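/- Let $D\ge 1$. On $\mathbb R^{2D}$ with coordinates $X=(\tilde x_i,x^i)$ put $\partial_i=\partial/\partial x^i$, $\tilde\partial^i=\partial/\partial\tilde x_i$; repeated indices are summed. Let $U\subseteq\mathbb R^{2D}$ be open, and let $\mathcal E_{ij}$, $d$ (fields) and $\xi^i$, $\tilde\xi_i$ (gauge parameters) be smooth real functions on $U$ such that $g_{ij}=\tfrac12(\mathcal E_{ij}+\mathcal E_{ji})$ is invertible at each point of $U$, with inverse $g^{ij}$. Assume the strong constraint: $\partial_i\tilde\partial^iA=0$ on $U$ for every product $A$ of fields, gauge parameters and their derivatives. Notation. $\mathcal D_i=\partial_i-\mathcal E_{ik}\tilde\partial^k$, $\bar{\mathcal D}_i=\partial_i+\mathcal E_{ki}\tilde\partial^k$; indices are raised with $g^{ij}$. The first index of $\mathcal E_{ij}$ and the index of $\mathcal D_i$ are unbarred, the second index of $\mathcal E_{ij}$ and the index of $\bar{\mathcal D}_i$ are barred. For a covector $V_j$ with unbarred (respectively barred) index, $\nabla_iV_j=\mathcal D_iV_j-\Gamma_{ij}^kV_k$ (resp. $\mathcal D_iV_j-\Gamma_{i\bar j}^{\bar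 k}V_k$) and $\bar\nabla_iV_j=\bar{\mathcal D}_iV_j-\Gamma_{\bar ij}^kV_k$ (resp. $\bar{\mathcal D}_iV_j-\Gamma_{\bar i\bar j}^{\bar k}V_k$), where $\Gamma_{ij}^k=\tfrac12g^{kl}\mathcal D_i\mathcal E_{jl}$, $\Gamma_{\bar i\bar j}^{\bar k}=\tfrac12g^{kl}\bar{\mathcal D}_i\mathcal E_{lj}$, $\Gamma_{i\bar j}^{\bar k}=\tfrac12g^{kl}(\mathcal D_i\mathcal E_{lj}+\bar{\mathcal D}_j\mathcal E_{il}-\bar{\mathcal D}_l\mathcal E_{ij})$, $\Gamma_{\bar ij}^k=\tfrac12g^{kl}(\bar{\mathcal D}_i\mathcal E_{jl}+\mathcal D_j\mathcal E_{li}-\mathcal D_l\mathcal E_{ji})$; on tensors with several lower indices $\nabla,\bar\nabla$ act with one such term per index. The Ricci-like tensor of $(\mathcal E,d)$ is $$\begin{aligned}\mathcal K_{pq}={}&\tfrac14\big(\nabla^s\mathcal D_s\mathcal E_{pq}+\bar\nabla^s\bar{\mathcal D}_s\mathcal E_{pq}-2\nabla^s\mathcal D_p\mathcal E_{sq}-2\bar\nabla^s\bar{\mathcal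 D}_q\mathcal E_{ps}\big)-\big(\bar\nabla_q\mathcal D_pd+\nabla_p\bar{\mathcal D}_qd\big)\\&+\tfrac14g^{jk}\big(\bar{\mathcal D}_q\mathcal E_{pj}\mathcal D^i\mathcal E_{ik}+\tfrac12\bar{\mathcal D}_q\mathcal E_{ik}\mathcal D^i\mathcal E_{pj}+\mathcal D_p\mathcal E_{jq}\bar{\mathcal D}^i\mathcal E_{ki}+\tfrac12\mathcal D_p\mathcal E_{ki}\bar{\mathcal D}^i\mathcal E_{jq}\big)\\&-\tfrac14\big(\bar{\mathcal D}^j\mathcal E_{iq}\mathcal D^i\mathcal E_{pj}+\tfrac12\bar{\mathcal D}^i\mathcal E_{ji}\mathcal D^j\mathcal E_{pq}+\tfrac12\bar{\mathcal D}^i\mathcal E_{pq}\mathcal D^j\mathcal E_{ji}\big)-\tfrac14g^{ik}g^{jl}\bar{\mathcal D}_q\mathcal E_{ij}\mathcal D_p\mathcal E_{kl},\end{aligned}$$ with first index unbarred and second index barred. The gauge transformations are, with $\xi^M\partial_M=\xi^i\partial_i+\tilde\xi_i\tilde\partial^i$, $$\delta\mathcal E_{ij}=\mathcal D_i\tilde\xi_j-\bar{\mathcal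 D}_j\tilde\xi_i+\xi^M\partial_M\mathcal E_{ij}+\mathcal D_i\xi^k\mathcal E_{kj}+\bar{\mathcal D}_j\xi^k\mathcal E_{ik},\qquad \delta d=-\tfrac12(\partial_i\xi^i+\tilde\partial^i\tilde\xi_i)+\xi^M\partial_Md,$$ and $\delta\mathcal K_{pq}=\frac{d}{dt}\big|_{t=0}\mathcal K_{pq}[\mathcal E+t\,\delta\mathcal E,\,d+t\,\delta d]$. Put $T^{kl}=\tilde\partial^l\xi^k-\tilde\partial^k\xi^l$, $\mathcal L_\xi\mathcal K_{pq}=\xi^k\partial_k\mathcal K_{pq}+\partial_p\xi^k\mathcal K_{kq}+\partial_q\xi^k\mathcal K_{pk}$, $\mathcal L_{\tilde\xi}\mathcal K_{pq}=\tilde\xi_k\tilde\partial^k\mathcal K_{pq}-\tilde\partial^k\tilde\xi_p\mathcal K_{kq}-\tilde\partial^k\tilde\xi_q\mathcal K_{pk}$, $\eta_i=-\tilde\xi_i+\mathcal E_{ij}\xi^j$ (unbarred) and $\bar\eta_i=\tilde\xi_i+\mathcal E_{ji}\xi^j$ (barred). Claims. (1) At every point of $U$ the derivative $\delta\mathcal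 K_{pq}$ exists and $$\delta\mathcal K_{pq}=\mathcal L_\xi\mathcal K_{pq}+\mathcal L_{\tilde\xi}\mathcal K_{pq}+\mathcal E_{pk}T^{kl}\mathcal K_{lq}+\mathcal E_{lq}T^{kl}\mathcal K_{pk}.$$ (2) Equivalently, $\delta\mathcal K_{pq}=F_{pq}+N^{(1)}_{pq}+N^{(2)}_{pq}$ with $$F_{pq}=\tfrac12(\eta\cdot\nabla+\bar\eta\cdot\bar\nabla)\mathcal K_{pq}+\tfrac12(\bar\nabla_q\bar\eta^k-\bar\nabla^k\bar\eta_q)\mathcal K_{pk}+\tfrac12(\nabla_p\eta^k-\nabla^k\eta_p)\mathcal K_{kq},$$ $$N^{(1)}_{pq}=\tfrac12g^{kl}(\bar\nabla_q\eta_l+\nabla_l\bar\eta_q)\mathcal K_{pk},\qquad N^{(2)}_{pq}=\tfrac12g^{kl}(\nabla_p\bar\eta_l+\bar\nabla_l\eta_p)\mathcal K_{kq}.$$ (3) Let $h=\begin{pmatrix}a&b\\c&e\end{pmatrix}\in O(D,D)$, i.e. $h^t\begin{pmatrix}0&1\\1&0\end{pmatrix}h=\begin{pmatrix}0&1\\1&0\end{pmatrix}$,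 act by $X'=hX$, $\mathcal E'(X')=(a\mathcal E(X)+b)(c\mathcal E(X)+e)^{-1}$, $d'(X')=d(X)$, $(\tilde\xi',\xi')(X')=h\,(\tilde\xi,\xi)(X)$. Call an expression $T_{pq}$ in the fields and gauge parameters $O(D,D)$ covariant if, with $M=e^t-\mathcal Ec^t$ and $\bar M=e^t+\mathcal E^tc^t$, one has $T_{pq}(X)=M_p{}^k(X)\bar M_q{}^l(X)T'_{kl}(X')$ on $U$ for all $U$, all fields and gauge parameters as above and all $h\in O(D,D)$ such that $c\mathcal E+e$ is invertible on $U$. Then $F_{pq}$ is $O(D,D)$ covariant, whereas $N^{(1)}_{pq}$, $N^{(2)}_{pq}$, $N^{(1)}_{pq}+N^{(2)}_{pq}$ and $\delta\mathcal K_{pq}$ are not. (4) If all fields and gauge parameters are independent of $\tilde x$, in the sense that every $\tilde\partial^i$ annihilates them on $U$ (the strong constraint then holds automatically), then $\delta\mathcal K_{pq}=\mathcal L_\xi\mathcal K_{pq}$, the ordinary Lie derivative. -/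

import Mathlib

open scoped BigOperators ContDiff

noncomputable section

namespace DFT

/-- The doubled index `M`: `Sum.inl i` labels the winding coordinate `x̃_i` and
`Sum.inr i` labels the momentum coordinate `x^i`. -/
abbrev DIdx (D : ℕ) := Fin D ⊕ Fin D

/-- A point `X = (x̃, x)` of the doubled space `ℝ^{2D}`. -/
abbrev Doubled (D : ℕ) := DIdx D → ℝ

/-- Real functions on the doubled space. -/
abbrev Sc (D : ℕ) := Doubled D → ℝ

variable {D : ℕ}

/-- The partial derivative `∂_M f`. -/
def pd (M : DIdx D) (f : Sc D) : Sc D := fun X => fderiv ℝ f X (Pi.single M 1)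

/-- `∂_i = ∂/∂x^i`. -/
def pdx (i : Fin D) (f : Sc D) : Sc D := pd (Sum.inr i) f

/-- `∂̃^i = ∂/∂x̃_i`. -/
def pdt (i : Fin D) (f : Sc D) : Sc D := pd (Sum.inl i) f

/-- The dynamical fields: `E i j` is `ℰ_{ij}` and `d` is the dilaton. -/
structure Fields (D : ℕ) where
  E : Fin D → Fin D → Sc D
  d : Sc D

/-- The gauge parameters: `xi i` is `ξ^i` and `xit i` is `ξ̃_i`. -/
structure GaugeParam (D : ℕ) where
  xi : Fin D → Sc D
  xit : Fin D → Sc D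

/-- The matrix `ℰ(X)`. -/
def Fields.EMat (Φ : Fields D) (X : Doubled D) : Matrix (Fin D) (Fin D) ℝ :=
  Matrix.of fun i j => Φ.E i j X

/-- The metric `g_{ij} = (ℰ_{ij} + ℰ_{ji}) / 2` as a matrix at `X`. -/
def Fields.gMat (Φ : Fields D) (X : Doubled D) : Matrix (Fin D) (Fin D) ℝ :=
  Matrix.of fun i j => (1 / 2 : ℝ) * (Φ.E i j X + Φ.E j i X)

/-- The inverse metric `g^{ij}`. -/
def Fields.gInv (Φ : Fields D) (i j : Fin D) : Sc D := fun X => (Φ.gMat X)⁻¹ i j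

/-! ### Calligraphic and covariant derivatives -/

/-- The two kinds of indices, unbarred and barred. -/
inductive Kind where
  | unb : Kind
  | bar : Kind

open Kind

/-- `calD Φ unb i = 𝒟_i = ∂_i - ℰ_{ik} ∂̃^k` and `calD Φ bar i = 𝒟̄_i = ∂_i + ℰ_{ki} ∂̃^k`. -/
def calD (Φ : Fields D) : Kind → Fin D → Sc D → Sc D
  | unb, i, f => fun X => pdx i f X - ∑ k, Φ.E i k X * pdt k f X
  | bar, i, f => fun X => pdx i f X + ∑ k, Φ.E k i X * pdt k f X

/-- The derivative with raised index, `g^{im} 𝒟_m` or `g^{im} 𝒟̄_m`. -/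
def calDUp (Φ : Fields D) (κ : Kind) (i : Fin D) (f : Sc D) : Sc D :=
  fun X => ∑ m, Φ.gInv i m X * calD Φ κ m f X

/-- The Christoffel-like symbols: `Gam Φ κ τ i j k` is `Γ_{ij}^k`, where `κ` is the kind of the
index `i` and `τ` is the kind of the indices `j` and `k`. -/
def Gam (Φ : Fields D) : Kind → Kind → Fin D → Fin D → Fin D → Sc D
  | unb, bar, i, j, k => fun X => (1 / 2 : ℝ) * ∑ l, Φ.gInv k l X *
      (calD Φ unb i (Φ.E l j) X + calD Φ bar j (Φ.E i l) X - calD Φ bar l (Φ.E i j) X)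
  | unb, unb, i, j, k => fun X => (1 / 2 : ℝ) * ∑ l, Φ.gInv k l X * calD Φ unb i (Φ.E j l) X
  | bar, unb, i, j, k => fun X => (1 / 2 : ℝ) * ∑ l, Φ.gInv k l X *
      (calD Φ bar i (Φ.E j l) X + calD Φ unb j (Φ.E l i) X - calD Φ unb l (Φ.E j i) X)
  | bar, bar, i, j, k => fun X => (1 / 2 : ℝ) * ∑ l, Φ.gInv k l X * calD Φ bar i (Φ.E l j) X

/-- `∇_i V_j` (`κ = unb`) or `∇̄_i V_j` (`κ = bar`), the index of `V` being of kind `τ`. -/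
def cov1 (Φ : Fields D) (κ τ : Kind) (i : Fin D) (V : Fin D → Sc D) (j : Fin D) : Sc D :=
  fun X => calD Φ κ i (V j) X - ∑ k, Gam Φ κ τ i j k X * V k X

/-- The covariant derivative of a tensor `T_{pq}` with indices of kinds `τ₁`, `τ₂`. -/
def cov2 (Φ : Fields D) (κ τ₁ τ₂ : Kind) (i : Fin D) (T : Fin D → Fin D → Sc D)
    (p q : Fin D) : Sc D :=
  fun X => calD Φ κ i (T p q) X
    - ∑ k, Gam Φ κ τ₁ i p k X * T k q X - ∑ k, Gam Φ κ τ₂ i q k X * T p k X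

/-- The covariant derivative of a tensor `T_{spq}` with indices of kinds `τ₀`, `τ₁`, `τ₂`. -/
def cov3 (Φ : Fields D) (κ τ₀ τ₁ τ₂ : Kind) (i : Fin D) (T : Fin D → Fin D → Fin D → Sc D)
    (s p q : Fin D) : Sc D :=
  fun X => calD Φ κ i (T s p q) X
    - ∑ k, Gam Φ κ τ₀ i s k X * T k p q X - ∑ k, Gam Φ κ τ₁ i p k X * T s k q X
    - ∑ k, Gam Φ κ τ₂ i q k X * T s p k X

/-- The tensor `𝒟_s ℰ_{pq}` (indices unbarred, unbarred, barred) or `𝒟̄_s ℰ_{pq}` (indices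
barred, unbarred, barred). -/
def DE (Φ : Fields D) (κ : Kind) (s p q : Fin D) : Sc D := calD Φ κ s (Φ.E p q)

/-- The tensor `𝒟^s ℰ_{pq}` or `𝒟̄^s ℰ_{pq}`. -/
def DEUp (Φ : Fields D) (κ : Kind) (s p q : Fin D) : Sc D := calDUp Φ κ s (Φ.E p q)

/-- The Ricci-like tensor `𝒦_{pq}` (first index unbarred, second index barred). -/
def Ricci (Φ : Fields D) (p q : Fin D) : Sc D := fun X =>
  (1 / 4 : ℝ) * (∑ s, ∑ r, Φ.gInv s r X *
      (cov3 Φ unb unb unb bar r (DE Φ unb) s p q X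
        + cov3 Φ bar bar unb bar r (DE Φ bar) s p q X
        - 2 * cov3 Φ unb unb unb bar r (DE Φ unb) p s q X
        - 2 * cov3 Φ bar bar unb bar r (DE Φ bar) q p s X))
  - (cov1 Φ bar unb q (fun i => calD Φ unb i Φ.d) p X
      + cov1 Φ unb bar p (fun i => calD Φ bar i Φ.d) q X)
  + (1 / 4 : ℝ) * (∑ j, ∑ k, ∑ i, Φ.gInv j k X *
      (DE Φ bar q p j X * DEUp Φ unb i i k X
        + (1 / 2 : ℝ) * (DE Φ bar q i k X * DEUp Φ unb i p j X)
        + DE Φ unb p j q X * DEUp Φ bar i k i X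
        + (1 / 2 : ℝ) * (DE Φ unb p k i X * DEUp Φ bar i j q X)))
  - (1 / 4 : ℝ) * (∑ i, ∑ j,
      (DEUp Φ bar j i q X * DEUp Φ unb i p j X
        + (1 / 2 : ℝ) * (DEUp Φ bar i j i X * DEUp Φ unb j p q X)
        + (1 / 2 : ℝ) * (DEUp Φ bar i p q X * DEUp Φ unb j j i X)))
  - (1 / 4 : ℝ) * (∑ i, ∑ j, ∑ k, ∑ l, Φ.gInv i k X * Φ.gInv j l X *
      (DE Φ bar q i j X * DE Φ unb p k l X))

/-! ### Gauge transformations -/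

/-- The transport term `ξ^M ∂_M f = ξ^i ∂_i f + ξ̃_i ∂̃^i f`. -/
def transport (Λ : GaugeParam D) (f : Sc D) : Sc D :=
  fun X => ∑ i, (Λ.xi i X * pdx i f X + Λ.xit i X * pdt i f X)

/-- The gauge variation `δℰ_{ij}`. -/
def deltaE (Φ : Fields D) (Λ : GaugeParam D) (i j : Fin D) : Sc D := fun X =>
  calD Φ unb i (Λ.xit j) X - calD Φ bar j (Λ.xit i) X + transport Λ (Φ.E i j) X
    + ∑ k, (calD Φ unb i (Λ.xi k) X * Φ.E k j X + calD Φ bar j (Λ.xi k) X * Φ.E i k X)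

/-- The gauge variation `δd = -½ ∂_M ξ^M + ξ^M ∂_M d`. -/
def deltaDil (Φ : Fields D) (Λ : GaugeParam D) : Sc D := fun X =>
  -(1 / 2 : ℝ) * (∑ i, (pdx i (Λ.xi i) X + pdt i (Λ.xit i) X)) + transport Λ Φ.d X

/-- The gauge-varied fields `(ℰ + t δℰ, d + t δd)`. -/
def gaugeVaried (Φ : Fields D) (Λ : GaugeParam D) (t : ℝ) : Fields D where
  E i j := fun X => Φ.E i j X + t * deltaE Φ Λ i j X
  d := fun X => Φ.d X + t * deltaDil Φ Λ X

/-- The gauge transformation `δ𝒦_{pq}` induced by that of `ℰ` and `d`. -/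
def deltaRicci (Φ : Fields D) (Λ : GaugeParam D) (p q : Fin D) : Sc D :=
  fun X => deriv (fun t => Ricci (gaugeVaried Φ Λ t) p q X) 0

/-- The Lie derivative `ℒ_ξ T_{pq} = ξ^k ∂_k T_{pq} + ∂_p ξ^k T_{kq} + ∂_q ξ^k T_{pk}`. -/
def lieXi (Λ : GaugeParam D) (T : Fin D → Fin D → Sc D) (p q : Fin D) : Sc D := fun X =>
  ∑ k, (Λ.xi k X * pdx k (T p q) X + pdx p (Λ.xi k) X * T k q X + pdx q (Λ.xi k) X * T p k X)

/-- The dual Lie derivative `ℒ_ξ̃ T_{pq} = ξ̃_k ∂̃^k T_{pq} - ∂̃^k ξ̃_p T_{kq} - ∂̃^k ξ̃_q T_{pk}`. -/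
def lieXit (Λ : GaugeParam D) (T : Fin D → Fin D → Sc D) (p q : Fin D) : Sc D := fun X =>
  ∑ k, (Λ.xit k X * pdt k (T p q) X - pdt k (Λ.xit p) X * T k q X - pdt k (Λ.xit q) X * T p k X)

/-- `T^{kl} = ∂̃^l ξ^k - ∂̃^k ξ^l`. -/
def Tkl (Λ : GaugeParam D) (k l : Fin D) : Sc D :=
  fun X => pdt l (Λ.xi k) X - pdt k (Λ.xi l) X

/-- `η_i = -ξ̃_i + ℰ_{ij} ξ^j` (unbarred index). -/
def eta (Φ : Fields D) (Λ : GaugeParam D) (i : Fin D) : Sc D :=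
  fun X => -Λ.xit i X + ∑ j, Φ.E i j X * Λ.xi j X

/-- `η̄_i = ξ̃_i + ℰ_{ji} ξ^j` (barred index). -/
def etaBar (Φ : Fields D) (Λ : GaugeParam D) (i : Fin D) : Sc D :=
  fun X => Λ.xit i X + ∑ j, Φ.E j i X * Λ.xi j X

/-- `½ (η·∇ + η̄·∇̄) 𝒦_{pq} + ½ (∇̄_q η̄^k - ∇̄^k η̄_q) 𝒦_{pk} + ½ (∇_p η^k - ∇^k η_p) 𝒦_{kq}`. -/
def firstLine (Φ : Fields D) (Λ : GaugeParam D) (p q : Fin D) : Sc D := fun X =>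
  (1 / 2 : ℝ) * (∑ k, ∑ l, Φ.gInv k l X *
      (eta Φ Λ k X * cov2 Φ unb unb bar l (Ricci Φ) p q X
        + etaBar Φ Λ k X * cov2 Φ bar unb bar l (Ricci Φ) p q X))
  + (1 / 2 : ℝ) * (∑ k, ∑ l, Φ.gInv k l X *
      (cov1 Φ bar bar q (etaBar Φ Λ) l X - cov1 Φ bar bar l (etaBar Φ Λ) q X) * Ricci Φ p k X)
  + (1 / 2 : ℝ) * (∑ k, ∑ l, Φ.gInv k l X *
      (cov1 Φ unb unb p (eta Φ Λ) l X - cov1 Φ unb unb l (eta Φ Λ) p X) * Ricci Φ k q X)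

/-- `½ g^{kl} (∇̄_q η_l + ∇_l η̄_q) 𝒦_{pk}`. -/
def extraOne (Φ : Fields D) (Λ : GaugeParam D) (p q : Fin D) : Sc D := fun X =>
  (1 / 2 : ℝ) * (∑ k, ∑ l, Φ.gInv k l X *
      (cov1 Φ bar unb q (eta Φ Λ) l X + cov1 Φ unb bar l (etaBar Φ Λ) q X) * Ricci Φ p k X)

/-- `½ g^{kl} (∇_p η̄_l + ∇̄_l η_p) 𝒦_{kq}`. -/
def extraTwo (Φ : Fields D) (Λ : GaugeParam D) (p q : Fin D) : Sc D := fun X =>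
  (1 / 2 : ℝ) * (∑ k, ∑ l, Φ.gInv k l X *
      (cov1 Φ unb bar p (etaBar Φ Λ) l X + cov1 Φ bar unb l (eta Φ Λ) p X) * Ricci Φ k q X)

/-! ### Regularity and the strong constraint -/

/-- All fields and gauge parameters are smooth on `U` and the metric is nondegenerate there. -/
structure Regular (U : Set (Doubled D)) (Φ : Fields D) (Λ : GaugeParam D) : Prop where
  smooth_E : ∀ i j, ContDiffOn ℝ ∞ (Φ.E i j) U
  smooth_d : ContDiffOn ℝ ∞ Φ.d U
  smooth_xi : ∀ i, ContDiffOn ℝ ∞ (Λ.xi i) U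
  smooth_xit : ∀ i, ContDiffOn ℝ ∞ (Λ.xit i) U
  nondeg : ∀ X ∈ U, (Φ.gMat X).det ≠ 0

/-- The products of fields and gauge parameters, and of their derivatives. -/
inductive FieldProduct (Φ : Fields D) (Λ : GaugeParam D) : Sc D → Prop
  | E (i j : Fin D) : FieldProduct Φ Λ (Φ.E i j)
  | d : FieldProduct Φ Λ Φ.d
  | xi (i : Fin D) : FieldProduct Φ Λ (Λ.xi i)
  | xit (i : Fin D) : FieldProduct Φ Λ (Λ.xit i)
  | deriv (M : DIdx D) (A : Sc D) : FieldProduct Φ Λ A → FieldProduct Φ Λ (pd M A)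
  | mul (A B : Sc D) : FieldProduct Φ Λ A → FieldProduct Φ Λ B →
      FieldProduct Φ Λ (fun X => A X * B X)

/-- The strong constraint on `U`: `∂^M ∂_M = ∂_i ∂̃^i + ∂̃^i ∂_i` annihilates all products of fields
and gauge parameters. -/
def StrongConstraint (U : Set (Doubled D)) (Φ : Fields D) (Λ : GaugeParam D) : Prop :=
  ∀ A, FieldProduct Φ Λ A → ∀ X ∈ U, ∑ i, (pdx i (pdt i A) X + pdt i (pdx i A) X) = 0

/-- Nothing depends on `x̃` on `U`: `∂̃^i` annihilates all fields and gauge parameters. -/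
def NoWinding (U : Set (Doubled D)) (Φ : Fields D) (Λ : GaugeParam D) : Prop :=
  ∀ X ∈ U, ∀ k, (∀ i j, pdt k (Φ.E i j) X = 0) ∧ pdt k Φ.d X = 0 ∧
    (∀ i, pdt k (Λ.xi i) X = 0) ∧ (∀ i, pdt k (Λ.xit i) X = 0)

/-! ### `O(D,D)` transformations -/

/-- Matrices acting on doubled vectors, in blocks `a b; c d`. -/
abbrev DMat (D : ℕ) := Matrix (DIdx D) (DIdx D) ℝ

/-- `h ∈ O(D,D)`, that is, `hᵗ η h = η` for `η = (0 1; 1 0)`. -/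
def IsODD (h : DMat D) : Prop :=
  h.transpose * Matrix.fromBlocks 0 1 1 0 * h = Matrix.fromBlocks 0 1 1 0

/-- The matrix `c ℰ(X) + d`. -/
def denomMat (h : DMat D) (Φ : Fields D) (X : Doubled D) : Matrix (Fin D) (Fin D) ℝ :=
  h.toBlocks₂₁ * Φ.EMat X + h.toBlocks₂₂

/-- The transformed fields `ℰ'(hX) = (a ℰ(X) + b) (c ℰ(X) + d)⁻¹`, `d'(hX) = d(X)`. -/
def actFields (h : DMat D) (Φ : Fields D) : Fields D where
  E i j := fun X' =>
    ((h.toBlocks₁₁ * Φ.EMat (h⁻¹.mulVec X') + h.toBlocks₁₂)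
      * (denomMat h Φ (h⁻¹.mulVec X'))⁻¹) i j
  d := fun X' => Φ.d (h⁻¹.mulVec X')

/-- The doubled vector `ξ^M = (ξ̃_i, ξ^i)` at `X`. -/
def GaugeParam.vec (Λ : GaugeParam D) (X : Doubled D) : DIdx D → ℝ :=
  Sum.elim (fun i => Λ.xit i X) (fun i => Λ.xi i X)

/-- The transformed gauge parameters `ξ'(hX) = h ξ(X)`. -/
def actGauge (h : DMat D) (Λ : GaugeParam D) : GaugeParam D where
  xi i := fun X' => h.mulVec (Λ.vec (h⁻¹.mulVec X')) (Sum.inr i)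
  xit i := fun X' => h.mulVec (Λ.vec (h⁻¹.mulVec X')) (Sum.inl i)

/-- `M(X) = dᵗ - ℰ(X) cᵗ`, which acts on unbarred indices. -/
def MMat (h : DMat D) (Φ : Fields D) (X : Doubled D) : Matrix (Fin D) (Fin D) ℝ :=
  h.toBlocks₂₂.transpose - Φ.EMat X * h.toBlocks₂₁.transpose

/-- `M̄(X) = dᵗ + ℰ(X)ᵗ cᵗ`, which acts on barred indices. -/
def MBarMat (h : DMat D) (Φ : Fields D) (X : Doubled D) : Matrix (Fin D) (Fin D) ℝ :=
  h.toBlocks₂₂.transpose + (Φ.EMat X).transpose * h.toBlocks₂₁.transpose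

/-- The object `T_{pq}`, built out of fields and gauge parameters, is an `O(D,D)` tensor whose
first index is unbarred and whose second index is barred:
`T_{pq}(X) = M_p{}^k(X) M̄_q{}^l(X) T'_{kl}(hX)` for all `h ∈ O(D,D)`. -/
def IsODDTensor (T : Fields D → GaugeParam D → Fin D → Fin D → Sc D) : Prop :=
  ∀ (U : Set (Doubled D)) (Φ : Fields D) (Λ : GaugeParam D), IsOpen U → Regular U Φ Λ →
    StrongConstraint U Φ Λ → ∀ h : DMat D, IsODD h →
    (∀ X ∈ U, IsUnit (denomMat h Φ X).det) → ∀ X ∈ U, ∀ p q,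
      T Φ Λ p q X = ∑ k, ∑ l, MMat h Φ X p k * MBarMat h Φ X q l *
        T (actFields h Φ) (actGauge h Λ) k l (h.mulVec X)

end DFT

end

noncomputable section

namespace DFT

open Kind Finset

/-! Everything rests on one identity: up to sign, 𝒦 is the generalized Ricci tensor (`genRicci`)
Ric_{pq} = 𝒟̄_k Γ_{pq̄}^k + Γ_{pq̄}^k w_k − 𝒟_p w_q − Γ_{k̄p}^m Γ_{mq̄}^k, which involves only the
mixed Christoffel-like symbols and the divergence w_k of the frame vector 𝒟̄_k for the density
e^{-2d} (`ricci_eq_neg_genRicci`). Its second derivatives of ℰ are matched to those of 𝒦 by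
commutators and by the agreement of the two Laplacians to leading order. The remaining terms,
quadratic in 𝒟ℰ and 𝒟̄ℰ, cancel by the index symmetries of a contraction with two inverse metrics
(`quad_first_derivatives`).

Ric is tensorial for a structural reason. When the barred and unbarred frames are changed by two
matrices, the mixed symbols obey the inhomogeneous law of a connection and w that of a divergence.
The inhomogeneous terms cancel because [𝒟_p, 𝒟̄_q] = Γ_{pq̄}^k 𝒟̄_k − Γ_{q̄p}^k 𝒟_k (`cD_comm_Gam`),
which needs the strong constraint. The argument is used twice. Infinitesimally, for gauge
transformations: after the transport term is removed, the variation is a twisted derivation `σ`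
acting on frame indices through matrices `rot`, so that δ𝒦 = ξ^M∂_M𝒦 plus one rotation per index
(`σ_genRicci`, `δ_ricci`). Expanding `rot` in partial derivatives gives the Lie derivative form;
expanding it in covariant derivatives of η and η̄ gives F + N⁽¹⁾ + N⁽²⁾ (`firstLine_add_extra`).
Finitely, for O(D,D): the matrices are M and M̄ (`ODDPair.genRicci_eq`). In F every contraction
pairs two indices of the same kind and is therefore covariant (`ODDPair.firstLine_eq`).

N⁽¹⁾ and N⁽²⁾ contract indices of unlike kind. That they are not covariant is seen on ℰ = 1 with a
dilaton quadratic in one coordinate, under the exchange of x and x̃: covariance would make N change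
sign, and it does not.

The computations take place in a commutative algebra with commuting derivations all of whose
elements satisfy the strong constraint (`Background`). Arbitrary smooth functions do not satisfy it,
so for given fields the algebra consists of the functions generated by fields, parameters and their
derivatives under ring operations and inversion (`GenSystem`). A `Slice` carries algebraic
identities back to functions on ℝ^{2D}. Adjoining the parameter t gives the varied fields, while the
O(D,D) transform lives on the original algebra with recombined derivations. -/

/-- The element `1/2` of a real algebra. -/
def half (A : Type*) [CommRing A] [Algebra ℝ A] : A := algebraMap ℝ A (1 / 2)

lemma two_mul_half (A : Type*) [CommRing A] [Algebra ℝ A] : 2 * half A = 1 := by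
  have h : (2 : A) = algebraMap ℝ A 2 := (map_ofNat (algebraMap ℝ A) 2).symm
  rw [half, h, ← map_mul]
  norm_num

lemma half_mul {A : Type*} [CommRing A] [Algebra ℝ A] (x : A) : half A * x = (1 / 2 : ℝ) • x :=
  (Algebra.smul_def _ _).symm

lemma map_half {A A' : Type*} [CommRing A] [Algebra ℝ A] [CommRing A'] [Algebra ℝ A']
    (q : A →ₐ[ℝ] A') : q (half A) = half A' := q.commutes _

lemma derivation_half {A : Type*} [CommRing A] [Algebra ℝ A] (δ : Derivation ℝ A A) :
    δ (half A) = 0 := δ.map_algebraMap _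

/-- Derivation rule with multiplication in place of scalar multiplication. -/
lemma derivation_mul {A : Type*} [CommRing A] [Algebra ℝ A] (δ : Derivation ℝ A A) (f g : A) :
    δ (f * g) = f * δ g + δ f * g := by
  rw [δ.leibniz, smul_eq_mul, smul_eq_mul, mul_comm g]

lemma derivation_sum_apply {A ι : Type*} [CommRing A] [Algebra ℝ A] (s : Finset ι)
    (δ : ι → Derivation ℝ A A) (f : A) : (∑ i ∈ s, δ i) f = ∑ i ∈ s, δ i f := by
  classical
  induction s using Finset.induction_on with
  | empty => simp
  | insert a s ha ih => simp [sum_insert ha, ih]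

/-! ### Calculus of the calligraphic derivatives over an abstract algebra. -/

/-- A pair `(ℰ, d)` with entries in a real algebra carrying commuting derivations `∂_i`, `∂̃^i`
such that all elements of the algebra satisfy the strong constraint. -/
structure Background (D : ℕ) (A : Type*) [CommRing A] [Algebra ℝ A] where
  dx : Fin D → Derivation ℝ A A
  dt : Fin D → Derivation ℝ A A
  dx_dx : ∀ i j f, dx i (dx j f) = dx j (dx i f)
  dx_dt : ∀ i j f, dx i (dt j f) = dt j (dx i f)
  dt_dt : ∀ i j f, dt i (dt j f) = dt j (dt i f)
  sc : ∀ f g, ∑ i, (dx i f * dt i g + dt i f * dx i g) = 0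
  box : ∀ f, ∑ i, dx i (dt i f) = 0
  E : Fin D → Fin D → A
  d : A
  gI : Fin D → Fin D → A
  gI_symm : ∀ i j, gI i j = gI j i
  gI_g : ∀ i j, ∑ k, gI i k * (E k j + E j k) = if i = j then 2 else 0

namespace Background

variable {D : ℕ} {A : Type*} [CommRing A] [Algebra ℝ A] (B : Background D A)

/-- The derivations `𝒟_i` and `𝒟̄_i`. -/
def cD : Kind → Fin D → Derivation ℝ A A
  | unb, i => B.dx i - ∑ k, B.E i k • B.dt k
  | bar, i => B.dx i + ∑ k, B.E k i • B.dt k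

/-- The Christoffel-like symbols. -/
def Gam : Kind → Kind → Fin D → Fin D → Fin D → A
  | unb, bar, i, j, k => half A * ∑ l, B.gI k l *
      (B.cD unb i (B.E l j) + B.cD bar j (B.E i l) - B.cD bar l (B.E i j))
  | unb, unb, i, j, k => half A * ∑ l, B.gI k l * B.cD unb i (B.E j l)
  | bar, unb, i, j, k => half A * ∑ l, B.gI k l *
      (B.cD bar i (B.E j l) + B.cD unb j (B.E l i) - B.cD unb l (B.E j i))
  | bar, bar, i, j, k => half A * ∑ l, B.gI k l * B.cD bar i (B.E l j)

/-- The covariant derivative of a covector. -/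
def cov1 (κ τ : Kind) (i : Fin D) (V : Fin D → A) (j : Fin D) : A :=
  B.cD κ i (V j) - ∑ k, B.Gam κ τ i j k * V k

/-- The covariant derivative of a tensor with two indices. -/
def cov2 (κ τ₁ τ₂ : Kind) (i : Fin D) (T : Fin D → Fin D → A) (p q : Fin D) : A :=
  B.cD κ i (T p q) - ∑ k, B.Gam κ τ₁ i p k * T k q - ∑ k, B.Gam κ τ₂ i q k * T p k

/-- The covariant derivative of a tensor with three indices. -/
def cov3 (κ τ₀ τ₁ τ₂ : Kind) (i : Fin D) (T : Fin D → Fin D → Fin D → A) (s p q : Fin D) : A :=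
  B.cD κ i (T s p q) - ∑ k, B.Gam κ τ₀ i s k * T k p q - ∑ k, B.Gam κ τ₁ i p k * T s k q
    - ∑ k, B.Gam κ τ₂ i q k * T s p k

/-- The tensors `𝒟_s ℰ_{pq}` and `𝒟̄_s ℰ_{pq}`. -/
def DE (κ : Kind) (s p q : Fin D) : A := B.cD κ s (B.E p q)

/-- The tensors `𝒟^s ℰ_{pq}` and `𝒟̄^s ℰ_{pq}`. -/
def DEUp (κ : Kind) (s p q : Fin D) : A := ∑ m, B.gI s m * B.DE κ m p q

/-- The Ricci-like tensor `𝒦_{pq}`. -/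
def ricci (p q : Fin D) : A :=
  half A * half A * (∑ s, ∑ r, B.gI s r *
      (B.cov3 unb unb unb bar r (B.DE unb) s p q
        + B.cov3 bar bar unb bar r (B.DE bar) s p q
        - 2 * B.cov3 unb unb unb bar r (B.DE unb) p s q
        - 2 * B.cov3 bar bar unb bar r (B.DE bar) q p s))
  - (B.cov1 bar unb q (fun i => B.cD unb i B.d) p
      + B.cov1 unb bar p (fun i => B.cD bar i B.d) q)
  + half A * half A * (∑ j, ∑ k, ∑ i, B.gI j k *
      (B.DE bar q p j * B.DEUp unb i i k
        + half A * (B.DE bar q i k * B.DEUp unb i p j)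
        + B.DE unb p j q * B.DEUp bar i k i
        + half A * (B.DE unb p k i * B.DEUp bar i j q)))
  - half A * half A * (∑ i, ∑ j,
      (B.DEUp bar j i q * B.DEUp unb i p j
        + half A * (B.DEUp bar i j i * B.DEUp unb j p q)
        + half A * (B.DEUp bar i p q * B.DEUp unb j j i)))
  - half A * half A * (∑ i, ∑ j, ∑ k, ∑ l, B.gI i k * B.gI j l *
      (B.DE bar q i j * B.DE unb p k l))

/-- The divergence of the barred frame vector `𝒟̄_k` with respect to the density `e^{-2d}`. -/
def frameDiv (k : Fin D) : A := ∑ l, B.dt l (B.E l k) - 2 * B.cD bar k B.d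

/-- The generalized Ricci tensor, written with the mixed Christoffel symbols. -/
def genRicci (p q : Fin D) : A :=
  ∑ k, (B.cD bar k (B.Gam unb bar p q k) + B.Gam unb bar p q k * B.frameDiv k)
    - B.cD unb p (B.frameDiv q)
    - ∑ k, ∑ m, B.Gam bar unb k p m * B.Gam unb bar m q k

lemma cD_unb (i : Fin D) (f : A) :
    B.cD unb i f = B.dx i f - ∑ k, B.E i k * B.dt k f := by
  simp [cD, derivation_sum_apply]

lemma cD_bar (i : Fin D) (f : A) :
    B.cD bar i f = B.dx i f + ∑ k, B.E k i * B.dt k f := by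
  simp [cD, derivation_sum_apply]

/-- The background with `ℰ` transposed and `x̃` reversed, which exchanges the two kinds of
indices. -/
def swap : Background D A where
  dx := B.dx
  dt i := -B.dt i
  dx_dx := B.dx_dx
  dx_dt i j f := by simp [B.dx_dt]
  dt_dt i j f := by simp [B.dt_dt]
  sc f g := by
    have h := B.sc f g
    simp only [Derivation.neg_apply, mul_neg, neg_mul, ← neg_add, sum_neg_distrib, h, neg_zero]
  box f := by simp [B.box]
  E i j := B.E j i
  d := B.d
  gI := B.gI
  gI_symm := B.gI_symm
  gI_g i j := by rw [← B.gI_g i j]; exact sum_congr rfl fun k _ => by ring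

/-- The opposite kind. -/
def _root_.DFT.Kind.swap : Kind → Kind
  | unb => bar
  | bar => unb

/-- Transposing ℰ and reversing ∂̃ exchanges 𝒟 and 𝒟̄. With `swap_Gam` this yields the mirror image
of any statement proved for one choice of kinds. -/
lemma swap_cD (κ : Kind) (i : Fin D) : B.swap.cD κ i = B.cD κ.swap i := by
  cases κ <;> ext f <;> simp [cD, swap, Kind.swap, derivation_sum_apply, sub_eq_add_neg]

lemma swap_Gam (κ τ : Kind) (i j k : Fin D) : B.swap.Gam κ τ i j k = B.Gam κ.swap τ.swap i j k := by
  cases κ <;> cases τ <;> simp only [Gam, swap_cD, Kind.swap] <;> rfl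

lemma gI_mul_E (i : Fin D) (f : Fin D → A) :
    ∑ k, B.gI i k * ∑ j, (B.E k j + B.E j k) * f j = 2 * f i := by
  simp_rw [mul_sum]
  rw [sum_comm]
  simp_rw [← mul_assoc, ← sum_mul, B.gI_g]
  simp

lemma cD_bar_sub_cD_unb (i : Fin D) (f : A) :
    B.cD bar i f - B.cD unb i f = ∑ k, (B.E i k + B.E k i) * B.dt k f := by
  rw [cD_bar, cD_unb]
  simp_rw [add_mul, sum_add_distrib]
  ring

lemma gI_mul_cD_sub (i : Fin D) (f : A) :
    ∑ k, B.gI i k * (B.cD bar k f - B.cD unb k f) = 2 * B.dt i f := by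
  simp_rw [cD_bar_sub_cD_unb, gI_mul_E]

/-- Since 𝒟̄_i − 𝒟_i = 2g_{ik}∂̃^k, winding derivatives can be traded for calligraphic ones. -/
lemma dt_eq (k : Fin D) (f : A) :
    B.dt k f = half A * ∑ l, B.gI k l * (B.cD bar l f - B.cD unb l f) := by
  rw [gI_mul_cD_sub]
  linear_combination (-B.dt k f) * two_mul_half A

/-- The strong constraint in terms of the calligraphic derivatives. -/
lemma sc_cD (f g : A) :
    ∑ i, ∑ j, B.gI i j * (B.cD bar i f * B.cD bar j g) =
      ∑ i, ∑ j, B.gI i j * (B.cD unb i f * B.cD unb j g) := by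
  -- Telescoping leaves a factor 𝒟̄ − 𝒟 in each term, which g^{ij} turns into 2∂̃^i.
  have key : ∀ i j, B.cD bar i f * B.cD bar j g - B.cD unb i f * B.cD unb j g =
      (B.cD bar i f - B.cD unb i f) * B.cD bar j g
        + B.cD unb i f * (B.cD bar j g - B.cD unb j g) := fun i j => by ring
  rw [← sub_eq_zero]
  simp_rw [← sum_sub_distrib, ← mul_sub, key, mul_add, sum_add_distrib]
  have h1 : ∑ i, ∑ j, B.gI i j * ((B.cD bar i f - B.cD unb i f) * B.cD bar j g) =
      2 * ∑ j, B.dt j f * B.cD bar j g := by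
    rw [sum_comm, mul_sum]
    refine sum_congr rfl fun j _ => ?_
    rw [← mul_assoc, ← B.gI_mul_cD_sub, sum_mul]
    refine sum_congr rfl fun i _ => ?_
    rw [B.gI_symm]
    ring
  have h2 : ∑ i, ∑ j, B.gI i j * (B.cD unb i f * (B.cD bar j g - B.cD unb j g)) =
      2 * ∑ i, B.cD unb i f * B.dt i g := by
    rw [mul_sum]
    refine sum_congr rfl fun i _ => ?_
    rw [mul_left_comm, ← B.gI_mul_cD_sub, mul_sum]
    refine sum_congr rfl fun j _ => ?_
    ring
  rw [h1, h2, ← mul_add, ← sum_add_distrib]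
  -- The ℰ-terms cancel after renaming indices; what is left is the strong constraint for f and g.
  have h3 : ∑ j, (B.dt j f * B.cD bar j g + B.cD unb j f * B.dt j g) = 0 := by
    have h4 : ∑ j, ∑ k, B.E k j * (B.dt j f * B.dt k g) =
        ∑ j, ∑ k, B.E j k * (B.dt k f * B.dt j g) := sum_comm
    calc _ = ∑ i, (B.dx i f * B.dt i g + B.dt i f * B.dx i g)
        + (∑ j, ∑ k, B.E k j * (B.dt j f * B.dt k g)
          - ∑ j, ∑ k, B.E j k * (B.dt k f * B.dt j g)) := by
          simp_rw [← sum_sub_distrib, ← sum_add_distrib]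
          refine sum_congr rfl fun j _ => ?_
          rw [cD_bar, cD_unb, mul_add, sub_mul, mul_sum, sum_mul, sum_sub_distrib]
          have e1 : ∀ k, B.dt j f * (B.E k j * B.dt k g) = B.E k j * (B.dt j f * B.dt k g) :=
            fun k => by ring
          have e2 : ∀ k, B.E j k * B.dt k f * B.dt j g = B.E j k * (B.dt k f * B.dt j g) :=
            fun k => by ring
          simp_rw [e1, e2]
          ring
      _ = 0 := by rw [B.sc, h4, sub_self, add_zero]
  rw [h3, mul_zero]

/-- The partial derivatives labelled by the doubled index. -/
def der : DIdx D → Derivation ℝ A A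
  | .inl i => B.dt i
  | .inr i => B.dx i

/-- The vectors `e_i` and `ē_i` with `𝒟_i = e_i^M ∂_M` and `𝒟̄_i = ē_i^M ∂_M`. -/
def fr : Kind → Fin D → DIdx D → A
  | unb, i, .inl k => -B.E i k
  | bar, i, .inl k => B.E k i
  | _, i, .inr k => if i = k then 1 else 0

lemma der_comm (M N : DIdx D) (f : A) : B.der M (B.der N f) = B.der N (B.der M f) := by
  rcases M with i | i <;> rcases N with j | j <;>
    simp [der, B.dx_dx i j, B.dt_dt i j, B.dx_dt]

lemma cD_eq_sum_der (κ : Kind) (i : Fin D) (f : A) :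
    B.cD κ i f = ∑ M, B.fr κ i M * B.der M f := by
  cases κ <;> simp [cD_unb, cD_bar, fr, der, Fintype.sum_sum_type] <;> ring

/-- The momentum components of the frame vectors are 0 or 1, so only the winding components ±ℰ are
ever differentiated. -/
lemma derivation_fr (δ : Derivation ℝ A A) (κ : Kind) (i : Fin D) (k : Fin D) :
    δ (B.fr κ i (.inr k)) = 0 := by
  have h : B.fr κ i (.inr k) = if i = k then 1 else 0 := by cases κ <;> rfl
  rw [h]
  split_ifs <;> simp

/-- The second derivative of `f` along the frame vectors of kinds `κ` and `τ`. -/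
def hess (κ τ : Kind) (i j : Fin D) (f : A) : A :=
  ∑ M, ∑ N, B.fr κ i M * B.fr τ j N * B.der M (B.der N f)

/-- In `hess` no derivative falls on the frame, so symmetry is that of coordinate derivatives.
Commutators of calligraphic derivatives thereby reduce to derivatives of ℰ. -/
lemma hess_comm (κ τ : Kind) (i j : Fin D) (f : A) : B.hess κ τ i j f = B.hess τ κ j i f := by
  unfold hess
  rw [sum_comm]
  refine sum_congr rfl fun M _ => sum_congr rfl fun N _ => ?_
  rw [B.der_comm]
  ring

lemma cD_cD (κ τ : Kind) (i j : Fin D) (f : A) :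
    B.cD κ i (B.cD τ j f) = B.hess κ τ i j f + ∑ k, B.cD κ i (B.fr τ j (.inl k)) * B.dt k f := by
  have h : ∑ k, B.cD κ i (B.fr τ j (.inl k)) * B.dt k f =
      ∑ M, B.cD κ i (B.fr τ j M) * B.der M f := by
    simp [Fintype.sum_sum_type, derivation_fr, der]
  rw [h, B.cD_eq_sum_der τ j f, map_sum, hess, sum_comm, ← sum_add_distrib]
  refine sum_congr rfl fun N _ => ?_
  rw [derivation_mul, B.cD_eq_sum_der κ i (B.der N f), mul_sum]
  congr 1
  refine sum_congr rfl fun M _ => ?_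
  ring

lemma cD_cD_bar (κ : Kind) (i j : Fin D) (f : A) :
    B.cD κ i (B.cD bar j f) = B.hess κ bar i j f + ∑ k, B.cD κ i (B.E k j) * B.dt k f :=
  B.cD_cD κ bar i j f

lemma cD_cD_unb (κ : Kind) (i j : Fin D) (f : A) :
    B.cD κ i (B.cD unb j f) = B.hess κ unb i j f - ∑ k, B.cD κ i (B.E j k) * B.dt k f := by
  rw [cD_cD]
  simp [fr, sub_eq_add_neg]

/-- The commutator of `𝒟_p` and `𝒟̄_q`. -/
lemma cD_unb_bar_comm (p q : Fin D) (f : A) :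
    B.cD unb p (B.cD bar q f) - B.cD bar q (B.cD unb p f) =
      ∑ k, (B.cD unb p (B.E k q) + B.cD bar q (B.E p k)) * B.dt k f := by
  rw [cD_cD_bar, cD_cD_unb, B.hess_comm bar]
  simp_rw [add_mul, sum_add_distrib]
  ring

/-- The commutator of `𝒟_p` and `𝒟_q`. -/
lemma cD_unb_unb_comm (p q : Fin D) (f : A) :
    B.cD unb p (B.cD unb q f) - B.cD unb q (B.cD unb p f) =
      ∑ k, (B.cD unb q (B.E p k) - B.cD unb p (B.E q k)) * B.dt k f := by
  rw [cD_cD_unb, cD_cD_unb, B.hess_comm unb unb p]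
  simp_rw [sub_mul, sum_sub_distrib]
  ring

lemma hess_eq_sum_cD (κ τ : Kind) (i j : Fin D) (f : A) :
    B.hess κ τ i j f = ∑ M, B.fr κ i M * B.cD τ j (B.der M f) := by
  refine sum_congr rfl fun M _ => ?_
  rw [cD_eq_sum_der, mul_sum]
  refine sum_congr rfl fun N _ => ?_
  rw [B.der_comm]
  ring

lemma hess_bar_sub_hess_unb (τ : Kind) (i j : Fin D) (f : A) :
    B.hess bar τ i j f - B.hess unb τ i j f =
      ∑ k, (B.E i k + B.E k i) * B.cD τ j (B.dt k f) := by
  simp only [hess_eq_sum_cD, Fintype.sum_sum_type, fr, der, add_mul, sum_add_distrib, neg_mul,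
    sum_neg_distrib]
  ring

lemma gI_hess_sub (τ : Kind) (i j : Fin D) (f : A) :
    ∑ k, B.gI i k * (B.hess bar τ k j f - B.hess unb τ k j f) = 2 * B.cD τ j (B.dt i f) := by
  simp_rw [hess_bar_sub_hess_unb, gI_mul_E]

/-- Replacing one barred frame vector at a time, the difference of the two sides is 2𝒟̄_s∂̃^s f +
2𝒟_s∂̃^s f. There the ℰ-terms cancel by symmetry of ∂̃∂̃, and ∂_s∂̃^s f = 0. -/
lemma sum_hess_bar_eq (f : A) :
    ∑ s, ∑ r, B.gI s r * B.hess bar bar r s f = ∑ s, ∑ r, B.gI s r * B.hess unb unb r s f := by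
  have key : ∀ s r, B.hess bar bar r s f - B.hess unb unb r s f =
      (B.hess bar bar r s f - B.hess unb bar r s f)
        + (B.hess bar unb s r f - B.hess unb unb s r f) := fun s r => by
    rw [B.hess_comm bar unb s r, B.hess_comm unb unb s r]
    ring
  rw [← sub_eq_zero]
  simp_rw [← sum_sub_distrib, ← mul_sub, key, mul_add, sum_add_distrib, gI_hess_sub]
  have h1 : ∑ s, ∑ r, B.gI s r * (B.hess bar unb s r f - B.hess unb unb s r f) =
      ∑ r, 2 * B.cD unb r (B.dt r f) := by
    rw [sum_comm]
    refine sum_congr rfl fun r _ => ?_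
    rw [← gI_hess_sub]
    exact sum_congr rfl fun s _ => by rw [B.gI_symm]
  have h2 : ∑ s, ∑ k, B.E k s * B.dt k (B.dt s f) = ∑ s, ∑ k, B.E s k * B.dt k (B.dt s f) := by
    rw [sum_comm]
    exact sum_congr rfl fun s _ => sum_congr rfl fun k _ => by rw [B.dt_dt]
  rw [h1]
  simp_rw [cD_unb, cD_bar, mul_add, mul_sub, sum_add_distrib, sum_sub_distrib, ← mul_sum, B.box,
    h2]
  ring

/-- The two Laplacians built from the calligraphic derivatives agree up to first derivatives. -/
lemma laplacian_sub (f : A) :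
    ∑ s, ∑ r, B.gI s r * (B.cD unb r (B.cD unb s f) - B.cD bar r (B.cD bar s f)) =
      -∑ s, ∑ r, B.gI s r * ∑ k, (B.cD unb r (B.E s k) + B.cD bar r (B.E k s)) * B.dt k f := by
  have h := B.sum_hess_bar_eq f
  simp_rw [cD_cD_unb, cD_cD_bar, add_mul, sum_add_distrib, mul_sub, mul_add, sum_sub_distrib,
    sum_add_distrib]
  linear_combination -h

/-- The derivative of the inverse metric. -/
lemma derivation_gI (δ : Derivation ℝ A A) (i j : Fin D) :
    δ (B.gI i j) = -(half A * ∑ k, ∑ l, B.gI i k * B.gI j l * (δ (B.E k l) + δ (B.E l k))) := by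
  have h : ∀ l, ∑ k, (B.gI i k * (δ (B.E k l) + δ (B.E l k))
      + δ (B.gI i k) * (B.E k l + B.E l k)) = 0 := fun l => by
    have h1 := congrArg δ (B.gI_g i l)
    rw [map_sum] at h1
    simp_rw [derivation_mul, map_add] at h1
    rw [h1]
    split_ifs
    · exact δ.map_natCast 2
    · exact map_zero δ
  have h2 : ∑ l, B.gI j l * ∑ k, (B.E l k + B.E k l) * δ (B.gI i k) = 2 * δ (B.gI i j) :=
    B.gI_mul_E j fun k => δ (B.gI i k)
  have h3 : ∑ l, B.gI j l * ∑ k, (B.gI i k * (δ (B.E k l) + δ (B.E l k))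
      + δ (B.gI i k) * (B.E k l + B.E l k)) = 0 := by simp_rw [h]; simp
  have h4 : ∑ l, B.gI j l * ∑ k, (B.gI i k * (δ (B.E k l) + δ (B.E l k))
      + δ (B.gI i k) * (B.E k l + B.E l k)) =
      ∑ k, ∑ l, B.gI i k * B.gI j l * (δ (B.E k l) + δ (B.E l k)) + 2 * δ (B.gI i j) := by
    rw [← h2, sum_comm, ← sum_add_distrib]
    refine sum_congr rfl fun l _ => ?_
    rw [mul_sum, mul_sum, ← sum_add_distrib]
    exact sum_congr rfl fun k _ => by ring
  linear_combination (-δ (B.gI i j)) * two_mul_half A + half A * (h3 - h4)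

/-- The commutator of `𝒟_p` and `𝒟̄_q` in terms of the Christoffel-like symbols. -/
lemma cD_comm_Gam (p q : Fin D) (f : A) :
    B.cD unb p (B.cD bar q f) - B.cD bar q (B.cD unb p f) =
      ∑ k, B.Gam unb bar p q k * B.cD bar k f - ∑ k, B.Gam bar unb q p k * B.cD unb k f := by
  -- The bare commutator is half g^{kl}(𝒟_pℰ_{lq} + 𝒟̄_qℰ_{pl})(𝒟̄_k − 𝒟_k)f. The missing third
  -- terms of the two symbols are contractions of derivatives of ℰ_{pq} and f, which this instance
  -- of the strong constraint makes cancel.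
  have h := B.sc_cD f (B.E p q)
  have h1 : ∀ (V : Fin D → A) (κ : Kind), ∑ k, (half A * ∑ l, B.gI k l * V l) * B.cD κ k f =
      half A * ∑ k, ∑ l, B.gI k l * (V l * B.cD κ k f) := fun V κ => by
    simp_rw [mul_sum, sum_mul]
    exact sum_congr rfl fun k _ => sum_congr rfl fun l _ => by ring
  have h2 : ∑ k, (B.cD unb p (B.E k q) + B.cD bar q (B.E p k)) * B.dt k f =
      half A * ∑ k, ∑ l, B.gI k l * ((B.cD unb p (B.E l q) + B.cD bar q (B.E p l))
        * (B.cD bar k f - B.cD unb k f)) := by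
    rw [sum_comm, mul_sum]
    refine sum_congr rfl fun k _ => ?_
    rw [dt_eq, mul_sum, mul_sum, mul_sum]
    exact sum_congr rfl fun l _ => by rw [B.gI_symm]; ring
  rw [cD_unb_bar_comm, h2]
  simp only [Gam]
  rw [h1, h1, ← mul_sub]
  congr 1
  rw [← sub_eq_zero] at h ⊢
  rw [← h]
  simp_rw [← sum_sub_distrib]
  exact sum_congr rfl fun k _ => sum_congr rfl fun l _ => by ring

end Background

end DFT

end

/-! ### Contractions with two inverse metrics. -/

noncomputable section

namespace DFT

open Kind Finset

namespace Background

variable {D : ℕ} {A : Type*} [CommRing A] [Algebra ℝ A] (B : Background D A)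

/-- Contraction of four indices with two inverse metrics. -/
def quad : (Fin D → Fin D → Fin D → Fin D → A) →ₗ[A] A where
  toFun f := ∑ i, ∑ j, ∑ k, ∑ l, B.gI i j * B.gI k l * f i j k l
  map_add' f g := by simp only [Pi.add_apply, mul_add, sum_add_distrib]
  map_smul' c f := by
    simp only [Pi.smul_apply, smul_eq_mul, mul_sum, RingHom.id_apply, mul_left_comm]

lemma quad_apply (f : Fin D → Fin D → Fin D → Fin D → A) :
    B.quad f = ∑ i, ∑ j, ∑ k, ∑ l, B.gI i j * B.gI k l * f i j k l := rfl

/-- By symmetry of g^{ij}, `quad` is invariant under the eight permutations preserving the pairing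
{ij}{kl}. This lemma and its companions cover the seven nontrivial ones. -/
lemma quad_jikl (f : Fin D → Fin D → Fin D → Fin D → A) :
    B.quad (fun i j k l => f j i k l) = B.quad f := by
  rw [quad_apply, quad_apply, sum_comm]
  refine sum_congr rfl fun i _ => sum_congr rfl fun j _ => ?_
  rw [B.gI_symm]

lemma quad_ijlk (f : Fin D → Fin D → Fin D → Fin D → A) :
    B.quad (fun i j k l => f i j l k) = B.quad f := by
  rw [quad_apply, quad_apply]
  refine sum_congr rfl fun i _ => sum_congr rfl fun j _ => ?_
  rw [sum_comm]
  exact sum_congr rfl fun k _ => sum_congr rfl fun l _ => by rw [B.gI_symm l k]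

lemma quad_klij (f : Fin D → Fin D → Fin D → Fin D → A) :
    B.quad (fun i j k l => f k l i j) = B.quad f := by
  have h : ∀ F : Fin D → Fin D → Fin D → Fin D → A, ∑ i, ∑ j, ∑ k, ∑ l, F i j k l =
      ∑ x : Fin D × Fin D, ∑ y : Fin D × Fin D, F x.1 x.2 y.1 y.2 := fun F => by
    simp only [Fintype.sum_prod_type]
  rw [quad_apply, quad_apply, h, h, sum_comm]
  exact sum_congr rfl fun x _ => sum_congr rfl fun y _ => by ring

/-- The Christoffel-like symbols with all indices lowered, multiplied by two. -/
def gamLow : Kind → Kind → Fin D → Fin D → Fin D → A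
  | unb, bar, i, j, l => B.DE unb i l j + B.DE bar j i l - B.DE bar l i j
  | unb, unb, i, j, l => B.DE unb i j l
  | bar, unb, i, j, l => B.DE bar i j l + B.DE unb j l i - B.DE unb l j i
  | bar, bar, i, j, l => B.DE bar i l j

lemma Gam_eq (κ τ : Kind) (i j k : Fin D) :
    B.Gam κ τ i j k = half A * ∑ l, B.gI k l * B.gamLow κ τ i j l := by
  cases κ <;> cases τ <;> rfl

/-- The function `x` says which indices sit on the symbol, so that one statement serves every slot
of a covariant derivative. -/
lemma sum_gI_Gam (κ τ : Kind) (x : Fin D → Fin D → Fin D × Fin D) (T : Fin D → Fin D → Fin D → A) :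
    ∑ s, ∑ r, B.gI s r * ∑ k, B.Gam κ τ (x s r).1 (x s r).2 k * T s r k =
      half A * B.quad (fun s r k l => B.gamLow κ τ (x s r).1 (x s r).2 l * T s r k) := by
  simp_rw [Gam_eq, quad_apply, mul_sum, sum_mul, mul_sum]
  exact sum_congr rfl fun s _ => sum_congr rfl fun r _ => sum_congr rfl fun k _ =>
    sum_congr rfl fun l _ => by ring

/-- The contraction of a covariant derivative, `g^{sr} ∇_r T_{s…}`. -/
lemma sum_gI_cov3 (κ τ₀ τ₁ τ₂ : Kind) (T : Fin D → Fin D → Fin D → A)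
    (x : Fin D → Fin D × Fin D × Fin D) :
    ∑ s, ∑ r, B.gI s r * B.cov3 κ τ₀ τ₁ τ₂ r T (x s).1 (x s).2.1 (x s).2.2 =
      ∑ s, ∑ r, B.gI s r * B.cD κ r (T (x s).1 (x s).2.1 (x s).2.2)
      - half A * B.quad (fun s r k l =>
          B.gamLow κ τ₀ r (x s).1 l * T k (x s).2.1 (x s).2.2
          + B.gamLow κ τ₁ r (x s).2.1 l * T (x s).1 k (x s).2.2
          + B.gamLow κ τ₂ r (x s).2.2 l * T (x s).1 (x s).2.1 k) := by
  have h0 := B.sum_gI_Gam κ τ₀ (fun s r => (r, (x s).1)) (fun s r k => T k (x s).2.1 (x s).2.2)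
  have h1 := B.sum_gI_Gam κ τ₁ (fun s r => (r, (x s).2.1)) (fun s r k => T (x s).1 k (x s).2.2)
  have h2 := B.sum_gI_Gam κ τ₂ (fun s r => (r, (x s).2.2)) (fun s r k => T (x s).1 (x s).2.1 k)
  have h3 : ∀ f g h : Fin D → Fin D → Fin D → Fin D → A,
      B.quad (fun s r k l => f s r k l + g s r k l + h s r k l)
        = B.quad f + B.quad g + B.quad h := fun f g h => by
    rw [← map_add, ← map_add]; rfl
  rw [h3, mul_add, mul_add, ← h0, ← h1, ← h2]
  simp only [cov3, mul_sub, sum_sub_distrib]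
  ring

/-- Terms with a derivative `∂̃^k` as contractions of calligraphic derivatives. -/
lemma sum_gI_dt (x : Fin D → Fin D → Fin D → A) (f : Fin D → A) :
    ∑ s, ∑ r, B.gI s r * ∑ k, x s r k * B.dt k (f s) =
      half A * B.quad (fun s r k l => x s r k * (B.cD bar l (f s) - B.cD unb l (f s))) := by
  simp_rw [dt_eq, quad_apply, mul_sum]
  exact sum_congr rfl fun s _ => sum_congr rfl fun r _ => sum_congr rfl fun k _ =>
    sum_congr rfl fun l _ => by ring

lemma sum_derivation_gI (δ : Fin D → Derivation ℝ A A) (V : Fin D → Fin D → A) :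
    ∑ k, ∑ l, δ k (B.gI k l) * V k l =
      -(half A * B.quad (fun k i l j => (δ k (B.E i j) + δ k (B.E j i)) * V k l)) := by
  simp_rw [derivation_gI, neg_mul, sum_neg_distrib, quad_apply, mul_sum, sum_mul]
  congr 1
  refine sum_congr rfl fun k _ => ?_
  rw [sum_comm]
  refine sum_congr rfl fun i _ => sum_congr rfl fun l _ => sum_congr rfl fun j _ => ?_
  ring

end Background

end DFT

end

/-! ### Cancellation of the terms quadratic in first derivatives of ℰ. -/

noncomputable section

namespace DFT

open Kind Finset

namespace Background

variable {D : ℕ} {A : Type*} [CommRing A] [Algebra ℝ A] (B : Background D A)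

lemma quad_jilk (f : Fin D → Fin D → Fin D → Fin D → A) :
    B.quad (fun i j k l => f j i l k) = B.quad f :=
  (B.quad_jikl fun i j k l => f i j l k).trans (B.quad_ijlk f)

lemma quad_lkij (f : Fin D → Fin D → Fin D → Fin D → A) :
    B.quad (fun i j k l => f l k i j) = B.quad f :=
  (B.quad_klij fun i j k l => f j i k l).trans (B.quad_jikl f)

lemma quad_klji (f : Fin D → Fin D → Fin D → Fin D → A) :
    B.quad (fun i j k l => f k l j i) = B.quad f :=
  (B.quad_klij fun i j k l => f i j l k).trans (B.quad_ijlk f)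

lemma quad_lkji (f : Fin D → Fin D → Fin D → Fin D → A) :
    B.quad (fun i j k l => f l k j i) = B.quad f :=
  (B.quad_klij fun i j k l => f j i l k).trans (B.quad_jilk f)

/-- The cancellation of all terms quadratic in first derivatives in `𝒦 + Ric`. -/
lemma quad_first_derivatives (a b : Fin D → Fin D → Fin D → A) (p q : Fin D)
    (F : Fin D → Fin D → Fin D → Fin D → A)
    (hF : ∀ i j k l, F i j k l =
      -(a j i l * a k p q + a j p l * a i k q + (a j l q + b q j l - b l j q) * a i p k)
      - (b j l i * b k p q + (b j p l + a p l j - a l p j) * b i k q + b j l q * b i p k)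
      + 2 * (a j p l * a k i q + a j i l * a p k q + (a j l q + b q j l - b l j q) * a p i k)
      + 2 * (b j l q * b k p i + (b j p l + a p l j - a l p j) * b q k i + b j l i * b q p k)
      + 2 * (b q p i * a l k j + a p i q * b l j k)
      + (b q k j * a l p i + a p j k * b l i q)
      - 2 * (b j k q * a l p i)
      - (b l i k * a j p q + b l p q * a j i k)
      - 2 * (b q i k * a p j l)
      - 2 * ((b i j l + b i l j) * (a p k q + b q p k - b k p q))
      + 2 * ((a p j q + b q p j - b j p q) * (b l k i - a l k i))
      + 2 * ((a p j l + a p l j) * (b k i q - a k i q))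
      - 2 * ((b k p j + a p j k - a j p k) * (a i l q + b q i l - b l i q))
      - (a j i k + b j k i) * (b l p q - a l p q)
      - 2 * ((a p k j + b j p k) * (b l i q - a l i q))
      + 2 * ((a j p k - a p j k) * (b l i q - a l i q))) :
    B.quad F = 0 := by
  -- Certificate: F is a sum of seven differences H − H∘π, one for each nontrivial permutation π
  -- preserving the pairing of indices, and `quad` annihilates each of them.
  set H₁ : Fin D → Fin D → Fin D → Fin D → A := fun i j k l =>
    2 * (a p j l * b k i q) + 2 * (a l i q * a p j k) + a j i k * a l p q - a i k q * a j p l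
      - b j k i * b l p q - 2 * (a j p k * a l i q) - 2 * (a p j k * b q i l)
      - 2 * (a p k j * b l i q) with h₁
  set H₂ : Fin D → Fin D → Fin D → Fin D → A := fun i j k l =>
    2 * (b i l j * b k p q) + a l p j * b i k q - a i p k * a j l q - 2 * (a l p j * b q k i)
      - 2 * (a p i k * b l j q) - 2 * (a i l q * a p j k) - 2 * (b i l j * b q p k)
      - 2 * (a l k i * b q p j) with h₂
  set H₃ : Fin D → Fin D → Fin D → Fin D → A := fun i j k l =>
    2 * (a l i q * a p k j) + a i p k * b l j q - a i p k * b q j l - a p l j * b i k q with h₃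
  set H₄ : Fin D → Fin D → Fin D → Fin D → A := fun i j k l =>
    2 * (a j p k * b q i l) + 2 * (a p l j * b q k i) + 2 * (a l k i * b j p q)
      + a l p q * b j k i with h₄
  set H₅ : Fin D → Fin D → Fin D → Fin D → A := fun i j k l =>
    2 * (a p i k * b q j l) - b i p k * b j l q with h₅
  set H₆ : Fin D → Fin D → Fin D → Fin D → A := fun i j k l =>
    2 * (b k p j * b l i q) + 2 * (a j i l * a p k q) + 2 * (b j l q * b k p i)
      + 2 * (a p i q * b l j k) - 2 * (b k p j * b q i l) with h₆
  set H₇ : Fin D → Fin D → Fin D → Fin D → A := fun i j k l =>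
    2 * (a p j q * b l k i) + 2 * (b l k i * b q p j) + 2 * (a l i q * b j p k)
      - 2 * (a k i q * a p l j) - 2 * (b j p q * b l k i) with h₇
  have key : F = (H₁ - fun i j k l => H₁ i j l k) + (H₂ - fun i j k l => H₂ j i k l)
      + (H₃ - fun i j k l => H₃ l k i j) + (H₄ - fun i j k l => H₄ k l i j)
      + (H₅ - fun i j k l => H₅ j i l k) + (H₆ - fun i j k l => H₆ k l j i)
      + (H₇ - fun i j k l => H₇ l k j i) := by
    funext i j k l
    simp only [Pi.add_apply, Pi.sub_apply, hF, h₁, h₂, h₃, h₄, h₅, h₆, h₇]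
    ring
  rw [key]
  simp only [map_add, map_sub, B.quad_ijlk H₁, B.quad_jikl H₂, B.quad_lkij H₃, B.quad_klij H₄,
    B.quad_jilk H₅, B.quad_klji H₆, B.quad_lkji H₇, sub_self, add_zero]

end Background

end DFT

end

/-! ### The Ricci-like tensor is minus the generalized Ricci tensor. -/

noncomputable section

namespace DFT

open Kind Finset

namespace Background

variable {D : ℕ} {A : Type*} [CommRing A] [Algebra ℝ A] (B : Background D A)

/-- The part of `𝒦` quadratic in first derivatives that is written without covariant
derivatives. -/
lemma ricci_quadratic (p q : Fin D) :
    half A * half A * (∑ j, ∑ k, ∑ i, B.gI j k *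
      (B.DE bar q p j * B.DEUp unb i i k
        + half A * (B.DE bar q i k * B.DEUp unb i p j)
        + B.DE unb p j q * B.DEUp bar i k i
        + half A * (B.DE unb p k i * B.DEUp bar i j q)))
    - half A * half A * (∑ i, ∑ j,
      (B.DEUp bar j i q * B.DEUp unb i p j
        + half A * (B.DEUp bar i j i * B.DEUp unb j p q)
        + half A * (B.DEUp bar i p q * B.DEUp unb j j i)))
    - half A * half A * (∑ i, ∑ j, ∑ k, ∑ l, B.gI i k * B.gI j l *
      (B.DE bar q i j * B.DE unb p k l)) =
    half A * half A * half A * (2 * B.quad (fun i j k l =>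
        B.DE bar q p i * B.DE unb l k j + B.DE unb p i q * B.DE bar l j k)
      + B.quad (fun i j k l => B.DE bar q k j * B.DE unb l p i + B.DE unb p j k * B.DE bar l i q)
      - 2 * B.quad (fun i j k l => B.DE bar j k q * B.DE unb l p i)
      - B.quad (fun i j k l => B.DE bar l i k * B.DE unb j p q + B.DE bar l p q * B.DE unb j i k)
      - 2 * B.quad (fun i j k l => B.DE bar q i k * B.DE unb p j l)) := by
  have h1 : ∑ j, ∑ k, ∑ i, B.gI j k *
      (B.DE bar q p j * B.DEUp unb i i k
        + half A * (B.DE bar q i k * B.DEUp unb i p j)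
        + B.DE unb p j q * B.DEUp bar i k i
        + half A * (B.DE unb p k i * B.DEUp bar i j q)) =
      B.quad (fun i j k l =>
        B.DE bar q p i * B.DE unb l k j + B.DE unb p i q * B.DE bar l j k)
      + half A * B.quad
        (fun i j k l => B.DE bar q k j * B.DE unb l p i + B.DE unb p j k * B.DE bar l i q) := by
    simp only [quad_apply, DEUp, mul_sum, ← sum_add_distrib]
    refine sum_congr rfl fun i _ => sum_congr rfl fun j _ => sum_congr rfl fun k _ =>
      sum_congr rfl fun l _ => ?_
    ring
  have h2 : ∑ i, ∑ j, (B.DEUp bar j i q * B.DEUp unb i p j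
        + half A * (B.DEUp bar i j i * B.DEUp unb j p q)
        + half A * (B.DEUp bar i p q * B.DEUp unb j j i)) =
      B.quad (fun i j k l => B.DE bar j k q * B.DE unb l p i) + half A * B.quad
        (fun i j k l => B.DE bar l i k * B.DE unb j p q + B.DE bar l p q * B.DE unb j i k) := by
    -- Each inverse metric touches only one of the two factors, so the fourfold sum separates into
    -- two derivatives with raised index.
    have e : ∀ x y : Fin D → Fin D → Fin D → A, B.quad (fun i j k l => x i k j * y i k l) =
        ∑ i, ∑ k, (∑ j, B.gI i j * x i k j) * ∑ l, B.gI k l * y i k l := fun x y => by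
      rw [quad_apply]
      refine sum_congr rfl fun i _ => ?_
      rw [sum_comm]
      refine sum_congr rfl fun k _ => ?_
      rw [sum_mul_sum]
      exact sum_congr rfl fun j _ => sum_congr rfl fun l _ => by ring
    have e2 : B.quad
        (fun i j k l => B.DE bar l i k * B.DE unb j p q + B.DE bar l p q * B.DE unb j i k) =
        B.quad (fun i j k l => B.DE unb j p q * B.DE bar l i k)
        + B.quad (fun i j k l => B.DE unb j i k * B.DE bar l p q) := by
      rw [← map_add]
      congr 1
      funext i j k l
      simp only [Pi.add_apply]
      ring
    rw [e2, e (fun i k j => B.DE bar j k q) (fun i k l => B.DE unb l p i),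
      e (fun i k j => B.DE unb j p q) (fun i k l => B.DE bar l i k),
      e (fun i k j => B.DE unb j i k) (fun i k l => B.DE bar l p q),
      sum_comm, mul_add, mul_sum, mul_sum, ← sum_add_distrib, ← sum_add_distrib]
    refine sum_congr rfl fun j _ => ?_
    rw [mul_sum, mul_sum, ← sum_add_distrib, ← sum_add_distrib]
    refine sum_congr rfl fun i _ => ?_
    simp only [DEUp]
    ring
  have h3 : ∑ i, ∑ j, ∑ k, ∑ l, B.gI i k * B.gI j l * (B.DE bar q i j * B.DE unb p k l) =
      B.quad (fun i j k l => B.DE bar q i k * B.DE unb p j l) := by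
    rw [quad_apply]
    exact sum_congr rfl fun i _ => sum_comm
  rw [h1, h2, h3]
  linear_combination -half A * half A * (B.quad (fun i j k l =>
        B.DE bar q p i * B.DE unb l k j + B.DE unb p i q * B.DE bar l j k)
      - B.quad (fun i j k l => B.DE bar j k q * B.DE unb l p i)
      - B.quad (fun i j k l => B.DE bar q i k * B.DE unb p j l)) * two_mul_half A

/-- Leibniz rule for g^{kl} times the lowered symbol: the symbol contributes the second derivatives
of ℰ, the inverse metric the quadratic contraction. -/
lemma sum_cD_Gam (p q : Fin D) :
    ∑ k, B.cD bar k (B.Gam unb bar p q k) =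
      half A * (∑ s, ∑ r, B.gI s r * B.cD bar r (B.cD unb p (B.E s q))
        + ∑ s, ∑ r, B.gI s r * B.cD bar r (B.cD bar q (B.E p s))
        - ∑ s, ∑ r, B.gI s r * B.cD bar r (B.cD bar s (B.E p q)))
      - half A * half A * B.quad
        (fun i j k l => (B.DE bar i j l + B.DE bar i l j) * B.gamLow unb bar p q k) := by
  have h := B.sum_derivation_gI (fun k => B.cD bar k) fun _ l => B.gamLow unb bar p q l
  have h1 : ∀ k, B.cD bar k (B.Gam unb bar p q k) = half A * (∑ l, (B.gI k l *
      B.cD bar k (B.gamLow unb bar p q l) + B.cD bar k (B.gI k l) * B.gamLow unb bar p q l)) :=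
    fun k => by
      rw [Gam_eq, derivation_mul, derivation_half, map_sum]
      simp_rw [derivation_mul]
      ring
  have h2 : ∑ k, ∑ l, B.gI k l * B.cD bar k (B.gamLow unb bar p q l) =
      ∑ s, ∑ r, B.gI s r * B.cD bar r (B.cD unb p (B.E s q))
        + ∑ s, ∑ r, B.gI s r * B.cD bar r (B.cD bar q (B.E p s))
        - ∑ s, ∑ r, B.gI s r * B.cD bar r (B.cD bar s (B.E p q)) := by
    simp only [← sum_add_distrib, ← sum_sub_distrib]
    rw [sum_comm]
    refine sum_congr rfl fun s _ => sum_congr rfl fun r _ => ?_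
    rw [B.gI_symm r s, gamLow, map_sub, map_add]
    simp only [DE]
    ring
  simp_rw [h1, ← mul_sum, sum_add_distrib]
  rw [h2, h]
  simp only [DE]
  ring

lemma sum_dt_E (q : Fin D) :
    ∑ l, B.dt l (B.E l q) =
      half A * ∑ l, ∑ m, B.gI l m * (B.DE bar m l q - B.DE unb m l q) := by
  rw [mul_sum]
  exact sum_congr rfl fun l _ => B.dt_eq l _

lemma sum_Gam_mul_dt (p q : Fin D) :
    ∑ k, B.Gam unb bar p q k * ∑ l, B.dt l (B.E l k) = half A * half A * B.quad
      (fun i j k l => B.gamLow unb bar p q j * (B.DE bar l k i - B.DE unb l k i)) := by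
  simp_rw [sum_dt_E, Gam_eq, quad_apply]
  rw [mul_sum]
  refine sum_congr rfl fun i _ => ?_
  have h : ∀ a b : A, half A * a * (half A * b) = half A * half A * (a * b) := fun a b => by ring
  rw [h]
  congr 1
  rw [sum_mul]
  refine sum_congr rfl fun j _ => ?_
  rw [mul_sum]
  refine sum_congr rfl fun k _ => ?_
  rw [mul_sum]
  exact sum_congr rfl fun l _ => by ring

lemma cD_sum_dt (p q : Fin D) :
    B.cD unb p (∑ l, B.dt l (B.E l q)) =
      half A * (∑ s, ∑ r, B.gI s r * B.cD unb p (B.cD bar r (B.E s q))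
        - ∑ s, ∑ r, B.gI s r * B.cD unb p (B.cD unb r (B.E s q)))
      - half A * half A * B.quad
        (fun i j k l => (B.DE unb p j l + B.DE unb p l j) * (B.DE bar k i q - B.DE unb k i q)) := by
  have h := B.sum_derivation_gI (fun _ => B.cD unb p) fun l m => B.DE bar m l q - B.DE unb m l q
  rw [sum_dt_E, derivation_mul, derivation_half, map_sum]
  simp_rw [map_sum, derivation_mul, sum_add_distrib]
  rw [h]
  simp only [DE, map_sub, mul_sub, sum_sub_distrib]
  ring

lemma sum_Gam_mul_Gam (p q : Fin D) :
    ∑ k, ∑ m, B.Gam bar unb k p m * B.Gam unb bar m q k = half A * half A * B.quad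
      (fun i j k l => B.gamLow bar unb k p j * B.gamLow unb bar i q l) := by
  have h : ∀ a b : A, half A * a * (half A * b) = half A * half A * (a * b) := fun a b => by ring
  simp_rw [Gam_eq, quad_apply, h, ← mul_sum]
  rw [sum_comm]
  congr 1
  refine sum_congr rfl fun i _ => ?_
  rw [sum_comm]
  refine sum_congr rfl fun k _ => ?_
  rw [sum_mul_sum]
  exact sum_congr rfl fun j _ => sum_congr rfl fun l _ => by ring

/-- The commutator is a combination of ∂̃^k, which `sum_gI_dt` turns into calligraphic derivatives.
Second derivatives of ℰ can thus be reordered at the cost of quadratic contractions. -/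
lemma sum_gI_comm_unb_bar (p q : Fin D) :
    ∑ s, ∑ r, B.gI s r * B.cD unb p (B.cD bar r (B.E s q))
      - ∑ s, ∑ r, B.gI s r * B.cD bar r (B.cD unb p (B.E s q)) =
    half A * B.quad (fun i j k l => (B.DE unb p k j + B.DE bar j p k)
      * (B.DE bar l i q - B.DE unb l i q)) := by
  refine Eq.trans ?_ (B.sum_gI_dt (fun s r k => B.DE unb p k r + B.DE bar r p k) fun s => B.E s q)
  simp_rw [← sum_sub_distrib, ← mul_sub, cD_unb_bar_comm]
  rfl

lemma sum_gI_comm_unb_unb (p q : Fin D) :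
    ∑ s, ∑ r, B.gI s r * B.cD unb p (B.cD unb r (B.E s q))
      - ∑ s, ∑ r, B.gI s r * B.cD unb r (B.cD unb p (B.E s q)) =
    half A * B.quad (fun i j k l => (B.DE unb j p k - B.DE unb p j k)
      * (B.DE bar l i q - B.DE unb l i q)) := by
  refine Eq.trans ?_ (B.sum_gI_dt (fun s r k => B.DE unb r p k - B.DE unb p r k) fun s => B.E s q)
  simp_rw [← sum_sub_distrib, ← mul_sub, cD_unb_unb_comm]
  rfl

lemma sum_gI_laplacian (p q : Fin D) :
    ∑ s, ∑ r, B.gI s r * B.cD unb r (B.cD unb s (B.E p q))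
      - ∑ s, ∑ r, B.gI s r * B.cD bar r (B.cD bar s (B.E p q)) =
    -(half A * B.quad (fun i j k l => (B.DE unb j i k + B.DE bar j k i)
      * (B.DE bar l p q - B.DE unb l p q))) := by
  have h := B.laplacian_sub (B.E p q)
  have h1 := B.sum_gI_dt (fun s r k => B.DE unb r s k + B.DE bar r k s) fun _ => B.E p q
  simp only [DE] at h1 ⊢
  rw [h1] at h
  rw [← h]
  simp only [← sum_sub_distrib, ← mul_sub]

/-- The Ricci-like tensor is minus the generalized Ricci tensor. -/
theorem ricci_eq_neg_genRicci (p q : Fin D) : B.ricci p q = -B.genRicci p q := by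
  have hC1 := B.sum_gI_cov3 unb unb unb bar (B.DE unb) fun s => (s, p, q)
  have hC2 := B.sum_gI_cov3 bar bar unb bar (B.DE bar) fun s => (s, p, q)
  have hC3 := B.sum_gI_cov3 unb unb unb bar (B.DE unb) fun s => (p, s, q)
  have hC4 := B.sum_gI_cov3 bar bar unb bar (B.DE bar) fun s => (q, p, s)
  have hQ := B.ricci_quadratic p q
  have hR1 := B.sum_cD_Gam p q
  have hR2 := B.sum_Gam_mul_dt p q
  have hR3 := B.cD_sum_dt p q
  have hR4 := B.sum_Gam_mul_Gam p q
  have hW1 := B.sum_gI_laplacian p q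
  have hW2 := B.sum_gI_comm_unb_bar p q
  have hW3 := B.sum_gI_comm_unb_unb p q
  -- The dilaton terms of 𝒦 + Ric add up to exactly this commutator identity for d.
  have hd := B.cD_comm_Gam p q B.d
  -- One summand for each quadratic remainder: four contracted covariant derivatives, the explicit
  -- quadratic part of 𝒦, the four pieces of Ric, and the three reorderings of second derivatives.
  have hF : B.quad (
      -(fun i j k l => B.gamLow unb unb j i l * B.DE unb k p q
          + B.gamLow unb unb j p l * B.DE unb i k q + B.gamLow unb bar j q l * B.DE unb i p k)
      - (fun i j k l => B.gamLow bar bar j i l * B.DE bar k p q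
          + B.gamLow bar unb j p l * B.DE bar i k q + B.gamLow bar bar j q l * B.DE bar i p k)
      + (2 : A) • (fun i j k l => B.gamLow unb unb j p l * B.DE unb k i q
          + B.gamLow unb unb j i l * B.DE unb p k q + B.gamLow unb bar j q l * B.DE unb p i k)
      + (2 : A) • (fun i j k l => B.gamLow bar bar j q l * B.DE bar k p i
          + B.gamLow bar unb j p l * B.DE bar q k i + B.gamLow bar bar j i l * B.DE bar q p k)
      + (2 : A) • (fun i j k l =>
          B.DE bar q p i * B.DE unb l k j + B.DE unb p i q * B.DE bar l j k)
      + (fun i j k l => B.DE bar q k j * B.DE unb l p i + B.DE unb p j k * B.DE bar l i q)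
      - (2 : A) • (fun i j k l => B.DE bar j k q * B.DE unb l p i)
      - (fun i j k l => B.DE bar l i k * B.DE unb j p q + B.DE bar l p q * B.DE unb j i k)
      - (2 : A) • (fun i j k l => B.DE bar q i k * B.DE unb p j l)
      - (2 : A) • (fun i j k l => (B.DE bar i j l + B.DE bar i l j) * B.gamLow unb bar p q k)
      + (2 : A) • (fun i j k l => B.gamLow unb bar p q j * (B.DE bar l k i - B.DE unb l k i))
      + (2 : A) • (fun i j k l => (B.DE unb p j l + B.DE unb p l j)
          * (B.DE bar k i q - B.DE unb k i q))
      - (2 : A) • (fun i j k l => B.gamLow bar unb k p j * B.gamLow unb bar i q l)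
      - (fun i j k l => (B.DE unb j i k + B.DE bar j k i) * (B.DE bar l p q - B.DE unb l p q))
      - (2 : A) • (fun i j k l => (B.DE unb p k j + B.DE bar j p k)
          * (B.DE bar l i q - B.DE unb l i q))
      + (2 : A) • (fun i j k l => (B.DE unb j p k - B.DE unb p j k)
          * (B.DE bar l i q - B.DE unb l i q))) = 0 :=
    B.quad_first_derivatives (B.DE unb) (B.DE bar) p q _ fun i j k l => rfl
  simp only [map_add, map_sub, map_neg, map_smul, smul_eq_mul] at hF
  have hG : B.genRicci p q = ∑ k, B.cD bar k (B.Gam unb bar p q k)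
      + ∑ k, B.Gam unb bar p q k * ∑ l, B.dt l (B.E l k)
      - 2 * ∑ k, B.Gam unb bar p q k * B.cD bar k B.d
      - B.cD unb p (∑ l, B.dt l (B.E l q)) + 2 * B.cD unb p (B.cD bar q B.d)
      - ∑ k, ∑ m, B.Gam bar unb k p m * B.Gam unb bar m q k := by
    simp only [genRicci, frameDiv, two_mul, map_sub, map_add, mul_add, mul_sub, sum_add_distrib,
      sum_sub_distrib]
    ring
  have hK : ∑ s, ∑ r, B.gI s r *
      (B.cov3 unb unb unb bar r (B.DE unb) s p q
        + B.cov3 bar bar unb bar r (B.DE bar) s p q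
        - 2 * B.cov3 unb unb unb bar r (B.DE unb) p s q
        - 2 * B.cov3 bar bar unb bar r (B.DE bar) q p s) =
      ∑ s, ∑ r, B.gI s r * B.cov3 unb unb unb bar r (B.DE unb) s p q
        + ∑ s, ∑ r, B.gI s r * B.cov3 bar bar unb bar r (B.DE bar) s p q
        - 2 * ∑ s, ∑ r, B.gI s r * B.cov3 unb unb unb bar r (B.DE unb) p s q
        - 2 * ∑ s, ∑ r, B.gI s r * B.cov3 bar bar unb bar r (B.DE bar) q p s := by
    simp only [mul_add, mul_sub, sum_add_distrib, sum_sub_distrib, mul_sum, mul_left_comm]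
  simp only [] at hC1 hC2 hC3 hC4
  have hDE : ∀ κ s i j, B.cD κ s (B.E i j) = B.DE κ s i j := fun _ _ _ _ => rfl
  simp only [hDE] at hR1 hR3 hW1 hW2 hW3
  have h2 : ∀ x : A, 2 * x = (2 : ℝ) • x := fun x => by rw [two_mul, two_smul]
  rw [ricci, hG, hK, hC1, hC2, hC3, hC4, hR1, hR2, hR3, hR4, cov1, cov1]
  simp only [mul_assoc, half_mul, h2, smul_mul_assoc] at hQ hW1 hW2 hW3 hF ⊢
  -- In 𝒦 + Ric the second derivatives of ℰ are ¼g^{sr}(𝒟_r𝒟_s − 𝒟̄_r𝒟̄_s)ℰ_{pq} −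
  -- ½g^{sr}[𝒟_p,𝒟̄_r]ℰ_{sq} + ½g^{sr}[𝒟_p,𝒟_r]ℰ_{sq}, whence the weights. The 1/8 is the common
  -- normalization of the quadratic contractions.
  linear_combination (norm := module) hQ + (1 / 4 : ℝ) • hW1 - (1 / 2 : ℝ) • hW2 + (1 / 2 : ℝ) • hW3 + hd
    + (1 / 8 : ℝ) • hF

end Background

end DFT

end

/-! ### The gauge variation of ℰ and the rotation matrices. -/

noncomputable section

namespace DFT

open Kind Finset

namespace Background

variable {D : ℕ} {A : Type*} [CommRing A] [Algebra ℝ A] (B : Background D A)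

/-- The gauge parameter with lowered doubled index. -/
def _root_.DFT.lowered {D : ℕ} {A : Type*} (xi xit : Fin D → A) : DIdx D → A := Sum.elim xi xit

@[simp] lemma _root_.DFT.lowered_inl {D : ℕ} {A : Type*} (xi xit : Fin D → A) (k : Fin D) :
    lowered xi xit (.inl k) = xi k := rfl

@[simp] lemma _root_.DFT.lowered_inr {D : ℕ} {A : Type*} (xi xit : Fin D → A) (k : Fin D) :
    lowered xi xit (.inr k) = xit k := rfl

@[simp] lemma fr_unb_inl (i k : Fin D) : B.fr unb i (.inl k) = -B.E i k := rfl

@[simp] lemma fr_bar_inl (i k : Fin D) : B.fr bar i (.inl k) = B.E k i := rfl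

/-- The transport term `ξ^M ∂_M f`. -/
def transport (xi xit : Fin D → A) (f : A) : A :=
  ∑ k, (xi k * B.dx k f + xit k * B.dt k f)

/-- The matrices by which tensors with unbarred and barred indices rotate under a gauge
transformation. -/
def rot (xi xit : Fin D → A) (κ : Kind) (i k : Fin D) : A :=
  B.cD κ i (xi k) - ∑ N, B.fr κ i N * B.dt k (lowered xi xit N)

/-- The gauge variation of `ℰ` without the transport term. -/
def gaugeE (xi xit : Fin D → A) (j l : Fin D) : A :=
  ∑ N, B.fr bar l N * B.cD unb j (lowered xi xit N)
    - ∑ N, B.fr unb j N * B.cD bar l (lowered xi xit N)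

lemma sum_fr (κ : Kind) (i : Fin D) (V : DIdx D → A) :
    ∑ N, B.fr κ i N * V N = V (.inr i) + ∑ k, B.fr κ i (.inl k) * V (.inl k) := by
  cases κ <;> simp [Fintype.sum_sum_type, fr] <;> ring

/-- Links the frame form, in which ξ and ξ̃ enter as one doubled vector, with the expression used in
`deltaE`. -/
lemma gaugeE_eq (xi xit : Fin D → A) (i j : Fin D) :
    B.gaugeE xi xit i j = B.cD unb i (xit j) - B.cD bar j (xit i)
      + ∑ k, (B.cD unb i (xi k) * B.E k j + B.cD bar j (xi k) * B.E i k) := by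
  simp only [gaugeE, sum_fr, lowered_inl, lowered_inr, fr_unb_inl, fr_bar_inl, neg_mul,
    sum_neg_distrib, sum_add_distrib, mul_comm _ (B.E _ _)]
  ring

lemma rot_unb (xi xit : Fin D → A) (p l : Fin D) :
    B.rot xi xit unb p l =
      B.cD unb p (xi l) - B.dt l (xit p) + ∑ k, B.E p k * B.dt l (xi k) := by
  simp only [rot, sum_fr, lowered_inl, lowered_inr, fr_unb_inl, neg_mul, sum_neg_distrib]
  ring

lemma rot_bar (xi xit : Fin D → A) (p l : Fin D) :
    B.rot xi xit bar p l =
      B.cD bar p (xi l) - B.dt l (xit p) - ∑ k, B.E k p * B.dt l (xi k) := by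
  simp only [rot, sum_fr, lowered_inl, lowered_inr, fr_bar_inl]
  ring

lemma swap_rot (xi xit : Fin D → A) (κ : Kind) (i k : Fin D) :
    B.swap.rot xi (-xit) κ i k = B.rot xi xit κ.swap i k := by
  cases κ <;> simp [rot_unb, rot_bar, Kind.swap, swap_cD] <;> simp [swap] <;> ring

/-- After raising the first index the difference is antisymmetric, hence invisible on g^{ij}; this
is why either matrix may be used to rotate the inverse metric in `σ_gI`. -/
lemma rot_bar_sub_rot_unb (xi xit : Fin D → A) (l r : Fin D) :
    B.rot xi xit bar l r - B.rot xi xit unb l r =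
      ∑ k, (B.E l k + B.E k l) * (B.dt k (xi r) - B.dt r (xi k)) := by
  have h := B.cD_bar_sub_cD_unb l (xi r)
  simp_rw [mul_sub, sum_sub_distrib, ← h, add_mul, sum_add_distrib]
  rw [rot_bar, rot_unb]
  ring

/-- The ℰ-terms on the two sides are the same contraction of ∂̃f with ∂̃g, and the rest is the
strong constraint. -/
lemma sc_dt (f g : A) : ∑ k, B.dt k f * B.cD bar k g = -∑ k, B.dt k g * B.cD unb k f := by
  have h4 : ∑ j, ∑ k, B.E k j * (B.dt j f * B.dt k g) =
      ∑ j, ∑ k, B.E j k * (B.dt k f * B.dt j g) := sum_comm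
  rw [← sub_eq_zero, sub_neg_eq_add, ← sum_add_distrib]
  calc _ = ∑ i, (B.dx i f * B.dt i g + B.dt i f * B.dx i g)
      + (∑ j, ∑ k, B.E k j * (B.dt j f * B.dt k g)
        - ∑ j, ∑ k, B.E j k * (B.dt k f * B.dt j g)) := by
        simp_rw [← sum_sub_distrib, ← sum_add_distrib]
        refine sum_congr rfl fun j _ => ?_
        rw [cD_bar, cD_unb, mul_add, mul_sub, mul_sum, mul_sum, sum_sub_distrib]
        have e1 : ∀ k, B.dt j f * (B.E k j * B.dt k g) = B.E k j * (B.dt j f * B.dt k g) :=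
          fun k => by ring
        have e2 : ∀ k, B.dt j g * (B.E j k * B.dt k f) = B.E j k * (B.dt k f * B.dt j g) :=
          fun k => by ring
        simp_rw [e1, e2]
        ring
    _ = 0 := by rw [B.sc, h4, sub_self, add_zero]

lemma derivation_sum_fr (δ : Derivation ℝ A A) (κ : Kind) (i : Fin D) (V : DIdx D → A) :
    δ (∑ N, B.fr κ i N * V N) =
      ∑ N, B.fr κ i N * δ (V N) + ∑ k, δ (B.fr κ i (.inl k)) * V (.inl k) := by
  simp_rw [map_sum, derivation_mul, sum_add_distrib, Fintype.sum_sum_type, derivation_fr]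
  simp

/-- The derivative of `gaugeE`, for a derivation with given commutators with `𝒟` and `𝒟̄`. -/
lemma derivation_gaugeE (xi xit : Fin D → A) (j l : Fin D) (δ : Derivation ℝ A A) (S T : A → A)
    (hS : ∀ f, δ (B.cD unb j f) = S f - ∑ k, δ (B.E j k) * B.dt k f)
    (hT : ∀ f, δ (B.cD bar l f) = T f + ∑ k, δ (B.E k l) * B.dt k f) :
    δ (B.gaugeE xi xit j l) =
      ∑ N, B.fr bar l N * S (lowered xi xit N) - ∑ N, B.fr unb j N * T (lowered xi xit N)
      + ∑ k, δ (B.E j k) * B.rot xi xit bar l k + ∑ k, δ (B.E k l) * B.rot xi xit unb j k := by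
  have h : ∀ (κ : Kind) (i : Fin D) (a : Fin D → A) (X : DIdx D → A),
      ∑ N, B.fr κ i N * ∑ k, a k * B.dt k (X N) = ∑ k, a k * ∑ N, B.fr κ i N * B.dt k (X N) := by
    intro κ i a X
    simp_rw [mul_sum]
    rw [sum_comm]
    exact sum_congr rfl fun k _ => sum_congr rfl fun N _ => by ring
  rw [gaugeE, map_sub, derivation_sum_fr, derivation_sum_fr]
  simp only [hS, hT, fr_unb_inl, fr_bar_inl, lowered_inl, rot, mul_sub, mul_add,
    sum_sub_distrib, sum_add_distrib, map_neg, neg_mul, sum_neg_distrib, h]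
  ring

/-- The derivative of `gaugeE` along a frame vector. -/
lemma cD_gaugeE (xi xit : Fin D → A) (κ : Kind) (i j l : Fin D) :
    B.cD κ i (B.gaugeE xi xit j l) =
      ∑ N, B.fr bar l N * B.hess κ unb i j (lowered xi xit N)
      - ∑ N, B.fr unb j N * B.hess κ bar i l (lowered xi xit N)
      + ∑ k, B.cD κ i (B.E j k) * B.rot xi xit bar l k
      + ∑ k, B.cD κ i (B.E k l) * B.rot xi xit unb j k :=
  B.derivation_gaugeE xi xit j l (B.cD κ i) _ _ (B.cD_cD_unb κ i j) (B.cD_cD_bar κ i l)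

lemma dt_cD_unb (i j : Fin D) (f : A) :
    B.dt i (B.cD unb j f) = B.cD unb j (B.dt i f) - ∑ k, B.dt i (B.E j k) * B.dt k f := by
  simp_rw [cD_unb, map_sub, map_sum, derivation_mul, sum_add_distrib, B.dx_dt, B.dt_dt i]
  ring

lemma dt_cD_bar (i j : Fin D) (f : A) :
    B.dt i (B.cD bar j f) = B.cD bar j (B.dt i f) + ∑ k, B.dt i (B.E k j) * B.dt k f := by
  simp_rw [cD_bar, map_add, map_sum, derivation_mul, sum_add_distrib, B.dx_dt, B.dt_dt i]
  ring

/-- The derivative of `gaugeE` with respect to `x̃`. -/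
lemma dt_gaugeE (xi xit : Fin D → A) (i j l : Fin D) :
    B.dt i (B.gaugeE xi xit j l) =
      ∑ N, B.fr bar l N * B.cD unb j (B.dt i (lowered xi xit N))
      - ∑ N, B.fr unb j N * B.cD bar l (B.dt i (lowered xi xit N))
      + ∑ k, B.dt i (B.E j k) * B.rot xi xit bar l k
      + ∑ k, B.dt i (B.E k l) * B.rot xi xit unb j k :=
  B.derivation_gaugeE xi xit j l (B.dt i) _ _ (B.dt_cD_unb i j) (B.dt_cD_bar i l)

lemma cD_rot_bar (xi xit : Fin D → A) (κ : Kind) (i j k : Fin D) :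
    B.cD κ i (B.rot xi xit bar j k) = B.hess κ bar i j (xi k)
      - ∑ N, B.fr bar j N * B.cD κ i (B.dt k (lowered xi xit N))
      + ∑ r, B.cD κ i (B.E r j) * (B.dt r (xi k) - B.dt k (xi r)) := by
  rw [rot, map_sub, derivation_sum_fr, cD_cD_bar]
  simp only [fr_bar_inl, lowered_inl, mul_sub, sum_sub_distrib]
  ring

/-- The second derivatives of the gauge parameters cancel in the variation of the mixed
Christoffel-like symbols. -/
lemma gaugeE_cyclic (xi xit : Fin D → A) (p q l : Fin D) :
    B.cD unb p (B.gaugeE xi xit l q) + B.cD bar q (B.gaugeE xi xit p l)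
      - B.cD bar l (B.gaugeE xi xit p q) =
    ∑ r, B.rot xi xit unb p r * (B.cD bar q (B.E r l) - B.cD bar l (B.E r q))
      + ∑ r, B.rot xi xit bar q r * (B.cD unb p (B.E l r) - B.cD bar l (B.E p r))
      + ∑ r, B.rot xi xit bar l r * (B.cD unb p (B.E r q) + B.cD bar q (B.E p r))
      + ∑ k, (B.E l k + B.E k l) * B.cD unb p (B.rot xi xit bar q k) := by
  -- Six contracted Hessians of ξ_N occur. The two along e_p cancel by symmetry; the two along ē_q
  -- are compared here, and replacing ē_l by e_l inside the Hessian costs a factor 2g and a ∂̃^k.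
  have h1 : ∑ N, B.fr bar q N * B.hess bar unb l p (lowered xi xit N) =
      ∑ N, B.fr bar q N * B.hess unb unb p l (lowered xi xit N)
      + ∑ k, (B.E l k + B.E k l) *
        ∑ N, B.fr bar q N * B.cD unb p (B.dt k (lowered xi xit N)) := by
    rw [← sub_eq_iff_eq_add', ← sum_sub_distrib]
    simp_rw [← mul_sub, B.hess_comm unb unb p l, hess_bar_sub_hess_unb, mul_sum]
    rw [sum_comm]
    exact sum_congr rfl fun k _ => sum_congr rfl fun N _ => by ring
  -- The last two, along ē_l and e_l, have the same Hessian, so only ē_l − e_l survives; its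
  -- components are 2g_{lk} in the winding directions.
  have h2 : ∑ N, B.fr bar l N * B.hess bar unb q p (lowered xi xit N) =
      ∑ N, B.fr unb l N * B.hess unb bar p q (lowered xi xit N)
      + ∑ k, (B.E l k + B.E k l) * B.hess unb bar p q (xi k) := by
    simp_rw [B.hess_comm bar unb q p, sum_fr, fr_unb_inl, fr_bar_inl, lowered_inl, add_mul,
      sum_add_distrib, neg_mul, sum_neg_distrib]
    ring
  have h3 : ∑ k, (B.E l k + B.E k l) *
      ∑ r, B.cD unb p (B.E r q) * (B.dt r (xi k) - B.dt k (xi r)) =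
      -∑ r, (B.rot xi xit bar l r - B.rot xi xit unb l r) * B.cD unb p (B.E r q) := by
    simp_rw [rot_bar_sub_rot_unb, mul_sum, sum_mul]
    rw [sum_comm, ← sum_neg_distrib]
    simp_rw [← sum_neg_distrib]
    exact sum_congr rfl fun r _ => sum_congr rfl fun k _ => by ring
  have h4 : ∑ k, (B.E l k + B.E k l) * B.cD unb p (B.rot xi xit bar q k) =
      ∑ k, (B.E l k + B.E k l) * B.hess unb bar p q (xi k)
      - ∑ k, (B.E l k + B.E k l) * ∑ N, B.fr bar q N * B.cD unb p (B.dt k (lowered xi xit N))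
      - ∑ r, (B.rot xi xit bar l r - B.rot xi xit unb l r) * B.cD unb p (B.E r q) := by
    simp_rw [cD_rot_bar, mul_add _ (_ - _), sum_add_distrib, h3, mul_sub, sum_sub_distrib]
    ring
  rw [h4]
  simp_rw [cD_gaugeE, B.hess_comm bar bar l q, mul_add, mul_sub, sub_mul, sum_add_distrib,
    sum_sub_distrib]
  simp_rw [mul_comm _ (B.rot _ _ _ _ _)]
  linear_combination h2 - h1

end Background

end DFT

end

/-! ### One-parameter families and the variation without transport term. -/

noncomputable section

namespace DFT

open Kind Finset

namespace Background

variable {D : ℕ} {A : Type*} [CommRing A] [Algebra ℝ A] (B : Background D A)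

lemma sum_cD_unb_dt (f : A) :
    ∑ l, B.cD unb l (B.dt l f) = -∑ l, B.cD bar l (B.dt l f) := by
  have h : ∑ l, ∑ k, B.E l k * B.dt k (B.dt l f) = ∑ l, ∑ k, B.E k l * B.dt k (B.dt l f) := by
    rw [sum_comm]
    exact sum_congr rfl fun l _ => sum_congr rfl fun k _ => by rw [B.dt_dt]
  simp_rw [cD_unb, cD_bar, sum_sub_distrib, sum_add_distrib, B.box, h]
  ring

/-- The second derivatives of the gauge parameters cancel in the variation of `frameDiv`. -/
lemma sum_dt_gaugeE (xi xit : Fin D → A) (k : Fin D) :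
    ∑ l, (B.dt l (B.gaugeE xi xit l k)
        + B.transport (fun r => B.dt l (xi r)) (fun r => B.dt l (xit r)) (B.E l k))
      + B.cD bar k (∑ l, (B.dx l (xi l) + B.dt l (xit l))) =
    ∑ r, B.rot xi xit bar k r * ∑ l, B.dt l (B.E l r) + ∑ l, B.cD bar l (B.rot xi xit bar k l) := by
  have h1 : ∑ l, ∑ N, B.fr bar k N * B.cD unb l (B.dt l (lowered xi xit N)) =
      -∑ l, ∑ N, B.fr bar k N * B.cD bar l (B.dt l (lowered xi xit N)) := by
    rw [sum_comm, sum_comm (s := univ (α := Fin D)), ← sum_neg_distrib]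
    refine sum_congr rfl fun N _ => ?_
    rw [← mul_sum, ← mul_sum, sum_cD_unb_dt, mul_neg]
  -- The divergence of ξ equals e_l^N∂̃^lξ_N + ē_l^M∂_Mξ^l, the ℰ-terms cancelling. In this form its
  -- derivative shows the second derivatives produced by `dt_gaugeE` and `cD_rot_bar`.
  have h2 : B.cD bar k (∑ l, (B.dx l (xi l) + B.dt l (xit l))) =
      ∑ l, ∑ N, B.fr unb l N * B.cD bar k (B.dt l (lowered xi xit N))
        + ∑ l, B.hess bar bar l k (xi l) := by
    simp_rw [hess_eq_sum_cD, sum_fr, fr_unb_inl, fr_bar_inl, lowered_inl, lowered_inr, map_sum,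
      map_add, sum_add_distrib, der, neg_mul, sum_neg_distrib]
    rw [sum_comm (f := fun l r => B.E r l * _)]
    ring
  -- The terms with first derivatives of ξ and of ℰ. The strong constraint enters only through `e1`;
  -- the other two pieces are relabellings.
  have h3 : ∑ l, ∑ r, B.dt l (B.E r k) * B.rot xi xit unb l r
      + ∑ l, B.transport (fun r => B.dt l (xi r)) (fun r => B.dt l (xit r)) (B.E l k) =
      ∑ l, ∑ r, B.cD bar l (B.E r k) * (B.dt r (xi l) - B.dt l (xi r)) := by
    have e1 : ∑ l, ∑ r, B.dt l (B.E r k) * B.cD unb l (xi r) =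
        -∑ l, ∑ r, B.cD bar l (B.E r k) * B.dt l (xi r) := by
      have e0 : ∑ l, ∑ r, B.cD bar l (B.E r k) * B.dt l (xi r) =
          ∑ r, ∑ l, B.cD bar l (B.E r k) * B.dt l (xi r) := sum_comm
      rw [sum_comm, e0, ← sum_neg_distrib]
      refine sum_congr rfl fun r _ => ?_
      rw [eq_neg_iff_add_eq_zero, ← eq_neg_iff_add_eq_zero.mp (B.sc_dt (xi r) (B.E r k)), add_comm]
      congr 1
      exact sum_congr rfl fun l _ => mul_comm _ _
    have e2 : ∑ l, ∑ r, B.dt l (B.E r k) * B.dt r (xit l) =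
        ∑ l, ∑ r, B.dt l (xit r) * B.dt r (B.E l k) := by
      rw [sum_comm]
      exact sum_congr rfl fun r _ => sum_congr rfl fun l _ => mul_comm _ _
    have e3 : ∑ l, ∑ r, B.dt l (B.E r k) * ∑ s, B.E l s * B.dt r (xi s)
        + ∑ l, ∑ r, B.dt l (xi r) * B.dx r (B.E l k) =
        ∑ l, ∑ r, B.cD bar l (B.E r k) * B.dt r (xi l) := by
      simp_rw [cD_bar, add_mul, sum_add_distrib, mul_sum, sum_mul]
      rw [add_comm]
      congr 1
      · rw [sum_comm]
        exact sum_congr rfl fun r _ => sum_congr rfl fun l _ => mul_comm _ _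
      · rw [sum_comm, sum_comm (s := univ (α := Fin D))
          (f := fun x y => ∑ i, B.E i x * B.dt i (B.E y k) * B.dt y (xi x))]
        refine sum_congr rfl fun r _ => ?_
        rw [sum_comm]
        exact sum_congr rfl fun s _ => sum_congr rfl fun l _ => by ring
    simp_rw [rot_unb, transport, mul_add, mul_sub, sum_add_distrib, sum_sub_distrib]
    rw [e1, e2, ← e3]
    ring
  have h4 : ∑ r, B.rot xi xit bar k r * ∑ l, B.dt l (B.E l r) =
      ∑ l, ∑ r, B.dt l (B.E l r) * B.rot xi xit bar k r := by
    rw [sum_comm]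
    refine sum_congr rfl fun r _ => ?_
    rw [mul_comm, sum_mul]
  rw [h2, h4]
  simp_rw [dt_gaugeE, cD_rot_bar, sum_add_distrib, sum_sub_distrib]
  rw [← h3, h1]
  ring

end Background

/-- A one-parameter family of backgrounds, to first order: `q` evaluates at `t = 0` and `δ` is the
derivative with respect to the parameter, which is assumed to act on the fields as a gauge
transformation. -/
structure GaugeVariation {D : ℕ} {A A₀ : Type*} [CommRing A] [Algebra ℝ A] [CommRing A₀]
    [Algebra ℝ A₀] (B : Background D A) (B₀ : Background D A₀) (xi xit : Fin D → A₀) where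
  q : A →ₐ[ℝ] A₀
  δ : A →ₗ[ℝ] A₀
  δ_mul : ∀ f g, δ (f * g) = q f * δ g + δ f * q g
  q_dx : ∀ i f, q (B.dx i f) = B₀.dx i (q f)
  q_dt : ∀ i f, q (B.dt i f) = B₀.dt i (q f)
  δ_dx : ∀ i f, δ (B.dx i f) = B₀.dx i (δ f)
  δ_dt : ∀ i f, δ (B.dt i f) = B₀.dt i (δ f)
  q_E : ∀ i j, q (B.E i j) = B₀.E i j
  q_d : q B.d = B₀.d
  q_gI : ∀ i j, q (B.gI i j) = B₀.gI i j
  δ_E : ∀ i j, δ (B.E i j) = B₀.gaugeE xi xit i j + B₀.transport xi xit (B₀.E i j)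
  δ_d : δ B.d = -(half A₀ * ∑ i, (B₀.dx i (xi i) + B₀.dt i (xit i))) + B₀.transport xi xit B₀.d

namespace GaugeVariation

variable {D : ℕ} {A A₀ : Type*} [CommRing A] [Algebra ℝ A] [CommRing A₀] [Algebra ℝ A₀]
  {B : Background D A} {B₀ : Background D A₀} {xi xit : Fin D → A₀}
  (V : GaugeVariation B B₀ xi xit)

/-- The variation without the transport term. -/
def σ (f : A) : A₀ := V.δ f - B₀.transport xi xit (V.q f)

lemma σ_add (f g : A) : V.σ (f + g) = V.σ f + V.σ g := by
  simp only [σ, map_add, Background.transport, mul_add, sum_add_distrib]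
  ring

/-- The variation without the transport term, as an additive homomorphism. -/
def σHom : A →+ A₀ where
  toFun := V.σ
  map_zero' := by simp [σ, Background.transport]
  map_add' := V.σ_add

lemma σ_sum {ι : Type*} (s : Finset ι) (f : ι → A) : V.σ (∑ i ∈ s, f i) = ∑ i ∈ s, V.σ (f i) :=
  map_sum V.σHom f s

lemma σ_sub (f g : A) : V.σ (f - g) = V.σ f - V.σ g := map_sub V.σHom f g

/-- Both δ and the transport term obey the Leibniz rule over `q`, hence so does their difference.
The action of `σ` on all expressions then follows from ℰ, d and its commutators with the
derivations. -/
lemma σ_mul (f g : A) : V.σ (f * g) = V.q f * V.σ g + V.σ f * V.q g := by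
  have h : B₀.transport xi xit (V.q f * V.q g) =
      V.q f * B₀.transport xi xit (V.q g) + B₀.transport xi xit (V.q f) * V.q g := by
    simp only [Background.transport, derivation_mul, mul_sum, sum_mul, ← sum_add_distrib]
    exact sum_congr rfl fun k _ => by ring
  rw [σ, V.δ_mul, map_mul, h, σ, σ]
  ring

lemma σ_algebraMap (c : ℝ) : V.σ (algebraMap ℝ A c) = 0 := by
  have h : V.δ 1 = 0 := by
    have h1 := V.δ_mul 1 1
    simpa using h1
  simp [σ, Background.transport, Algebra.algebraMap_eq_smul_one, h]

lemma σ_half : V.σ (half A) = 0 := V.σ_algebraMap _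

lemma σ_half_mul (f : A) : V.σ (half A * f) = half A₀ * V.σ f := by
  rw [σ_mul, σ_half, map_half, zero_mul, add_zero]

lemma σ_E (i j : Fin D) : V.σ (B.E i j) = B₀.gaugeE xi xit i j := by
  rw [σ, V.δ_E, V.q_E]
  ring

lemma σ_d : V.σ B.d = -(half A₀ * ∑ i, (B₀.dx i (xi i) + B₀.dt i (xit i))) := by
  rw [σ, V.δ_d, V.q_d]
  ring

/-- Commuting a derivation past the transport term. -/
lemma derivation_transport (δ : Derivation ℝ A₀ A₀) (hx : ∀ i f, δ (B₀.dx i f) = B₀.dx i (δ f))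
    (ht : ∀ i f, δ (B₀.dt i f) = B₀.dt i (δ f)) (f : A₀) :
    δ (B₀.transport xi xit f) = B₀.transport xi xit (δ f)
      + B₀.transport (fun r => δ (xi r)) (fun r => δ (xit r)) f := by
  simp only [Background.transport, map_sum, map_add, derivation_mul, hx, ht, ← sum_add_distrib]
  exact sum_congr rfl fun k _ => by ring

lemma σ_dx (i : Fin D) (f : A) : V.σ (B.dx i f) = B₀.dx i (V.σ f)
    + B₀.transport (fun r => B₀.dx i (xi r)) (fun r => B₀.dx i (xit r)) (V.q f) := by
  rw [σ, σ, map_sub, derivation_transport (B₀.dx i) (B₀.dx_dx i) (B₀.dx_dt i), V.δ_dx, V.q_dx]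
  ring

lemma σ_dt (i : Fin D) (f : A) : V.σ (B.dt i f) = B₀.dt i (V.σ f)
    + B₀.transport (fun r => B₀.dt i (xi r)) (fun r => B₀.dt i (xit r)) (V.q f) := by
  rw [σ, σ, map_sub, derivation_transport (B₀.dt i) (fun j f => (B₀.dx_dt j i f).symm)
    (B₀.dt_dt i), V.δ_dt, V.q_dt]
  ring

lemma q_cD (κ : Kind) (i : Fin D) (f : A) : V.q (B.cD κ i f) = B₀.cD κ i (V.q f) := by
  cases κ <;> simp [Background.cD_unb, Background.cD_bar, V.q_dx, V.q_dt, V.q_E]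

/-- The family with transposed `ℰ`. -/
def swap : GaugeVariation B.swap B₀.swap xi (-xit) where
  q := V.q
  δ := V.δ
  δ_mul := V.δ_mul
  q_dx := V.q_dx
  q_dt i f := by simp [Background.swap, V.q_dt]
  δ_dx := V.δ_dx
  δ_dt i f := by simp [Background.swap, V.δ_dt]
  q_E i j := V.q_E j i
  q_d := V.q_d
  q_gI := V.q_gI
  δ_E i j := by
    have h : B₀.swap.transport xi (-xit) (B₀.swap.E i j) = B₀.transport xi xit (B₀.E j i) := by
      simp [Background.transport, Background.swap]
    rw [h, Background.gaugeE_eq]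
    refine (V.δ_E j i).trans ?_
    rw [Background.gaugeE_eq, Background.swap_cD, Background.swap_cD]
    simp only [Background.swap, Kind.swap, Pi.neg_apply, map_neg, sum_add_distrib]
    ring
  δ_d := by
    refine V.δ_d.trans ?_
    simp [Background.transport, Background.swap]

lemma swap_σ (f : A) : V.swap.σ f = V.σ f := by
  simp [σ, swap, Background.transport, Background.swap]

/-- Commuting the transport past 𝒟_i and varying ℰ in 𝒟_i leaves 𝒟_iξ^k 𝒟_k f together with terms
𝒟̄_k(·)∂̃^k f. The strong constraint in the form `sc_dt` turns the latter into −∂̃^k(·)𝒟_k f,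
completing the rotation matrix. -/
lemma σ_cD_unb (i : Fin D) (f : A) : V.σ (B.cD unb i f) =
    B₀.cD unb i (V.σ f) + ∑ k, B₀.rot xi xit unb i k * B₀.cD unb k (V.q f) := by
  have h1 : ∀ g, ∑ k, B₀.dt k g * B₀.cD unb k (V.q f) = -∑ k, B₀.cD bar k g * B₀.dt k (V.q f) :=
    fun g => by
      have h := B₀.sc_dt (V.q f) g
      simp_rw [mul_comm (B₀.cD bar _ g), h, neg_neg]
  have h2 : ∑ k, (∑ j, B₀.E i j * B₀.dt k (xi j)) * B₀.cD unb k (V.q f) =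
      -∑ k, (∑ j, B₀.E i j * B₀.cD bar k (xi j)) * B₀.dt k (V.q f) := by
    have e : ∀ a b : Fin D → Fin D → A₀, ∑ k, (∑ j, B₀.E i j * a k j) * b k k =
        ∑ j, B₀.E i j * ∑ k, a k j * b k k := fun a b => by
      simp_rw [sum_mul, mul_sum]
      rw [sum_comm]
      exact sum_congr rfl fun j _ => sum_congr rfl fun k _ => by ring
    rw [e (fun k j => B₀.dt k (xi j)) fun k _ => B₀.cD unb k (V.q f),
      e (fun k j => B₀.cD bar k (xi j)) fun k _ => B₀.dt k (V.q f)]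
    simp_rw [h1, mul_neg, sum_neg_distrib]
  have h3 : ∑ k, B₀.cD unb i (xi k) * B₀.cD unb k (V.q f) =
      ∑ k, B₀.cD unb i (xi k) * B₀.dx k (V.q f)
      - ∑ k, (∑ j, B₀.cD unb i (xi j) * B₀.E j k) * B₀.dt k (V.q f) := by
    simp_rw [B₀.cD_unb _ (V.q f), mul_sub, sum_sub_distrib, mul_sum, sum_mul]
    rw [sum_comm (f := fun j k => _ * (_ * _))]
    congr 1
    exact sum_congr rfl fun k _ => sum_congr rfl fun j _ => by ring
  have h4 : B₀.transport (fun r => B₀.dx i (xi r)) (fun r => B₀.dx i (xit r)) (V.q f)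
      - ∑ j, B₀.E i j * B₀.transport (fun r => B₀.dt j (xi r)) (fun r => B₀.dt j (xit r)) (V.q f) =
      ∑ k, B₀.cD unb i (xi k) * B₀.dx k (V.q f) + ∑ k, B₀.cD unb i (xit k) * B₀.dt k (V.q f) := by
    simp_rw [B₀.cD_unb i, Background.transport, mul_sum]
    rw [sum_comm, ← sum_sub_distrib, ← sum_add_distrib]
    refine sum_congr rfl fun k _ => ?_
    simp_rw [sub_mul, sum_mul, mul_add, sum_add_distrib, mul_assoc]
    ring
  rw [B.cD_unb, σ_sub, σ_sum, σ_dx, B₀.cD_unb i (V.σ f)]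
  simp_rw [σ_mul, σ_dt, V.q_dt, V.q_E, σ_E, B₀.gaugeE_eq, B₀.rot_unb, add_mul, sub_mul, mul_add,
    sum_add_distrib, sum_sub_distrib, add_mul, sum_add_distrib]
  rw [h1, h2, h3]
  simp_rw [mul_comm (B₀.cD bar _ (xi _))]
  linear_combination h4

lemma σ_cD (κ : Kind) (i : Fin D) (f : A) : V.σ (B.cD κ i f) =
    B₀.cD κ i (V.σ f) + ∑ k, B₀.rot xi xit κ i k * B₀.cD κ k (V.q f) := by
  cases κ with
  | unb => exact V.σ_cD_unb i f
  | bar =>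
    have h := V.swap.σ_cD_unb i f
    simp only [swap_σ, Background.swap_cD, Background.swap_rot, Kind.swap] at h
    exact h

/-- The derivatives of ξ̃ in the two variations combine into differences 𝒟̄ − 𝒟 = 2g∂̃, which are
precisely the ∂̃-parts of the barred rotations. -/
lemma σ_E_add_E (i j : Fin D) : V.σ (B.E i j + B.E j i) =
    ∑ r, B₀.rot xi xit bar i r * (B₀.E r j + B₀.E j r)
      + ∑ r, B₀.rot xi xit bar j r * (B₀.E r i + B₀.E i r) := by
  have h : ∀ i j, ∑ r, B₀.rot xi xit bar i r * (B₀.E r j + B₀.E j r) =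
      ∑ r, B₀.cD bar i (xi r) * (B₀.E r j + B₀.E j r)
      - (B₀.cD bar j (xit i) - B₀.cD unb j (xit i))
      - ∑ k, B₀.E k i * (B₀.cD bar j (xi k) - B₀.cD unb j (xi k)) := fun i j => by
    simp_rw [B₀.rot_bar, B₀.cD_bar_sub_cD_unb, sub_mul, sum_sub_distrib, mul_sum, sum_mul]
    rw [sum_comm (f := fun k r => B₀.E k i * _)]
    congr 1
    · congr 1
      exact sum_congr rfl fun r _ => by ring
    · exact sum_congr rfl fun r _ => sum_congr rfl fun k _ => by ring
  rw [σ_add, σ_E, σ_E, B₀.gaugeE_eq, B₀.gaugeE_eq, h, h]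
  simp_rw [mul_add, mul_sub, sum_add_distrib, sum_sub_distrib, mul_comm (B₀.E _ _)]
  ring

lemma σ_gI_bar (i j : Fin D) : V.σ (B.gI i j) =
    -∑ r, B₀.gI i r * B₀.rot xi xit bar r j - ∑ r, B₀.gI j r * B₀.rot xi xit bar r i := by
  have h : ∀ l, ∑ k, (B₀.gI i k * V.σ (B.E k l + B.E l k)
      + V.σ (B.gI i k) * (B₀.E k l + B₀.E l k)) = 0 := fun l => by
    have h1 := congrArg V.σ (B.gI_g i l)
    simp_rw [σ_sum, σ_mul, map_add, V.q_E, V.q_gI] at h1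
    rw [h1]
    split_ifs
    · have h2 := V.σ_algebraMap 2
      rwa [map_ofNat] at h2
    · exact map_zero V.σHom
  have h2 : ∑ l, B₀.gI j l * ∑ k, (B₀.E l k + B₀.E k l) * V.σ (B.gI i k) = 2 * V.σ (B.gI i j) :=
    B₀.gI_mul_E j fun k => V.σ (B.gI i k)
  have h3 : ∀ i j, ∑ l, B₀.gI j l * ∑ k, B₀.gI i k *
      ∑ r, B₀.rot xi xit bar k r * (B₀.E r l + B₀.E l r) =
      2 * ∑ r, B₀.gI i r * B₀.rot xi xit bar r j := fun i j => by
    rw [mul_sum]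
    have e : ∀ k, 2 * (B₀.gI i k * B₀.rot xi xit bar k j) = B₀.gI i k *
        ∑ l, B₀.gI j l * ∑ r, (B₀.E l r + B₀.E r l) * B₀.rot xi xit bar k r := fun k => by
      rw [B₀.gI_mul_E]
      ring
    simp_rw [e, mul_sum]
    rw [sum_comm]
    exact sum_congr rfl fun k _ => sum_congr rfl fun l _ => sum_congr rfl fun r _ => by ring
  have h4 : ∑ l, B₀.gI j l * ∑ k, (B₀.gI i k * V.σ (B.E k l + B.E l k)
      + V.σ (B.gI i k) * (B₀.E k l + B₀.E l k)) = 0 := by simp_rw [h]; simp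
  have h5 : ∑ l, B₀.gI j l * ∑ k, B₀.gI i k *
      ∑ r, B₀.rot xi xit bar l r * (B₀.E r k + B₀.E k r) =
      ∑ k, B₀.gI i k * ∑ l, B₀.gI j l *
        ∑ r, B₀.rot xi xit bar l r * (B₀.E r k + B₀.E k r) := by
    simp_rw [mul_sum]
    rw [sum_comm]
    exact sum_congr rfl fun k _ => sum_congr rfl fun l _ => sum_congr rfl fun r _ => by ring
  have h6 : ∑ l, B₀.gI j l * ∑ k, V.σ (B.gI i k) * (B₀.E k l + B₀.E l k) =
      2 * V.σ (B.gI i j) := by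
    rw [← h2]
    exact sum_congr rfl fun l _ => by
      congr 1
      exact sum_congr rfl fun k _ => by ring
  simp_rw [sum_add_distrib, mul_add _ (∑ _, _), sum_add_distrib, h6, σ_E_add_E, mul_add _ (∑ _, _),
    sum_add_distrib, mul_add _ (∑ _, _), sum_add_distrib, h3, h5, h3] at h4
  linear_combination half A₀ * h4 - (V.σ (B.gI i j)
    + ∑ r, B₀.gI i r * B₀.rot xi xit bar r j + ∑ r, B₀.gI j r * B₀.rot xi xit bar r i)
      * two_mul_half A₀

lemma σ_gI (κ : Kind) (i j : Fin D) : V.σ (B.gI i j) =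
    -∑ r, B₀.gI i r * B₀.rot xi xit κ r j - ∑ r, B₀.gI j r * B₀.rot xi xit κ r i := by
  cases κ with
  | bar => exact V.σ_gI_bar i j
  | unb =>
    have h := V.swap.σ_gI_bar i j
    simp only [swap_σ, Background.swap_rot, Kind.swap] at h
    exact h

/-- Apart from one rotation per index there remains only what `gaugeE_cyclic` leaves of the second
derivatives of the parameters. -/
lemma σ_gamLow (p q l : Fin D) : V.σ (B.gamLow unb bar p q l) =
    ∑ r, B₀.rot xi xit unb p r * B₀.gamLow unb bar r q l
      + ∑ r, B₀.rot xi xit bar q r * B₀.gamLow unb bar p r l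
      + ∑ r, B₀.rot xi xit bar l r * B₀.gamLow unb bar p q r
      + ∑ k, (B₀.E l k + B₀.E k l) * B₀.cD unb p (B₀.rot xi xit bar q k) := by
  have h := B₀.gaugeE_cyclic xi xit p q l
  simp only [Background.gamLow, Background.DE, σ_add, σ_sub, σ_cD, σ_E, V.q_E, mul_add, mul_sub,
    sum_add_distrib, sum_sub_distrib] at h ⊢
  linear_combination h

lemma q_gamLow (κ τ : Kind) (i j l : Fin D) : V.q (B.gamLow κ τ i j l) = B₀.gamLow κ τ i j l := by
  cases κ <;> cases τ <;> simp [Background.gamLow, Background.DE, q_cD, V.q_E]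

lemma q_Gam (κ τ : Kind) (i j k : Fin D) : V.q (B.Gam κ τ i j k) = B₀.Gam κ τ i j k := by
  simp [Background.Gam_eq, map_half, V.q_gI, q_gamLow]

/-- Raising the last index turns ℰ + ℰᵗ into 2δ, so the inhomogeneous term is that of a connection:
𝒟_p of the matrix rotating barred indices. -/
lemma σ_Gam_unb_bar (p q k : Fin D) : V.σ (B.Gam unb bar p q k) =
    ∑ r, B₀.rot xi xit unb p r * B₀.Gam unb bar r q k
      + ∑ r, B₀.rot xi xit bar q r * B₀.Gam unb bar p r k
      - ∑ r, B₀.Gam unb bar p q r * B₀.rot xi xit bar r k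
      + B₀.cD unb p (B₀.rot xi xit bar q k) := by
  have h1 : ∑ l, B₀.gI k l * ∑ s, (B₀.E l s + B₀.E s l) * B₀.cD unb p (B₀.rot xi xit bar q s) =
      2 * B₀.cD unb p (B₀.rot xi xit bar q k) := B₀.gI_mul_E k _
  have h2 : ∀ (m : Fin D → A₀) (X : Fin D → Fin D → A₀), ∑ r, m r *
      (half A₀ * ∑ l, B₀.gI k l * X r l) = half A₀ * ∑ l, B₀.gI k l * ∑ r, m r * X r l := by
    intro m X
    simp_rw [mul_sum]
    rw [sum_comm]
    exact sum_congr rfl fun r _ => sum_congr rfl fun l _ => by ring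
  have h3 : ∑ l, (∑ r, B₀.gI k r * B₀.rot xi xit bar r l) * B₀.gamLow unb bar p q l =
      ∑ l, B₀.gI k l * ∑ r, B₀.rot xi xit bar l r * B₀.gamLow unb bar p q r := by
    simp_rw [mul_sum, sum_mul]
    rw [sum_comm]
    exact sum_congr rfl fun r _ => sum_congr rfl fun l _ => by ring
  have h4 : ∑ r, (half A₀ * ∑ l, B₀.gI r l * B₀.gamLow unb bar p q l) * B₀.rot xi xit bar r k =
      half A₀ * ∑ l, (∑ r, B₀.gI l r * B₀.rot xi xit bar r k) * B₀.gamLow unb bar p q l := by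
    simp_rw [mul_sum, sum_mul, mul_sum]
    rw [sum_comm]
    exact sum_congr rfl fun r _ => sum_congr rfl fun l _ => by rw [B₀.gI_symm l r]; ring
  simp_rw [Background.Gam_eq, σ_half_mul, σ_sum, σ_mul, V.q_gI, q_gamLow, σ_gamLow, V.σ_gI bar,
    h2, h4, mul_add _ _ (∑ _, _), sub_mul, neg_mul, sum_add_distrib, sum_sub_distrib,
    sum_neg_distrib, h1, h3]
  linear_combination B₀.cD unb p (B₀.rot xi xit bar q k) * two_mul_half A₀

lemma σ_Gam_bar_unb (q p k : Fin D) : V.σ (B.Gam bar unb q p k) =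
    ∑ r, B₀.rot xi xit bar q r * B₀.Gam bar unb r p k
      + ∑ r, B₀.rot xi xit unb p r * B₀.Gam bar unb q r k
      - ∑ r, B₀.Gam bar unb q p r * B₀.rot xi xit unb r k
      + B₀.cD bar q (B₀.rot xi xit unb p k) := by
  have h := V.swap.σ_Gam_unb_bar q p k
  simp only [swap_σ, Background.swap_cD, Background.swap_rot, Background.swap_Gam, Kind.swap] at h
  exact h

/-- This is the divergence of a rotated frame vector, n_k^l w_l + 𝒟̄_l n_k^l. The density term
−½∂_Mξ^M of δd supplies the derivative of the divergence of ξ required by `sum_dt_gaugeE`. -/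
lemma σ_frameDiv (k : Fin D) : V.σ (B.frameDiv k) =
    ∑ r, B₀.rot xi xit bar k r * B₀.frameDiv r + ∑ l, B₀.cD bar l (B₀.rot xi xit bar k l) := by
  have h := B₀.sum_dt_gaugeE xi xit k
  have h2 : V.σ (2 * B.cD bar k B.d) = 2 * V.σ (B.cD bar k B.d) := by
    rw [two_mul, two_mul, σ_add]
  rw [Background.frameDiv, σ_sub, σ_sum, h2, σ_cD, σ_d, V.q_d, map_neg, derivation_mul,
    derivation_half]
  simp_rw [σ_dt, V.q_E, σ_E, Background.frameDiv, mul_sub, sum_sub_distrib]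
  have h3 : ∑ r, B₀.rot xi xit bar k r * (2 * B₀.cD bar r B₀.d) =
      2 * ∑ r, B₀.rot xi xit bar k r * B₀.cD bar r B₀.d := by
    rw [mul_sum]
    exact sum_congr rfl fun r _ => by ring
  rw [h3]
  linear_combination h + B₀.cD bar k (∑ i, (B₀.dx i (xi i) + B₀.dt i (xit i))) * two_mul_half A₀

end GaugeVariation

end DFT

end

/-! ### Tensoriality of the generalized Ricci tensor under gauge transformations. -/

noncomputable section

namespace DFT

open Kind Finset

namespace GaugeVariation

variable {D : ℕ} {A A₀ : Type*} [CommRing A] [Algebra ℝ A] [CommRing A₀] [Algebra ℝ A₀]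
  {B : Background D A} {B₀ : Background D A₀} {xi xit : Fin D → A₀}
  (V : GaugeVariation B B₀ xi xit)

lemma q_frameDiv (k : Fin D) : V.q (B.frameDiv k) = B₀.frameDiv k := by
  simp [Background.frameDiv, q_cD, V.q_E, V.q_dt, V.q_d, two_mul]

lemma q_genRicci (p q : Fin D) : V.q (B.genRicci p q) = B₀.genRicci p q := by
  simp [Background.genRicci, q_cD, q_frameDiv, q_Gam]

/-- The generalized Ricci tensor transforms as a tensor. -/
lemma σ_genRicci (p q : Fin D) : V.σ (B.genRicci p q) =
    ∑ r, B₀.rot xi xit unb p r * B₀.genRicci r q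
      + ∑ r, B₀.rot xi xit bar q r * B₀.genRicci p r := by
  set m := B₀.rot xi xit unb with hm
  set n := B₀.rot xi xit bar with hn
  set Γ := B₀.Gam unb bar with hΓ
  set Γ' := B₀.Gam bar unb with hΓ'
  set w := B₀.frameDiv with hw
  -- Second derivatives of n come from 𝒟̄Γ and from 𝒟w in opposite orders; bringing them to one
  -- order produces Γ-terms.
  have hcomm : ∀ k, B₀.cD bar k (B₀.cD unb p (n q k)) = B₀.cD unb p (B₀.cD bar k (n q k))
      - ∑ r, Γ p k r * B₀.cD bar r (n q k) + ∑ r, Γ' k p r * B₀.cD unb r (n q k) := fun k => by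
    linear_combination -B₀.cD_comm_Gam p k (n q k)
  have h1 : ∑ k, V.σ (B.cD bar k (B.Gam unb bar p q k)) =
      ∑ r, m p r * ∑ k, B₀.cD bar k (Γ r q k) + ∑ r, n q r * ∑ k, B₀.cD bar k (Γ p r k)
      + ∑ k, ∑ r, B₀.cD bar k (m p r) * Γ r q k + ∑ k, ∑ r, B₀.cD bar k (n q r) * Γ p r k
      - ∑ r, Γ p q r * ∑ k, B₀.cD bar k (n r k)
      + ∑ k, B₀.cD unb p (B₀.cD bar k (n q k))
      - ∑ k, ∑ r, Γ p k r * B₀.cD bar r (n q k)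
      + ∑ k, ∑ r, Γ' k p r * B₀.cD unb r (n q k) := by
    have e1 : ∑ k, ∑ r, n k r * B₀.cD bar r (Γ p q k) =
        ∑ k, ∑ r, B₀.cD bar k (Γ p q r) * n r k := by
      rw [sum_comm]
      exact sum_congr rfl fun k _ => sum_congr rfl fun r _ => mul_comm _ _
    have e2 : ∀ X Y : Fin D → Fin D → A₀, ∑ r, X r r * ∑ k, Y r k = ∑ k, ∑ r, X r r * Y r k :=
      fun X Y => by simp_rw [mul_sum]; exact sum_comm
    rw [e2 (fun r _ => m p r) fun r k => B₀.cD bar k (Γ r q k),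
      e2 (fun r _ => n q r) fun r k => B₀.cD bar k (Γ p r k),
      e2 (fun r _ => Γ p q r) fun r k => B₀.cD bar k (n r k)]
    simp_rw [σ_cD, σ_Gam_unb_bar, q_Gam, map_add, map_sub, map_sum, derivation_mul, ← hm, ← hn,
      ← hΓ, hcomm, sum_add_distrib, sum_sub_distrib, sum_add_distrib]
    simp_rw [map_add, map_sum, derivation_mul, sum_add_distrib]
    rw [e1]
    ring
  have h2 : ∑ k, V.σ (B.Gam unb bar p q k * B.frameDiv k) =
      ∑ r, m p r * ∑ k, Γ r q k * w k + ∑ r, n q r * ∑ k, Γ p r k * w k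
      + ∑ k, B₀.cD unb p (n q k) * w k + ∑ r, Γ p q r * ∑ k, B₀.cD bar k (n r k) := by
    have e1 : ∑ k, ∑ r, Γ p q r * n r k * w k = ∑ k, Γ p q k * ∑ r, n k r * w r := by
      simp_rw [mul_sum]
      rw [sum_comm]
      exact sum_congr rfl fun k _ => sum_congr rfl fun r _ => by ring
    have e2 : ∀ (x : Fin D → A₀) (Y : Fin D → Fin D → A₀),
        ∑ r, x r * ∑ k, Y r k * w k = ∑ k, ∑ r, x r * Y r k * w k := fun x Y => by
      simp_rw [mul_sum]
      rw [sum_comm]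
      exact sum_congr rfl fun k _ => sum_congr rfl fun r _ => by ring
    rw [e2, e2]
    simp_rw [σ_mul, σ_frameDiv, σ_Gam_unb_bar, q_Gam, q_frameDiv, ← hm, ← hn, ← hΓ, ← hw, add_mul,
      sub_mul, sum_mul, mul_add, sum_add_distrib, sum_sub_distrib]
    simp_rw [add_mul, sum_mul, sum_add_distrib]
    rw [e1]
    ring
  have h3 : V.σ (B.cD unb p (B.frameDiv q)) =
      ∑ r, m p r * B₀.cD unb r (w q) + ∑ r, n q r * B₀.cD unb p (w r)
      + ∑ k, B₀.cD unb p (n q k) * w k + ∑ k, B₀.cD unb p (B₀.cD bar k (n q k)) := by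
    simp_rw [σ_cD, σ_frameDiv, q_frameDiv, map_add, map_sum, derivation_mul, sum_add_distrib]
    ring
  have h4 : ∑ k, ∑ l, V.σ (B.Gam bar unb k p l * B.Gam unb bar l q k) =
      ∑ r, m p r * ∑ k, ∑ l, Γ' k r l * Γ l q k + ∑ r, n q r * ∑ k, ∑ l, Γ' k p l * Γ l r k
      + ∑ k, ∑ r, B₀.cD bar k (m p r) * Γ r q k
      + ∑ k, ∑ r, Γ' k p r * B₀.cD unb r (n q k) := by
    have e1 : ∑ k, ∑ l, Γ' k p l * ∑ r, Γ l q r * n r k =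
        ∑ k, ∑ l, (∑ r, n k r * Γ' r p l) * Γ l q k := by
      simp_rw [mul_sum, sum_mul]
      rw [sum_comm, sum_comm (s := univ (α := Fin D))
        (f := fun k l => ∑ r, n k r * Γ' r p l * Γ l q k)]
      refine sum_congr rfl fun l _ => ?_
      rw [sum_comm]
      exact sum_congr rfl fun k _ => sum_congr rfl fun r _ => by ring
    have e2 : ∑ k, ∑ l, (∑ r, Γ' k p r * m r l) * Γ l q k =
        ∑ k, ∑ l, Γ' k p l * ∑ r, m l r * Γ r q k := by
      simp_rw [mul_sum, sum_mul]
      refine sum_congr rfl fun k _ => ?_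
      rw [sum_comm]
      exact sum_congr rfl fun l _ => sum_congr rfl fun r _ => by ring
    have e3 : ∀ (x : Fin D → A₀) (Y : Fin D → Fin D → Fin D → A₀),
        ∑ r, x r * ∑ k, ∑ l, Y r k l = ∑ k, ∑ l, ∑ r, x r * Y r k l := fun x Y => by
      simp_rw [mul_sum]
      rw [sum_comm]
      exact sum_congr rfl fun k _ => sum_comm
    have e4 : ∑ k, ∑ l, (∑ r, m p r * Γ' k r l) * Γ l q k =
        ∑ r, m p r * ∑ k, ∑ l, Γ' k r l * Γ l q k := by
      simp_rw [e3, sum_mul, mul_assoc]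
    have e5 : ∑ k, ∑ l, Γ' k p l * ∑ r, n q r * Γ l r k =
        ∑ r, n q r * ∑ k, ∑ l, Γ' k p l * Γ l r k := by
      simp_rw [e3, mul_sum, mul_left_comm]
    simp_rw [σ_mul, σ_Gam_bar_unb, σ_Gam_unb_bar, q_Gam, ← hm, ← hn, ← hΓ, ← hΓ', add_mul,
      sub_mul, mul_add, mul_sub, sum_add_distrib, sum_sub_distrib]
    simp only [add_mul, mul_add, sum_add_distrib]
    rw [e1, e2, e4, e5]
    ring
  -- The Leibniz term with 𝒟̄n cancels the first Γ-term of the commutator. The second one, and the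
  -- term with 𝒟̄m, cancel against the inhomogeneous parts of the product ΓΓ in `h4`.
  have h5 : ∑ k, ∑ r, B₀.cD bar k (n q r) * Γ p r k =
      ∑ k, ∑ r, Γ p k r * B₀.cD bar r (n q k) := by
    rw [sum_comm]
    exact sum_congr rfl fun k _ => sum_congr rfl fun r _ => mul_comm _ _
  simp only [Background.genRicci, σ_sub, σ_sum, σ_add, sum_add_distrib, mul_sub, mul_add,
    sum_sub_distrib]
  rw [h1, h2, h3, h4, h5]
  ring

/-- The Ricci-like tensor transforms as a tensor under gauge transformations. -/
theorem δ_ricci (p q : Fin D) : V.δ (B.ricci p q) =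
    B₀.transport xi xit (B₀.ricci p q) + ∑ r, B₀.rot xi xit unb p r * B₀.ricci r q
      + ∑ r, B₀.rot xi xit bar q r * B₀.ricci p r := by
  have h := V.σ_genRicci p q
  simp only [B.ricci_eq_neg_genRicci, B₀.ricci_eq_neg_genRicci, mul_neg, sum_neg_distrib, map_neg]
  rw [σ, q_genRicci] at h
  have h1 : ∀ f, B₀.transport xi xit (-f) = -B₀.transport xi xit f := fun f => by
    simp only [Background.transport, map_neg, mul_neg, ← sum_neg_distrib]
    exact sum_congr rfl fun k _ => by ring
  rw [h1]
  linear_combination -h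

end GaugeVariation

end DFT

end

/-! ### The gauge transformation in terms of η, η̄ and covariant derivatives. -/

noncomputable section

namespace DFT

open Kind Finset

namespace Background

variable {D : ℕ} {A : Type*} [CommRing A] [Algebra ℝ A] (B : Background D A)

/-- The gauge parameters `η` and `η̄` with frame indices. -/
def eta (xi xit : Fin D → A) : Kind → Fin D → A
  | unb, i => -xit i + ∑ j, B.E i j * xi j
  | bar, i => xit i + ∑ j, B.E j i * xi j

/-- The part of the gauge transformation of a tensor `T_{pq}` without mixed derivatives of `η`. -/
def firstLine (xi xit : Fin D → A) (T : Fin D → Fin D → A) (p q : Fin D) : A :=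
  half A * (∑ k, ∑ l, B.gI k l *
      (B.eta xi xit unb k * B.cov2 unb unb bar l T p q
        + B.eta xi xit bar k * B.cov2 bar unb bar l T p q))
  + half A * (∑ k, ∑ l, B.gI k l *
      (B.cov1 bar bar q (B.eta xi xit bar) l - B.cov1 bar bar l (B.eta xi xit bar) q) * T p k)
  + half A * (∑ k, ∑ l, B.gI k l *
      (B.cov1 unb unb p (B.eta xi xit unb) l - B.cov1 unb unb l (B.eta xi xit unb) p) * T k q)

/-- The term with mixed derivatives of `η` which rotates the barred index. -/
def extraOne (xi xit : Fin D → A) (T : Fin D → Fin D → A) (p q : Fin D) : A :=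
  half A * (∑ k, ∑ l, B.gI k l *
      (B.cov1 bar unb q (B.eta xi xit unb) l + B.cov1 unb bar l (B.eta xi xit bar) q) * T p k)

/-- The term with mixed derivatives of `η` which rotates the unbarred index. -/
def extraTwo (xi xit : Fin D → A) (T : Fin D → Fin D → A) (p q : Fin D) : A :=
  half A * (∑ k, ∑ l, B.gI k l *
      (B.cov1 unb bar p (B.eta xi xit bar) l + B.cov1 bar unb l (B.eta xi xit unb) p) * T k q)

variable (xi xit : Fin D → A)

lemma swap_eta (κ : Kind) : B.swap.eta xi (-xit) κ = B.eta xi xit κ.swap := by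
  funext i
  cases κ <;> simp [eta, swap, Kind.swap]

lemma swap_cov1 (κ τ : Kind) (i : Fin D) (V : Fin D → A) (j : Fin D) :
    B.swap.cov1 κ τ i V j = B.cov1 κ.swap τ.swap i V j := by
  simp only [cov1, swap_cD, swap_Gam]

lemma eta_unb_add_eta_bar (k : Fin D) :
    B.eta xi xit unb k + B.eta xi xit bar k = ∑ j, (B.E k j + B.E j k) * xi j := by
  simp_rw [eta, add_mul, sum_add_distrib]
  ring

lemma gI_mul_eta (k : Fin D) :
    ∑ l, B.gI k l * (B.eta xi xit unb l + B.eta xi xit bar l) = 2 * xi k := by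
  simp_rw [eta_unb_add_eta_bar, gI_mul_E]

/-- The transport term in terms of frame derivatives. -/
lemma transport_eq (f : A) : B.transport xi xit f = half A * ∑ k, ∑ l, B.gI k l *
    (B.eta xi xit unb k * B.cD unb l f + B.eta xi xit bar k * B.cD bar l f) := by
  -- Decompose η·𝒟 + η̄·𝒟̄ as (η + η̄)·𝒟 + η̄·(𝒟̄ − 𝒟), where η + η̄ = 2gξ and 𝒟̄ − 𝒟 = 2g∂̃.
  have h1 : ∑ k, ∑ l, B.gI k l *
      ((B.eta xi xit unb k + B.eta xi xit bar k) * B.cD unb l f) =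
      2 * ∑ l, xi l * B.cD unb l f := by
    rw [sum_comm, mul_sum]
    refine sum_congr rfl fun l _ => ?_
    rw [← mul_assoc, ← B.gI_mul_eta xi xit, sum_mul]
    exact sum_congr rfl fun k _ => by rw [B.gI_symm]; ring
  have h2 : ∑ k, ∑ l, B.gI k l * (B.eta xi xit bar k * (B.cD bar l f - B.cD unb l f)) =
      2 * ∑ k, B.eta xi xit bar k * B.dt k f := by
    rw [mul_sum]
    refine sum_congr rfl fun k _ => ?_
    rw [mul_left_comm, ← gI_mul_cD_sub, mul_sum]
    exact sum_congr rfl fun l _ => by ring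
  have h3 : ∑ k, ∑ l, B.gI k l *
      (B.eta xi xit unb k * B.cD unb l f + B.eta xi xit bar k * B.cD bar l f) =
      2 * ∑ l, xi l * B.cD unb l f + 2 * ∑ k, B.eta xi xit bar k * B.dt k f := by
    rw [← h1, ← h2, ← sum_add_distrib]
    refine sum_congr rfl fun k _ => ?_
    rw [← sum_add_distrib]
    exact sum_congr rfl fun l _ => by ring
  have h4 : ∑ l, xi l * B.cD unb l f + ∑ k, B.eta xi xit bar k * B.dt k f =
      B.transport xi xit f := by
    have e : ∑ l, xi l * ∑ k, B.E l k * B.dt k f = ∑ k, (∑ j, B.E j k * xi j) * B.dt k f := by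
      simp_rw [mul_sum, sum_mul]
      rw [sum_comm]
      exact sum_congr rfl fun k _ => sum_congr rfl fun l _ => by ring
    simp_rw [transport, cD_unb, eta, mul_sub, add_mul, sum_add_distrib, sum_sub_distrib, e]
    ring
  rw [h3, ← h4]
  linear_combination (-∑ l, xi l * B.cD unb l f - ∑ k, B.eta xi xit bar k * B.dt k f)
    * two_mul_half A

/-- The rotation of barred indices in terms of covariant derivatives of `η` and `η̄`. -/
lemma rot_bar_eq (q k : Fin D) : B.rot xi xit bar q k =
    half A * (∑ l, B.gI k l *
      (B.cov1 bar bar q (B.eta xi xit bar) l - B.cov1 bar bar l (B.eta xi xit bar) q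
      + (B.cov1 bar unb q (B.eta xi xit unb) l + B.cov1 unb bar l (B.eta xi xit bar) q)))
    - half A * ∑ m, ∑ l, B.gI m l * (B.eta xi xit unb m * B.Gam unb bar l q k
      + B.eta xi xit bar m * B.Gam bar bar l q k) := by
  set η := B.eta xi xit unb with hη
  set η' := B.eta xi xit bar with hη'
  -- In the combined Christoffel terms η and η̄ have the same coefficient, so only their sum 2gξ
  -- enters.
  have hG : ∑ l, ∑ m, ∑ r, B.gI k l * B.gI m r * ((η m + η' m) *
        (B.cD bar l (B.E r q) - B.cD unb l (B.E r q) - B.cD bar q (B.E r l + B.E l r))) =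
      2 * ∑ l, B.gI k l * ∑ m, (-(B.Gam bar bar q l m * η' m) + B.Gam bar bar l q m * η' m
          - B.Gam bar unb q l m * η m - B.Gam unb bar l q m * η' m)
        - 2 * ∑ m, ∑ r, B.gI m r * (η m * B.Gam unb bar r q k + η' m * B.Gam bar bar r q k) := by
    have e1 : ∑ m, ∑ r, B.gI m r * (η m * B.Gam unb bar r q k + η' m * B.Gam bar bar r q k) =
        half A * ∑ l, ∑ m, ∑ r, B.gI k l * B.gI m r * (η m *
          (B.cD unb r (B.E l q) + B.cD bar q (B.E r l) - B.cD bar l (B.E r q))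
          + η' m * B.cD bar r (B.E l q)) := by
      simp_rw [Gam, mul_sum, ← sum_add_distrib, mul_sum]
      conv_rhs => rw [sum_comm]
      refine sum_congr rfl fun m _ => ?_
      conv_rhs => rw [sum_comm]
      exact sum_congr rfl fun r _ => sum_congr rfl fun l _ => by ring
    have e2 : ∑ l, B.gI k l * ∑ m, (-(B.Gam bar bar q l m * η' m) + B.Gam bar bar l q m * η' m
          - B.Gam bar unb q l m * η m - B.Gam unb bar l q m * η' m) =
        half A * ∑ l, ∑ m, ∑ r, B.gI k l * B.gI m r *
          (η' m * (B.cD bar l (B.E r q) - B.cD bar q (B.E r l) - (B.cD unb l (B.E r q)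
            + B.cD bar q (B.E l r) - B.cD bar r (B.E l q)))
          - η m * (B.cD bar q (B.E l r) + B.cD unb l (B.E r q) - B.cD unb r (B.E l q))) := by
      simp_rw [Gam, mul_sum]
      refine sum_congr rfl fun l _ => sum_congr rfl fun m _ => ?_
      simp_rw [sum_mul]
      rw [← sum_neg_distrib, ← sum_add_distrib, ← sum_sub_distrib, ← sum_sub_distrib, mul_sum]
      exact sum_congr rfl fun r _ => by ring
    rw [e1, e2, ← mul_assoc, ← mul_assoc, two_mul_half, one_mul, one_mul]
    simp_rw [← sum_sub_distrib]
    refine sum_congr rfl fun l _ => sum_congr rfl fun m _ => sum_congr rfl fun r _ => ?_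
    rw [map_add]
    ring
  have hG' : ∑ l, ∑ m, ∑ r, B.gI k l * B.gI m r * ((η m + η' m) *
        (B.cD bar l (B.E r q) - B.cD unb l (B.E r q) - B.cD bar q (B.E r l + B.E l r))) =
      2 * ∑ l, B.gI k l * ∑ r, xi r *
        (B.cD bar l (B.E r q) - B.cD unb l (B.E r q) - B.cD bar q (B.E r l + B.E l r)) := by
    rw [mul_sum]
    refine sum_congr rfl fun l _ => ?_
    rw [mul_left_comm, mul_sum, mul_sum, sum_comm]
    refine sum_congr rfl fun r _ => ?_
    rw [← mul_assoc 2, ← B.gI_mul_eta xi xit, sum_mul, mul_sum]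
    exact sum_congr rfl fun m _ => by rw [B.gI_symm r m]; ring
  have h1 : ∑ l, B.gI k l * (B.cD bar l (η' q) - B.cD unb l (η' q)) =
      2 * (B.dt k (xit q) + ∑ j, B.E j q * B.dt k (xi j) + ∑ j, B.dt k (B.E j q) * xi j) := by
    rw [gI_mul_cD_sub, hη', eta, map_add, map_sum]
    simp_rw [derivation_mul, sum_add_distrib]
    ring
  have h2 : ∑ l, B.gI k l * B.cD bar q (η l + η' l) = 2 * B.cD bar q (xi k)
      + ∑ l, B.gI k l * ∑ r, xi r * B.cD bar q (B.E r l + B.E l r) := by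
    rw [← B.gI_mul_E k fun j => B.cD bar q (xi j), ← sum_add_distrib]
    refine sum_congr rfl fun l _ => ?_
    rw [← mul_add, hη, hη', eta_unb_add_eta_bar, map_sum, ← sum_add_distrib]
    congr 1
    refine sum_congr rfl fun r _ => ?_
    rw [derivation_mul, add_comm (B.E l r)]
    ring
  -- These are the derivatives of ℰ that appear when 𝒟̄_q acts on 2gξ and ∂̃^k on η̄_q, with the
  -- opposite sign.
  have h3 : ∑ l, B.gI k l * ∑ r, xi r *
        (B.cD bar l (B.E r q) - B.cD unb l (B.E r q) - B.cD bar q (B.E r l + B.E l r)) =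
      2 * ∑ r, B.dt k (B.E r q) * xi r
        - ∑ l, B.gI k l * ∑ r, xi r * B.cD bar q (B.E r l + B.E l r) := by
    have e : 2 * ∑ r, B.dt k (B.E r q) * xi r =
        ∑ l, B.gI k l * ∑ r, xi r * (B.cD bar l (B.E r q) - B.cD unb l (B.E r q)) := by
      simp_rw [mul_sum]
      rw [sum_comm]
      refine sum_congr rfl fun r _ => ?_
      rw [← mul_assoc, ← gI_mul_cD_sub, sum_mul]
      exact sum_congr rfl fun l _ => by ring
    rw [e, ← sum_sub_distrib]
    refine sum_congr rfl fun l _ => ?_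
    rw [← mul_sub, ← sum_sub_distrib]
    congr 1
    exact sum_congr rfl fun r _ => by ring
  have h4 : ∑ l, B.gI k l *
      (B.cov1 bar bar q η' l - B.cov1 bar bar l η' q + (B.cov1 bar unb q η l + B.cov1 unb bar l η' q))
      = ∑ l, B.gI k l * B.cD bar q (η l + η' l)
        - ∑ l, B.gI k l * (B.cD bar l (η' q) - B.cD unb l (η' q))
        + ∑ l, B.gI k l * ∑ m, (-(B.Gam bar bar q l m * η' m) + B.Gam bar bar l q m * η' m
          - B.Gam bar unb q l m * η m - B.Gam unb bar l q m * η' m) := by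
    rw [← sum_sub_distrib, ← sum_add_distrib]
    refine sum_congr rfl fun l _ => ?_
    simp_rw [sum_sub_distrib, sum_add_distrib, sum_neg_distrib, cov1, map_add]
    ring
  rw [h4, h1, h2]
  have h5 : B.rot xi xit bar q k = B.cD bar q (xi k) - B.dt k (xit q)
      - ∑ j, B.E j q * B.dt k (xi j) := B.rot_bar xi xit q k
  rw [h5]
  rw [hG, h3] at hG'
  have h6 : ∀ x : A, half A * (2 * x) = x := fun x => by
    linear_combination x * two_mul_half A
  have h7 := congrArg (fun x => half A * (half A * x)) hG'
  simp only [mul_sub, h6] at h7 ⊢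
  simp only [mul_add, mul_sub, h6] at h7 ⊢
  linear_combination -h7

/-- The rotation of unbarred indices in terms of covariant derivatives of `η` and `η̄`. -/
lemma rot_unb_eq (p k : Fin D) : B.rot xi xit unb p k =
    half A * (∑ l, B.gI k l *
      (B.cov1 unb unb p (B.eta xi xit unb) l - B.cov1 unb unb l (B.eta xi xit unb) p
      + (B.cov1 unb bar p (B.eta xi xit bar) l + B.cov1 bar unb l (B.eta xi xit unb) p)))
    - half A * ∑ m, ∑ l, B.gI m l * (B.eta xi xit unb m * B.Gam unb unb l p k
      + B.eta xi xit bar m * B.Gam bar unb l p k) := by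
  have h := B.swap.rot_bar_eq xi (-xit) p k
  simp only [swap_rot, swap_eta, swap_cov1, swap_Gam, Kind.swap] at h
  rw [h]
  simp_rw [add_comm (B.eta xi xit unb _ * _)]
  rfl

/-- The gauge transformation of a tensor in terms of covariant derivatives. -/
lemma firstLine_add_extra (T : Fin D → Fin D → A) (p q : Fin D) :
    B.firstLine xi xit T p q + B.extraOne xi xit T p q + B.extraTwo xi xit T p q =
      B.transport xi xit (T p q) + ∑ r, B.rot xi xit unb p r * T r q
        + ∑ r, B.rot xi xit bar q r * T p r := by
  have h1 : ∑ k, ∑ l, B.gI k l *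
      (B.eta xi xit unb k * B.cov2 unb unb bar l T p q
        + B.eta xi xit bar k * B.cov2 bar unb bar l T p q) =
      ∑ k, ∑ l, B.gI k l *
        (B.eta xi xit unb k * B.cD unb l (T p q) + B.eta xi xit bar k * B.cD bar l (T p q))
      - ∑ r, (∑ m, ∑ l, B.gI m l * (B.eta xi xit unb m * B.Gam unb unb l p r
          + B.eta xi xit bar m * B.Gam bar unb l p r)) * T r q
      - ∑ r, (∑ m, ∑ l, B.gI m l * (B.eta xi xit unb m * B.Gam unb bar l q r
          + B.eta xi xit bar m * B.Gam bar bar l q r)) * T p r := by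
    have e : ∀ (X : Fin D → Fin D → Fin D → A) (t : Fin D → A),
        ∑ r, (∑ m, ∑ l, X m l r) * t r = ∑ m, ∑ l, ∑ r, X m l r * t r := fun X t => by
      simp_rw [sum_mul]
      rw [sum_comm]
      exact sum_congr rfl fun m _ => sum_comm
    rw [e, e]
    simp_rw [← sum_sub_distrib]
    refine sum_congr rfl fun m _ => sum_congr rfl fun l _ => ?_
    have e' : ∀ (a : A) (Y Z : A) (G G' t : Fin D → A),
        ∑ r, a * (Y * G r + Z * G' r) * t r = a * (Y * ∑ r, G r * t r + Z * ∑ r, G' r * t r) :=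
      fun a Y Z G G' t => by
        simp_rw [mul_sum, ← sum_add_distrib, mul_sum]
        exact sum_congr rfl fun r _ => by ring
    rw [e', e', cov2, cov2]
    ring
  have h2 : ∀ (R t : Fin D → A) (a b : Fin D → Fin D → A) (S : Fin D → A),
      (∀ r, R r = half A * (∑ l, B.gI r l * (a r l + b r l)) - half A * S r) →
      ∑ r, R r * t r = half A * (∑ r, ∑ l, B.gI r l * a r l * t r)
        + half A * (∑ r, ∑ l, B.gI r l * b r l * t r) - half A * ∑ r, S r * t r :=
    fun R t a b S h => by
      rw [mul_sum, mul_sum, mul_sum, ← sum_add_distrib, ← sum_sub_distrib]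
      refine sum_congr rfl fun r _ => ?_
      rw [h]
      simp_rw [mul_add, sum_add_distrib, ← sum_mul]
      ring
  rw [h2 _ (fun r => T r q) _ _ _ (B.rot_unb_eq xi xit p),
    h2 _ (fun r => T p r) _ _ _ (B.rot_bar_eq xi xit q), firstLine, extraOne, extraTwo, h1, B.transport_eq]
  ring

/-- The rotations with the strong constraint violating terms made explicit. -/
lemma rot_unb_eq_dx (p l : Fin D) : B.rot xi xit unb p l = B.dx p (xi l) - B.dt l (xit p)
    + ∑ k, B.E p k * (B.dt l (xi k) - B.dt k (xi l)) := by
  rw [rot_unb, cD_unb]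
  simp_rw [mul_sub, sum_sub_distrib]
  ring

/-- Separates the coefficients of the two Lie derivatives from the contraction of ℰ with T^{kl}. -/
lemma rot_bar_eq_dx (q k : Fin D) : B.rot xi xit bar q k = B.dx q (xi k) - B.dt k (xit q)
    + ∑ l, B.E l q * (B.dt l (xi k) - B.dt k (xi l)) := by
  rw [rot_bar, cD_bar]
  simp_rw [mul_sub, sum_sub_distrib]
  ring

end Background

end DFT

end

/-! ### Backgrounds related by O(D,D): frames, symbols and divergences. -/

noncomputable section

namespace DFT

open Kind Finset

/-- Two backgrounds on the same algebra which are related by an `O(D,D)` transformation; `M unb`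
and `M bar` are the matrices acting on the two kinds of indices. -/
structure ODDPair {D : ℕ} {A : Type*} [CommRing A] [Algebra ℝ A] (B B' : Background D A) where
  M : Kind → Fin D → Fin D → A
  c : Fin D → Fin D → A
  cD_eq : ∀ κ i f, B.cD κ i f = ∑ r, M κ i r * B'.cD κ r f
  gI_eq : ∀ κ n m, ∑ k, ∑ l, B.gI k l * (M κ k n * M κ l m) = B'.gI n m
  derivation_E : ∀ (δ : Derivation ℝ A A) j l,
    δ (B.E j l) = ∑ r, ∑ s, M unb j r * M bar l s * δ (B'.E r s)
  M_bar : ∀ i k, M bar i k = M unb i k + ∑ j, (B.E i j + B.E j i) * c k j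
  c_M : ∀ k l, ∑ j, c k j * M unb j l = -∑ j, c l j * M bar j k
  derivation_unb : ∀ (δ : Derivation ℝ A A) i k, δ (M unb i k) = -∑ j, c k j * δ (B.E i j)
  derivation_bar : ∀ (δ : Derivation ℝ A A) i k, δ (M bar i k) = ∑ j, c k j * δ (B.E j i)
  dt_eq : ∀ κ s f, ∑ l, M κ l s * B.dt l f =
    B'.dt s f + ∑ l, M κ l s * ∑ r, c r l * B'.cD κ.swap r f
  d_eq : B'.d = B.d

namespace ODDPair

variable {D : ℕ} {A : Type*} [CommRing A] [Algebra ℝ A] {B B' : Background D A}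
  (P : ODDPair B B')

/-- The transposed pair. -/
def swap : ODDPair B.swap B'.swap where
  M κ := P.M κ.swap
  c i j := -P.c i j
  cD_eq κ i f := by simpa only [Background.swap_cD] using P.cD_eq κ.swap i f
  gI_eq κ := P.gI_eq κ.swap
  derivation_E δ j l := by
    refine (P.derivation_E δ l j).trans ?_
    rw [sum_comm]
    exact sum_congr rfl fun r _ => sum_congr rfl fun s _ => by
      simp only [Kind.swap, Background.swap]
      ring
  M_bar i k := by
    simp only [Kind.swap, Background.swap, P.M_bar i k, mul_neg, sum_neg_distrib]
    simp_rw [add_comm (B.E i _)]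
    ring
  c_M k l := by
    simp only [Kind.swap, neg_mul, sum_neg_distrib, P.c_M l k, neg_neg]
  derivation_unb δ i k := by
    simpa [Kind.swap, Background.swap] using P.derivation_bar δ i k
  derivation_bar δ i k := by
    simpa [Kind.swap, Background.swap] using P.derivation_unb δ i k
  dt_eq κ s f := by
    have h := P.dt_eq κ.swap s f
    simp only [Background.swap_cD]
    simp only [Background.swap, Derivation.neg_apply, mul_neg, neg_mul, sum_neg_distrib, h]
    ring
  d_eq := P.d_eq

/-- The inverse metric in the new frame, for possibly different kinds of indices. -/
def con (κ τ : Kind) (n m : Fin D) : A := ∑ k, ∑ l, B.gI k l * (P.M κ k n * P.M τ l m)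

/-- M̄ = M + 2g cᵗ, so a contraction of unlike kinds misses g′ by 2cM. This defect generates the
inhomogeneous terms of the symbols. -/
lemma con_unb_bar (n m : Fin D) :
    P.con unb bar n m = B'.gI n m + 2 * ∑ j, P.c m j * P.M unb j n := by
  rw [con, ← P.gI_eq unb, mul_sum, ← sum_add_distrib]
  refine sum_congr rfl fun k _ => ?_
  have h := B.gI_mul_E k fun j => P.c m j
  rw [← mul_assoc, ← h, sum_mul, ← sum_add_distrib]
  refine sum_congr rfl fun l _ => ?_
  rw [P.M_bar]
  ring

lemma con_bar_unb (n m : Fin D) :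
    P.con bar unb n m = B'.gI n m + 2 * ∑ j, P.c n j * P.M unb j m := by
  rw [B'.gI_symm, ← con_unb_bar, con, con, sum_comm]
  exact sum_congr rfl fun k _ => sum_congr rfl fun l _ => by rw [B.gI_symm]; ring

lemma sum_con (κ τ : Kind) (n : Fin D) (X : Fin D → A) :
    ∑ k, (∑ l, B.gI k l * ∑ m, P.M τ l m * X m) * P.M κ k n = ∑ m, P.con κ τ n m * X m := by
  simp_rw [con, mul_sum, sum_mul]
  conv_rhs => rw [sum_comm]
  refine sum_congr rfl fun k _ => ?_
  conv_rhs => rw [sum_comm]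
  exact sum_congr rfl fun l _ => sum_congr rfl fun m _ => by ring

/-- The second index of ℰ_{jl} is barred while the raised index counts as unbarred. The contraction
is therefore mixed, and its defect equals 𝒟_i M because δM = −δℰ cᵗ. -/
lemma sum_Gam_unb_unb (i j n : Fin D) : ∑ k, B.Gam unb unb i j k * P.M unb k n =
    ∑ r, P.M unb i r * ∑ s, P.M unb j s * B'.Gam unb unb r s n + B.cD unb i (P.M unb j n) := by
  have h1 : ∀ l, B.cD unb i (B.E j l) =
      ∑ m, P.M bar l m * ∑ s, P.M unb j s * B.cD unb i (B'.E s m) := fun l => by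
    rw [P.derivation_E, sum_comm]
    refine sum_congr rfl fun m _ => ?_
    rw [mul_sum]
    exact sum_congr rfl fun s _ => by ring
  have h2 : ∑ k, B.Gam unb unb i j k * P.M unb k n =
      half A * ∑ m, P.con unb bar n m * ∑ s, P.M unb j s * B.cD unb i (B'.E s m) := by
    rw [← sum_con, mul_sum]
    refine sum_congr rfl fun k _ => ?_
    rw [Background.Gam, mul_assoc]
    simp_rw [← h1]
  have h3 : ∑ r, P.M unb i r * ∑ s, P.M unb j s * B'.Gam unb unb r s n =
      half A * ∑ m, B'.gI n m * ∑ s, P.M unb j s * B.cD unb i (B'.E s m) := by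
    simp_rw [Background.Gam, P.cD_eq unb i, mul_sum]
    conv_rhs => rw [sum_comm]
    conv_lhs => rw [sum_comm]
    refine sum_congr rfl fun s _ => ?_
    rw [sum_comm]
    exact sum_congr rfl fun m _ => sum_congr rfl fun r _ => by ring
  have h4 : B.cD unb i (P.M unb j n) = ∑ m, (∑ l, P.c m l * P.M unb l n) *
      ∑ s, P.M unb j s * B.cD unb i (B'.E s m) := by
    rw [P.derivation_unb]
    simp_rw [P.c_M _ n, neg_mul, sum_neg_distrib, h1, sum_mul, mul_sum]
    rw [sum_comm]
    simp_rw [mul_assoc]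
  rw [h2, h3, h4]
  simp_rw [con_unb_bar, add_mul, sum_add_distrib, mul_add, mul_assoc, ← mul_sum]
  rw [← mul_assoc, mul_comm (half A) 2, two_mul_half, one_mul]

/-- Only 𝒟_iℰ_{lj} has its contracted index of the wrong kind, giving the defect 𝒟_i M̄; the other
two terms contract barred with barred and transform homogeneously. -/
lemma sum_Gam_unb_bar (i j n : Fin D) : ∑ k, B.Gam unb bar i j k * P.M bar k n =
    ∑ r, P.M unb i r * ∑ s, P.M bar j s * B'.Gam unb bar r s n + B.cD unb i (P.M bar j n) := by
  have h1 : ∀ l, B.cD unb i (B.E l j) =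
      ∑ m, P.M unb l m * ∑ s, P.M bar j s * B.cD unb i (B'.E m s) := fun l => by
    rw [P.derivation_E]
    refine sum_congr rfl fun m _ => ?_
    rw [mul_sum]
    exact sum_congr rfl fun s _ => by ring
  have h2 : ∀ l, B.cD bar j (B.E i l) - B.cD bar l (B.E i j) = ∑ m, P.M bar l m *
      (∑ r, P.M unb i r * B.cD bar j (B'.E r m)
        - ∑ r, ∑ s, P.M unb i r * P.M bar j s * B'.cD bar m (B'.E r s)) := fun l => by
    simp_rw [mul_sub, sum_sub_distrib, ← P.derivation_E (B'.cD bar _) i j]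
    rw [P.cD_eq bar l, P.derivation_E, sum_comm]
    congr 1
    refine sum_congr rfl fun m _ => ?_
    rw [mul_sum]
    exact sum_congr rfl fun s _ => by ring
  have h3 : ∑ k, B.Gam unb bar i j k * P.M bar k n =
      half A * (∑ m, P.con bar unb n m * (∑ s, P.M bar j s * B.cD unb i (B'.E m s))
        + ∑ m, P.con bar bar n m * (∑ r, P.M unb i r * B.cD bar j (B'.E r m)
        - ∑ r, ∑ s, P.M unb i r * P.M bar j s * B'.cD bar m (B'.E r s))) := by
    rw [← sum_con, ← sum_con, mul_add, mul_sum, mul_sum, ← sum_add_distrib]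
    refine sum_congr rfl fun k _ => ?_
    rw [Background.Gam, mul_assoc, ← mul_add, ← add_mul, ← sum_add_distrib]
    simp_rw [← h1, ← h2, ← mul_add, add_sub_assoc]
  have h4 : ∑ r, P.M unb i r * ∑ s, P.M bar j s * B'.Gam unb bar r s n =
      half A * (∑ m, B'.gI n m * (∑ s, P.M bar j s * B.cD unb i (B'.E m s))
        + ∑ m, B'.gI n m * (∑ r, P.M unb i r * B.cD bar j (B'.E r m)
        - ∑ r, ∑ s, P.M unb i r * P.M bar j s * B'.cD bar m (B'.E r s))) := by
    have e1 : ∀ m, ∑ s, P.M bar j s * B.cD unb i (B'.E m s) =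
        ∑ r, ∑ s, P.M unb i r * P.M bar j s * B'.cD unb r (B'.E m s) := fun m => by
      simp_rw [P.cD_eq unb i, mul_sum]
      rw [sum_comm]
      exact sum_congr rfl fun r _ => sum_congr rfl fun s _ => by ring
    have e2 : ∀ m, ∑ r, P.M unb i r * B.cD bar j (B'.E r m) =
        ∑ r, ∑ s, P.M unb i r * P.M bar j s * B'.cD bar s (B'.E r m) := fun m => by
      simp_rw [P.cD_eq bar j, mul_sum, mul_assoc]
    simp_rw [e1, e2, ← sum_add_distrib, ← mul_add, ← sum_sub_distrib, ← sum_add_distrib,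
      Background.Gam, mul_sum]
    conv_rhs => rw [sum_comm]
    refine sum_congr rfl fun r _ => ?_
    conv_rhs => rw [sum_comm]
    exact sum_congr rfl fun s _ => sum_congr rfl fun m _ => by ring
  have h5 : B.cD unb i (P.M bar j n) = ∑ m, (∑ l, P.c n l * P.M unb l m) *
      ∑ s, P.M bar j s * B.cD unb i (B'.E m s) := by
    rw [P.derivation_bar]
    simp_rw [h1, sum_mul, mul_sum]
    rw [sum_comm]
    simp_rw [mul_assoc]
  have h6 : P.con bar bar n = B'.gI n := funext fun m => P.gI_eq bar n m
  rw [h3, h4, h5, h6]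
  simp_rw [con_bar_unb, add_mul, sum_add_distrib, mul_assoc, ← mul_sum]
  linear_combination (∑ m, (∑ l, P.c n l * P.M unb l m) *
      ∑ s, P.M bar j s * B.cD unb i (B'.E m s)) * two_mul_half A

/-- The inhomogeneous transformation law of the Christoffel-like symbols. -/
lemma sum_Gam (κ τ : Kind) (i j n : Fin D) : ∑ k, B.Gam κ τ i j k * P.M τ k n =
    ∑ r, P.M κ i r * ∑ s, P.M τ j s * B'.Gam κ τ r s n + B.cD κ i (P.M τ j n) := by
  cases κ <;> cases τ
  · exact P.sum_Gam_unb_unb i j n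
  · exact P.sum_Gam_unb_bar i j n
  · have h := P.swap.sum_Gam_unb_bar i j n
    simp only [Background.swap_cD, Background.swap_Gam] at h
    exact h
  · have h := P.swap.sum_Gam_unb_unb i j n
    simp only [Background.swap_cD, Background.swap_Gam] at h
    exact h

/-- ∂̃ is not covariant by itself: by `dt_eq` it leaves a term with c and 𝒟̄′, and this is just 𝒟̄′
of M̄. -/
lemma frameDiv_eq (k : Fin D) : B.frameDiv k =
    ∑ l, P.M bar k l * B'.frameDiv l + ∑ l, B'.cD bar l (P.M bar k l) := by
  have h1 : ∑ l, B.dt l (B.E l k) =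
      ∑ t, P.M bar k t * ∑ s, B'.dt s (B'.E s t) + ∑ r, B'.cD bar r (P.M bar k r) := by
    have e1 : ∀ s t, ∑ l, P.M unb l s * (P.M bar k t * B.dt l (B'.E s t)) =
        P.M bar k t * B'.dt s (B'.E s t) + ∑ l, ∑ r, P.c r l * (P.M unb l s *
          (P.M bar k t * B'.cD bar r (B'.E s t))) := fun s t => by
      have h := congrArg (fun x => P.M bar k t * x) (P.dt_eq unb s (B'.E s t))
      simp only [mul_sum, mul_add] at h
      simp_rw [mul_left_comm (P.M bar k t)] at h
      rw [h]
      simp_rw [mul_left_comm (P.M unb _ s) (P.M bar k t)]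
      congr 1
      refine sum_congr rfl fun l _ => sum_congr rfl fun r _ => ?_
      simp only [Kind.swap]
      ring
    have e2 : ∀ l, B.dt l (B.E l k) =
        ∑ s, ∑ t, P.M unb l s * (P.M bar k t * B.dt l (B'.E s t)) := fun l => by
      rw [P.derivation_E]
      simp_rw [mul_assoc]
    have e3 : ∀ r, B'.cD bar r (P.M bar k r) = ∑ s, ∑ t, ∑ l, P.c r l * (P.M unb l s *
          (P.M bar k t * B'.cD bar r (B'.E s t))) := fun r => by
      rw [P.derivation_bar]
      simp_rw [P.derivation_E, mul_sum, mul_assoc]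
      rw [sum_comm]
      exact sum_congr rfl fun s _ => sum_comm
    have e4 : ∑ l, B.dt l (B.E l k) = ∑ s, ∑ t, ∑ l,
        P.M unb l s * (P.M bar k t * B.dt l (B'.E s t)) := by
      simp_rw [e2]
      rw [sum_comm]
      exact sum_congr rfl fun s _ => sum_comm
    rw [e4]
    simp_rw [e1, e3, sum_add_distrib, mul_sum]
    congr 1
    · exact sum_comm
    · conv_rhs => rw [sum_comm]
      refine sum_congr rfl fun s _ => ?_
      conv_rhs => rw [sum_comm]
      exact sum_congr rfl fun t _ => sum_comm
  rw [Background.frameDiv, h1, P.cD_eq, ← P.d_eq]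
  simp_rw [Background.frameDiv, mul_sub, sum_sub_distrib, mul_left_comm _ (2 : A), ← mul_sum]
  ring

end ODDPair

end DFT

end

/-! ### O(D,D) covariance of the Ricci-like tensor. -/

noncomputable section

namespace DFT

open Kind Finset

namespace ODDPair

variable {D : ℕ} {A : Type*} [CommRing A] [Algebra ℝ A] {B B' : Background D A}
  (P : ODDPair B B')

/-- The matrices `M` and `M̄` are invertible. -/
lemma exists_inv (κ : Kind) : ∃ N : Matrix (Fin D) (Fin D) A, Matrix.of (P.M κ) * N = 1 := by
  -- From Mᵗg⁻¹M = g′⁻¹ the inverse is read off as g′Mᵗg⁻¹; over a commutative ring a left inverse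
  -- suffices.
  let L : Matrix (Fin D) (Fin D) A := Matrix.of fun i j =>
    half A * ∑ n, (B'.E i n + B'.E n i) * ∑ k, P.M κ k n * B.gI k j
  refine ⟨L, mul_eq_one_comm.mp ?_⟩
  ext i m
  have h1 : ∑ n, (B'.E i n + B'.E n i) * B'.gI n m = if i = m then 2 else 0 := by
    have h := B'.gI_g m i
    simp only [eq_comm (a := m)] at h
    rw [← h]
    exact sum_congr rfl fun n _ => by rw [B'.gI_symm n]; ring
  have h2 : ∑ j, (∑ n, (B'.E i n + B'.E n i) * ∑ k, P.M κ k n * B.gI k j) * P.M κ j m =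
      ∑ n, (B'.E i n + B'.E n i) * B'.gI n m := by
    simp_rw [← P.gI_eq κ, mul_sum, sum_mul]
    rw [sum_comm]
    refine sum_congr rfl fun n _ => ?_
    rw [sum_comm]
    exact sum_congr rfl fun k _ => sum_congr rfl fun j _ => by ring
  rw [Matrix.mul_apply]
  simp only [L, Matrix.of_apply]
  simp_rw [mul_assoc (half A)]
  rw [← mul_sum, h2, h1, Matrix.one_apply]
  split_ifs
  · rw [mul_comm, two_mul_half]
  · rw [mul_zero]

/-- The generalized Ricci tensor is an `O(D,D)` tensor. -/
lemma genRicci_eq (p q : Fin D) : B.genRicci p q =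
    ∑ r, ∑ s, P.M unb p r * P.M bar q s * B'.genRicci r s := by
  set μ := P.M unb p with hμ
  set ν := P.M bar q with hν
  set Γ := B'.Gam unb bar with hΓ
  set Γ' := B'.Gam bar unb with hΓ'
  set w := B'.frameDiv with hw
  have hY : ∀ n, ∑ k, B.Gam unb bar p q k * P.M bar k n =
      ∑ r, ∑ s, μ r * ν s * Γ r s n + ∑ r, μ r * B'.cD unb r (ν n) := fun n => by
    rw [P.sum_Gam, P.cD_eq]
    simp_rw [mul_sum, mul_assoc]
    rfl
  have hcomm : ∀ n r, B'.cD bar n (B'.cD unb r (ν n)) = B'.cD unb r (B'.cD bar n (ν n))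
      - ∑ k, Γ r n k * B'.cD bar k (ν n) + ∑ k, Γ' n r k * B'.cD unb k (ν n) := fun n r => by
    linear_combination -B'.cD_comm_Gam r n (ν n)
  -- The left side is the divergence of a vector with upper barred index k. By `frameDiv_eq` it
  -- equals the divergence of the same vector in the new frame, so M̄ need not be inverted here.
  have h1 : ∑ k, (B.cD bar k (B.Gam unb bar p q k) + B.Gam unb bar p q k * B.frameDiv k) =
      ∑ n, (B'.cD bar n (∑ k, B.Gam unb bar p q k * P.M bar k n)
        + (∑ k, B.Gam unb bar p q k * P.M bar k n) * w n) := by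
    simp_rw [map_sum, sum_mul, ← sum_add_distrib]
    rw [sum_comm]
    refine sum_congr rfl fun k _ => ?_
    rw [P.frameDiv_eq, P.cD_eq, mul_add, mul_sum, mul_sum, ← sum_add_distrib, ← sum_add_distrib]
    refine sum_congr rfl fun n _ => ?_
    rw [derivation_mul]
    ring
  have h2 : ∑ n, (B'.cD bar n (∑ r, ∑ s, μ r * ν s * Γ r s n + ∑ r, μ r * B'.cD unb r (ν n))
        + (∑ r, ∑ s, μ r * ν s * Γ r s n + ∑ r, μ r * B'.cD unb r (ν n)) * w n) =
      ∑ n, ∑ r, ∑ s, μ r * ν s * B'.cD bar n (Γ r s n)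
      + ∑ n, ∑ r, ∑ s, μ r * ν s * (Γ r s n * w n)
      + ∑ n, ∑ r, ∑ s, B'.cD bar n (μ r) * (ν s * Γ r s n)
      + ∑ n, ∑ r, ∑ s, μ r * (B'.cD bar n (ν s) * Γ r s n)
      + ∑ n, ∑ r, μ r * B'.cD unb r (ν n) * w n
      + ∑ n, ∑ r, B'.cD bar n (μ r) * B'.cD unb r (ν n)
      + ∑ n, ∑ r, μ r * B'.cD unb r (B'.cD bar n (ν n))
      - ∑ n, ∑ r, ∑ k, μ r * (Γ r n k * B'.cD bar k (ν n))
      + ∑ n, ∑ r, ∑ k, μ r * (Γ' n r k * B'.cD unb k (ν n)) := by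
    rw [← sum_add_distrib, ← sum_add_distrib, ← sum_add_distrib, ← sum_add_distrib,
      ← sum_add_distrib, ← sum_add_distrib, ← sum_sub_distrib, ← sum_add_distrib]
    refine sum_congr rfl fun n _ => ?_
    simp_rw [map_add, map_sum, derivation_mul, hcomm, add_mul, sum_mul, mul_add, mul_sub,
      sum_add_distrib, sum_sub_distrib, mul_sum, mul_assoc]
    ring
  have h3 : B.cD unb p (B.frameDiv q) = ∑ r, ∑ s, μ r * ν s * B'.cD unb r (w s)
      + ∑ n, ∑ r, μ r * B'.cD unb r (ν n) * w n
      + ∑ n, ∑ r, μ r * B'.cD unb r (B'.cD bar n (ν n)) := by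
    have hs : ∀ f : Fin D → Fin D → A, ∑ n, ∑ r, f n r = ∑ r, ∑ n, f n r := fun _ => sum_comm
    rw [P.frameDiv_eq, P.cD_eq, hs fun n r => μ r * B'.cD unb r (ν n) * w n,
      hs fun n r => μ r * B'.cD unb r (B'.cD bar n (ν n)), ← sum_add_distrib, ← sum_add_distrib,
      ← sum_add_distrib]
    refine sum_congr rfl fun r _ => ?_
    rw [← sum_add_distrib, ← sum_add_distrib, map_sum, mul_sum]
    refine sum_congr rfl fun l _ => ?_
    rw [map_add, derivation_mul]
    ring
  -- The sum is a trace of two matrices whose transformation laws have M on one side and M̄ on the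
  -- other; by cyclicity only M̄ must be cancelled.
  have h4 : ∑ k, ∑ m, B.Gam bar unb k p m * B.Gam unb bar m q k =
      ∑ v, ∑ u, (∑ r, μ r * Γ' v r u + B'.cD bar v (μ u)) *
        (∑ s, ν s * Γ u s v + B'.cD unb u (ν v)) := by
    obtain ⟨N, hN⟩ := P.exists_inv bar
    have e1 : ∀ k u, ∑ m, B.Gam bar unb k p m * P.M unb m u =
        ∑ v, P.M bar k v * (∑ r, μ r * Γ' v r u + B'.cD bar v (μ u)) := fun k u => by
      rw [P.sum_Gam, P.cD_eq]
      simp_rw [mul_add, sum_add_distrib]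
      rfl
    have e2 : ∀ m v, ∑ k, B.Gam unb bar m q k * P.M bar k v =
        ∑ u, P.M unb m u * (∑ s, ν s * Γ u s v + B'.cD unb u (ν v)) := fun m v => by
      rw [P.sum_Gam, P.cD_eq]
      simp_rw [mul_add, sum_add_distrib]
      rfl
    let mG : Matrix (Fin D) (Fin D) A := Matrix.of fun k m => B.Gam bar unb k p m
    let mH : Matrix (Fin D) (Fin D) A := Matrix.of fun m k => B.Gam unb bar m q k
    let mW : Matrix (Fin D) (Fin D) A :=
      Matrix.of fun v u => ∑ r, μ r * Γ' v r u + B'.cD bar v (μ u)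
    let mZ : Matrix (Fin D) (Fin D) A :=
      Matrix.of fun u v => ∑ s, ν s * Γ u s v + B'.cD unb u (ν v)
    have e3 : mG * Matrix.of (P.M unb) = Matrix.of (P.M bar) * mW := by
      ext k u
      rw [Matrix.mul_apply, Matrix.mul_apply]
      exact e1 k u
    have e4 : mH * Matrix.of (P.M bar) = Matrix.of (P.M unb) * mZ := by
      ext m v
      rw [Matrix.mul_apply, Matrix.mul_apply]
      exact e2 m v
    have e5 : (mG * mH).trace = (mW * mZ).trace := by
      calc (mG * mH).trace = (mG * (mH * Matrix.of (P.M bar)) * N).trace := by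
            rw [Matrix.mul_assoc, Matrix.mul_assoc, hN, Matrix.mul_one]
        _ = (Matrix.of (P.M bar) * (mW * mZ * N)).trace := by
            rw [e4, ← Matrix.mul_assoc, e3]
            simp only [Matrix.mul_assoc]
        _ = (mW * mZ).trace := by
            rw [Matrix.trace_mul_comm, Matrix.mul_assoc, mul_eq_one_comm.mp hN, Matrix.mul_one]
    simp only [Matrix.trace, Matrix.diag, Matrix.mul_apply] at e5
    exact e5
  have h5 : ∑ v, ∑ u, (∑ r, μ r * Γ' v r u + B'.cD bar v (μ u)) *
        (∑ s, ν s * Γ u s v + B'.cD unb u (ν v)) =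
      ∑ r, ∑ s, μ r * ν s * ∑ v, ∑ u, Γ' v r u * Γ u s v
      + ∑ n, ∑ r, ∑ k, μ r * (Γ' n r k * B'.cD unb k (ν n))
      + ∑ n, ∑ r, ∑ s, B'.cD bar n (μ r) * (ν s * Γ r s n)
      + ∑ n, ∑ r, B'.cD bar n (μ r) * B'.cD unb r (ν n) := by
    have e1 : ∑ r, ∑ s, μ r * ν s * ∑ v, ∑ u, Γ' v r u * Γ u s v =
        ∑ v, ∑ u, (∑ r, μ r * Γ' v r u) * ∑ s, ν s * Γ u s v := by
      simp_rw [sum_mul_sum, mul_sum]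
      rw [show (∑ r, ∑ s, ∑ v, ∑ u, μ r * ν s * (Γ' v r u * Γ u s v)) =
        ∑ r, ∑ v, ∑ u, ∑ s, μ r * ν s * (Γ' v r u * Γ u s v) from
          sum_congr rfl fun r _ => by rw [sum_comm]; exact sum_congr rfl fun v _ => sum_comm]
      rw [sum_comm]
      refine sum_congr rfl fun v _ => ?_
      rw [sum_comm]
      exact sum_congr rfl fun u _ => sum_congr rfl fun r _ => sum_congr rfl fun s _ => by ring
    have e2 : ∑ n, ∑ r, ∑ k, μ r * (Γ' n r k * B'.cD unb k (ν n)) =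
        ∑ v, ∑ u, (∑ r, μ r * Γ' v r u) * B'.cD unb u (ν v) := by
      simp_rw [sum_mul]
      refine sum_congr rfl fun v _ => ?_
      rw [sum_comm]
      exact sum_congr rfl fun u _ => sum_congr rfl fun r _ => by ring
    have e3 : ∑ n, ∑ r, ∑ s, B'.cD bar n (μ r) * (ν s * Γ r s n) =
        ∑ v, ∑ u, B'.cD bar v (μ u) * ∑ s, ν s * Γ u s v := by
      simp_rw [mul_sum]
    rw [e1, e2, e3]
    simp_rw [← sum_add_distrib]
    exact sum_congr rfl fun v _ => sum_congr rfl fun u _ => by ring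
  -- As for gauge transformations, the Leibniz term is absorbed by the commutator of 𝒟′ and 𝒟̄′.
  have h6 : ∑ n, ∑ r, ∑ s, μ r * (B'.cD bar n (ν s) * Γ r s n) =
      ∑ n, ∑ r, ∑ k, μ r * (Γ r n k * B'.cD bar k (ν n)) := by
    rw [sum_comm]
    conv_rhs => rw [sum_comm]
    refine sum_congr rfl fun r _ => ?_
    rw [sum_comm]
    exact sum_congr rfl fun n _ => sum_congr rfl fun k _ => by ring
  have h7 : ∀ X : Fin D → Fin D → Fin D → A, ∑ n, ∑ r, ∑ s, μ r * ν s * X r s n =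
      ∑ r, ∑ s, μ r * ν s * ∑ n, X r s n := fun X => by
    simp_rw [mul_sum]
    rw [sum_comm]
    exact sum_congr rfl fun r _ => sum_comm
  rw [Background.genRicci, h1]
  simp_rw [hY]
  rw [h2, h3, h4, h5, h6, h7, h7]
  simp_rw [Background.genRicci, mul_sub, sum_add_distrib, mul_add, sum_sub_distrib, sum_add_distrib]
  ring

/-- The Ricci-like tensor is an `O(D,D)` tensor. -/
lemma ricci_eq (p q : Fin D) : B.ricci p q =
    ∑ r, ∑ s, P.M unb p r * P.M bar q s * B'.ricci r s := by
  simp_rw [Background.ricci_eq_neg_genRicci, P.genRicci_eq p q, mul_neg, sum_neg_distrib]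

end ODDPair

end DFT

end

/-! ### O(D,D) covariance of covariant derivatives and of F. -/

noncomputable section

namespace DFT

open Kind Finset

namespace ODDPair

variable {D : ℕ} {A : Type*} [CommRing A] [Algebra ℝ A] {B B' : Background D A}
  (P : ODDPair B B')

/-- The last term is what cancels the derivative falling on M in 𝒟(M X). -/
lemma sum_Gam_mul (κ τ : Kind) (i j : Fin D) (X : Fin D → A) :
    ∑ k, B.Gam κ τ i j k * ∑ n, P.M τ k n * X n =
      ∑ r, P.M κ i r * ∑ s, P.M τ j s * ∑ n, B'.Gam κ τ r s n * X n
        + ∑ n, B.cD κ i (P.M τ j n) * X n := by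
  have h1 : ∑ k, B.Gam κ τ i j k * ∑ n, P.M τ k n * X n =
      ∑ n, (∑ k, B.Gam κ τ i j k * P.M τ k n) * X n := by
    simp_rw [mul_sum, sum_mul]
    rw [sum_comm]
    exact sum_congr rfl fun n _ => sum_congr rfl fun k _ => by ring
  have h2 : ∑ r, P.M κ i r * ∑ s, P.M τ j s * ∑ n, B'.Gam κ τ r s n * X n =
      ∑ n, (∑ r, P.M κ i r * ∑ s, P.M τ j s * B'.Gam κ τ r s n) * X n := by
    simp_rw [mul_sum, sum_mul]
    conv_rhs => rw [sum_comm]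
    refine sum_congr rfl fun r _ => ?_
    rw [sum_comm]
    exact sum_congr rfl fun n _ => sum_congr rfl fun s _ => by ring
  rw [h1, h2, ← sum_add_distrib]
  refine sum_congr rfl fun n _ => ?_
  rw [P.sum_Gam, add_mul]

/-- Covariant derivatives of covectors are `O(D,D)` tensors. -/
lemma cov1_eq (κ τ : Kind) {V V' : Fin D → A} (hV : ∀ j, V j = ∑ s, P.M τ j s * V' s)
    (i j : Fin D) : B.cov1 κ τ i V j =
      ∑ r, P.M κ i r * ∑ s, P.M τ j s * B'.cov1 κ τ r V' s := by
  simp_rw [Background.cov1, hV]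
  rw [sum_Gam_mul]
  simp_rw [map_sum, derivation_mul, sum_add_distrib, mul_sub, sum_sub_distrib, mul_sub,
    sum_sub_distrib]
  have h : ∑ s, P.M τ j s * B.cD κ i (V' s) =
      ∑ r, P.M κ i r * ∑ s, P.M τ j s * B'.cD κ r (V' s) := by
    simp_rw [P.cD_eq κ i, mul_sum]
    rw [sum_comm]
    exact sum_congr rfl fun r _ => sum_congr rfl fun s _ => by ring
  rw [h]
  ring

/-- Covariant derivatives of tensors with two indices are `O(D,D)` tensors. -/
lemma cov2_eq (κ τ₁ τ₂ : Kind) {T T' : Fin D → Fin D → A}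
    (hT : ∀ p q, T p q = ∑ r, ∑ s, P.M τ₁ p r * P.M τ₂ q s * T' r s) (i p q : Fin D) :
    B.cov2 κ τ₁ τ₂ i T p q = ∑ n, P.M κ i n *
      ∑ r, ∑ s, P.M τ₁ p r * P.M τ₂ q s * B'.cov2 κ τ₁ τ₂ n T' r s := by
  have h1 : ∀ k, T k q = ∑ r, P.M τ₁ k r * ∑ s, P.M τ₂ q s * T' r s := fun k => by
    simp_rw [hT, mul_sum, mul_assoc]
  have h2 : ∀ k, T p k = ∑ s, P.M τ₂ k s * ∑ r, P.M τ₁ p r * T' r s := fun k => by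
    simp_rw [hT, mul_sum]
    rw [sum_comm]
    exact sum_congr rfl fun r _ => sum_congr rfl fun s _ => by ring
  have h3 : B.cD κ i (T p q) =
      ∑ n, P.M κ i n * ∑ r, ∑ s, P.M τ₁ p r * P.M τ₂ q s * B'.cD κ n (T' r s)
      + ∑ r, B.cD κ i (P.M τ₁ p r) * ∑ s, P.M τ₂ q s * T' r s
      + ∑ s, B.cD κ i (P.M τ₂ q s) * ∑ r, P.M τ₁ p r * T' r s := by
    have e1 : ∑ n, P.M κ i n * ∑ r, ∑ s, P.M τ₁ p r * P.M τ₂ q s * B'.cD κ n (T' r s) =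
        ∑ r, ∑ s, P.M τ₁ p r * P.M τ₂ q s * B.cD κ i (T' r s) := by
      simp_rw [P.cD_eq κ i, mul_sum]
      rw [sum_comm]
      refine sum_congr rfl fun r _ => ?_
      rw [sum_comm]
      exact sum_congr rfl fun s _ => sum_congr rfl fun n _ => by ring
    have e2 : ∑ s, B.cD κ i (P.M τ₂ q s) * ∑ r, P.M τ₁ p r * T' r s =
        ∑ r, ∑ s, B.cD κ i (P.M τ₂ q s) * (P.M τ₁ p r * T' r s) := by
      simp_rw [mul_sum]
      exact sum_comm
    rw [e1, e2, hT, map_sum, ← sum_add_distrib, ← sum_add_distrib]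
    refine sum_congr rfl fun r _ => ?_
    rw [map_sum, mul_sum, ← sum_add_distrib, ← sum_add_distrib]
    refine sum_congr rfl fun s _ => ?_
    rw [derivation_mul, derivation_mul]
    ring
  rw [Background.cov2, h3]
  simp_rw [h1, h2]
  rw [sum_Gam_mul, sum_Gam_mul]
  have h4 : ∀ n, ∑ r, ∑ s, P.M τ₁ p r * P.M τ₂ q s * B'.cov2 κ τ₁ τ₂ n T' r s =
      ∑ r, ∑ s, P.M τ₁ p r * P.M τ₂ q s * B'.cD κ n (T' r s)
      - ∑ s, P.M τ₁ p s * ∑ m, B'.Gam κ τ₁ n s m * ∑ t, P.M τ₂ q t * T' m t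
      - ∑ s, P.M τ₂ q s * ∑ m, B'.Gam κ τ₂ n s m * ∑ r, P.M τ₁ p r * T' r m := fun n => by
    have e1 : ∀ s, P.M τ₁ p s * ∑ m, B'.Gam κ τ₁ n s m * ∑ t, P.M τ₂ q t * T' m t =
        ∑ t, P.M τ₁ p s * P.M τ₂ q t * ∑ m, B'.Gam κ τ₁ n s m * T' m t := fun s => by
      simp_rw [mul_sum]
      rw [sum_comm]
      exact sum_congr rfl fun r _ => sum_congr rfl fun t _ => by ring
    have e2 : ∑ s, P.M τ₂ q s * ∑ m, B'.Gam κ τ₂ n s m * ∑ r, P.M τ₁ p r * T' r m =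
        ∑ r, ∑ s, P.M τ₁ p r * P.M τ₂ q s * ∑ m, B'.Gam κ τ₂ n s m * T' r m := by
      rw [sum_comm]
      refine sum_congr rfl fun s _ => ?_
      simp_rw [mul_sum]
      rw [sum_comm]
      exact sum_congr rfl fun r _ => sum_congr rfl fun t _ => by ring
    simp_rw [e1]
    rw [e2]
    simp_rw [← sum_sub_distrib]
    refine sum_congr rfl fun r _ => sum_congr rfl fun s _ => ?_
    rw [Background.cov2]
    ring
  simp_rw [h4, mul_sub, sum_sub_distrib]
  ring

lemma _root_.DFT.sum_comm_pairs {ι A : Type*} [Fintype ι] [AddCommMonoid A] (f : ι → ι → ι → ι → A) :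
    ∑ k, ∑ l, ∑ n, ∑ m, f k l n m = ∑ n, ∑ m, ∑ k, ∑ l, f k l n m := by
  calc _ = ∑ k, ∑ n, ∑ l, ∑ m, f k l n m := sum_congr rfl fun k _ => sum_comm
    _ = ∑ n, ∑ k, ∑ l, ∑ m, f k l n m := sum_comm
    _ = ∑ n, ∑ k, ∑ m, ∑ l, f k l n m :=
      sum_congr rfl fun n _ => sum_congr rfl fun k _ => sum_comm
    _ = _ := sum_congr rfl fun n _ => sum_comm

/-- Contractions within one kind pass to g′ without remainder. All contractions in F have this form,
those in the extra terms do not. -/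
lemma contract (κ : Kind) (X Y : Fin D → A) :
    ∑ k, ∑ l, B.gI k l * ((∑ m, P.M κ l m * Y m) * ∑ n, P.M κ k n * X n) =
      ∑ n, ∑ m, B'.gI n m * (Y m * X n) := by
  have h1 : ∀ k l, B.gI k l * ((∑ m, P.M κ l m * Y m) * ∑ n, P.M κ k n * X n) =
      ∑ n, ∑ m, B.gI k l * (P.M κ k n * P.M κ l m) * (Y m * X n) := fun k l => by
    rw [mul_comm (∑ m, _), sum_mul_sum, mul_sum]
    simp_rw [mul_sum]
    exact sum_congr rfl fun n _ => sum_congr rfl fun m _ => by ring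
  simp_rw [h1, ← P.gI_eq κ, sum_mul]
  exact sum_comm_pairs _

/-- The terms of the first line form an `O(D,D)` tensor. -/
lemma firstLine_eq {xi xit xi' xit' : Fin D → A}
    (hη : ∀ κ i, B.eta xi xit κ i = ∑ r, P.M κ i r * B'.eta xi' xit' κ r)
    {T T' : Fin D → Fin D → A}
    (hT : ∀ p q, T p q = ∑ r, ∑ s, P.M unb p r * P.M bar q s * T' r s) (p q : Fin D) :
    B.firstLine xi xit T p q =
      ∑ r, ∑ s, P.M unb p r * P.M bar q s * B'.firstLine xi' xit' T' r s := by
  have h1 : ∀ κ, ∑ k, ∑ l, B.gI k l * (B.eta xi xit κ k * B.cov2 κ unb bar l T p q) =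
      ∑ r, ∑ s, P.M unb p r * P.M bar q s *
        ∑ n, ∑ m, B'.gI n m * (B'.eta xi' xit' κ n * B'.cov2 κ unb bar m T' r s) := fun κ => by
    simp_rw [hη κ, P.cov2_eq κ unb bar hT, mul_comm (∑ r, P.M κ _ r * B'.eta xi' xit' κ r)]
    rw [contract]
    simp_rw [mul_sum, sum_mul, mul_sum]
    rw [sum_comm_pairs]
    exact sum_congr rfl fun r _ => sum_congr rfl fun s _ => sum_congr rfl fun n _ =>
      sum_congr rfl fun m _ => by ring
  have h2 : ∀ (κ : Kind) (t t' : Fin D → A), (∀ k, t k = ∑ n, P.M κ k n * t' n) → ∀ i,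
      ∑ k, ∑ l, B.gI k l * (B.cov1 κ κ i (B.eta xi xit κ) l - B.cov1 κ κ l (B.eta xi xit κ) i)
        * t k =
      ∑ s, P.M κ i s * ∑ n, ∑ m, B'.gI n m * (B'.cov1 κ κ s (B'.eta xi' xit' κ) m
        - B'.cov1 κ κ m (B'.eta xi' xit' κ) s) * t' n := fun κ t t' ht i => by
    have e1 : ∀ l, B.cov1 κ κ i (B.eta xi xit κ) l - B.cov1 κ κ l (B.eta xi xit κ) i =
        ∑ m, P.M κ l m * ∑ s, P.M κ i s * (B'.cov1 κ κ s (B'.eta xi' xit' κ) m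
        - B'.cov1 κ κ m (B'.eta xi' xit' κ) s) := fun l => by
      rw [P.cov1_eq κ κ (hη κ), P.cov1_eq κ κ (hη κ)]
      simp_rw [mul_sub, sum_sub_distrib, mul_sub, sum_sub_distrib]
      congr 1
      simp_rw [mul_sum]
      rw [sum_comm]
      exact sum_congr rfl fun m _ => sum_congr rfl fun s _ => by ring
    simp_rw [e1, ht, mul_assoc]
    rw [contract]
    simp_rw [mul_sum, sum_mul, mul_sum]
    conv_rhs => rw [sum_comm]
    refine sum_congr rfl fun n _ => ?_
    conv_rhs => rw [sum_comm]
    exact sum_congr rfl fun m _ => sum_congr rfl fun s _ => by ring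
  have hp : ∀ k, T p k = ∑ n, P.M bar k n * ∑ r, P.M unb p r * T' r n := fun k => by
    simp_rw [hT, mul_sum]
    rw [sum_comm]
    exact sum_congr rfl fun r _ => sum_congr rfl fun s _ => by ring
  have hq : ∀ k, T k q = ∑ n, P.M unb k n * ∑ s, P.M bar q s * T' n s := fun k => by
    simp_rw [hT, mul_sum, mul_assoc]
  rw [Background.firstLine]
  simp_rw [mul_add (B.gI _ _), sum_add_distrib]
  rw [h1, h1, h2 bar _ _ hp, h2 unb _ _ hq]
  have h3 : ∀ X : Fin D → Fin D → Fin D → A,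
      ∑ s, P.M bar q s * ∑ n, ∑ m, X s n m * ∑ r, P.M unb p r * T' r n =
      ∑ r, ∑ s, P.M unb p r * P.M bar q s * ∑ n, ∑ m, X s n m * T' r n := fun X => by
    simp_rw [mul_sum]
    conv_rhs => rw [sum_comm]
    refine sum_congr rfl fun s _ => ?_
    conv_rhs => rw [sum_comm]
    refine sum_congr rfl fun n _ => ?_
    conv_rhs => rw [sum_comm]
    exact sum_congr rfl fun m _ => sum_congr rfl fun r _ => by ring
  have h4 : ∀ X : Fin D → Fin D → Fin D → A,
      ∑ r, P.M unb p r * ∑ n, ∑ m, X r n m * ∑ s, P.M bar q s * T' n s =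
      ∑ r, ∑ s, P.M unb p r * P.M bar q s * ∑ n, ∑ m, X r n m * T' n s := fun X => by
    simp_rw [mul_sum]
    refine sum_congr rfl fun r _ => ?_
    conv_rhs => rw [sum_comm]
    refine sum_congr rfl fun n _ => ?_
    conv_rhs => rw [sum_comm]
    exact sum_congr rfl fun m _ => sum_congr rfl fun s _ => by ring
  rw [h3 fun s n m => B'.gI n m * (B'.cov1 bar bar s (B'.eta xi' xit' bar) m
      - B'.cov1 bar bar m (B'.eta xi' xit' bar) s),
    h4 fun r n m => B'.gI n m * (B'.cov1 unb unb r (B'.eta xi' xit' unb) m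
      - B'.cov1 unb unb m (B'.eta xi' xit' unb) r)]
  simp_rw [Background.firstLine, mul_add (B'.gI _ _), sum_add_distrib, mul_add, sum_add_distrib,
    mul_left_comm _ (half A), ← mul_sum]

end ODDPair

end DFT

end

/-! ### Matrix identities for the fractional linear action. -/

noncomputable section

namespace DFT

open Kind Finset

/-- The blocks of an `O(D,D)` matrix over a commutative ring. -/
structure ODDBlocks (D : ℕ) (R : Type*) [CommRing R] where
  a : Matrix (Fin D) (Fin D) R
  b : Matrix (Fin D) (Fin D) R
  c : Matrix (Fin D) (Fin D) R
  e : Matrix (Fin D) (Fin D) R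
  ac : a.transpose * c + c.transpose * a = 0
  be : b.transpose * e + e.transpose * b = 0
  ae : a.transpose * e + c.transpose * b = 1
  ea : e.transpose * a + b.transpose * c = 1
  ce : c * e.transpose + e * c.transpose = 0

namespace ODDBlocks

open Matrix

variable {D : ℕ} {R : Type*} [CommRing R] (h : ODDBlocks D R) (E E' : Matrix (Fin D) (Fin D) R)

/-- The matrix acting on unbarred indices. -/
def matM : Matrix (Fin D) (Fin D) R := h.eᵀ - E * h.cᵀ

/-- The matrix acting on barred indices. -/
def matMBar : Matrix (Fin D) (Fin D) R := h.eᵀ + Eᵀ * h.cᵀ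

variable {E E'}

/-- The transpose of M̄ is cℰ + e, so this is the definition of ℰ′. -/
lemma mul_matMBar_transpose (hE : E' * (h.c * E + h.e) = h.a * E + h.b) :
    E' * (h.matMBar E)ᵀ = h.a * E + h.b := by
  rw [← hE, matMBar, transpose_add, transpose_mul, transpose_transpose, transpose_transpose,
    transpose_transpose, add_comm]

lemma matMBar_mul (hE : E' * (h.c * E + h.e) = h.a * E + h.b) :
    h.matMBar E * E'ᵀ = Eᵀ * h.aᵀ + h.bᵀ := by
  have h1 := congrArg transpose (h.mul_matMBar_transpose hE)
  rwa [transpose_mul, transpose_transpose, transpose_add, transpose_mul] at h1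

/-- Multiplied on the right by the invertible cℰ + e, the claim becomes a consequence of the block
relations. It is the second form ℰ′ = M⁻¹(ℰaᵗ − bᵗ) of the action. -/
lemma matM_mul {N : Matrix (Fin D) (Fin D) R} (hN : (h.c * E + h.e) * N = 1)
    (hE : E' * (h.c * E + h.e) = h.a * E + h.b) : h.matM E * E' = E * h.aᵀ - h.bᵀ := by
  have h1 : (h.matM E * E' - (E * h.aᵀ - h.bᵀ)) * (h.c * E + h.e) = 0 := by
    rw [sub_mul, Matrix.mul_assoc, hE, matM]
    linear_combination (norm := noncomm_ring) h.be + h.ea * E - E * h.ac * E - E * h.ae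
  rw [← sub_eq_zero, ← Matrix.mul_one (_ - _), ← hN, ← Matrix.mul_assoc, h1, Matrix.zero_mul]

/-- The only place for `ce`, the relation coming from hηhᵗ = η instead of hᵗηh = η. -/
lemma c_mul_matM : h.c * h.matM E = -(h.c * h.matMBar E)ᵀ := by
  simp only [matM, matMBar, transpose_add, transpose_mul, transpose_transpose]
  linear_combination (norm := noncomm_ring) h.ce

lemma matM_mul_inv {N : Matrix (Fin D) (Fin D) R} (hN : (h.c * E + h.e) * N = 1)
    (hE : E' * (h.c * E + h.e) = h.a * E + h.b) : h.matM E * (h.a - E' * h.c) = 1 := by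
  rw [mul_sub, ← Matrix.mul_assoc, h.matM_mul hN hE, matM]
  linear_combination (norm := noncomm_ring) h.ea - E * h.ac

lemma matMBar_mul_inv (hE : E' * (h.c * E + h.e) = h.a * E + h.b) :
    h.matMBar E * (h.a + E'ᵀ * h.c) = 1 := by
  rw [mul_add, ← Matrix.mul_assoc, h.matMBar_mul hE, matMBar]
  linear_combination (norm := noncomm_ring) h.ea + Eᵀ * h.ac

lemma matM_metric {N : Matrix (Fin D) (Fin D) R} (hN : (h.c * E + h.e) * N = 1)
    (hE : E' * (h.c * E + h.e) = h.a * E + h.b) :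
    h.matM E * (E' + E'ᵀ) * (h.matM E)ᵀ = E + Eᵀ := by
  have h1 : E'ᵀ * (h.matM E)ᵀ = h.a * Eᵀ - h.b := by
    rw [← transpose_mul, h.matM_mul hN hE]
    simp
  rw [mul_add, add_mul, Matrix.mul_assoc _ E'ᵀ, h1, h.matM_mul hN hE]
  simp only [matM, transpose_sub, transpose_mul, transpose_transpose]
  linear_combination (norm := noncomm_ring) E * h.ae + h.ea * Eᵀ - h.be - E * h.ac * Eᵀ

lemma matMBar_metric (hE : E' * (h.c * E + h.e) = h.a * E + h.b) :
    h.matMBar E * (E' + E'ᵀ) * (h.matMBar E)ᵀ = E + Eᵀ := by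
  rw [mul_add, add_mul, Matrix.mul_assoc _ E', h.mul_matMBar_transpose hE, h.matMBar_mul hE]
  simp only [matMBar, transpose_add, transpose_mul, transpose_transpose]
  linear_combination (norm := noncomm_ring) Eᵀ * h.ae + h.ea * E + h.be + Eᵀ * h.ac * E

lemma matM_mul_eta {N : Matrix (Fin D) (Fin D) R} (hN : (h.c * E + h.e) * N = 1)
    (hE : E' * (h.c * E + h.e) = h.a * E + h.b) (x y : Fin D → R) :
    h.matM E *ᵥ (-(h.a *ᵥ y + h.b *ᵥ x) + E' *ᵥ (h.c *ᵥ y + h.e *ᵥ x)) = -y + E *ᵥ x := by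
  have h1 : h.matM E * E' * h.c - h.matM E * h.a = -1 := by
    rw [h.matM_mul hN hE, matM]
    linear_combination (norm := noncomm_ring) E * h.ac - h.ea
  have h2 : h.matM E * E' * h.e - h.matM E * h.b = E := by
    rw [h.matM_mul hN hE, matM]
    linear_combination (norm := noncomm_ring) E * h.ae - h.be
  have h3 := congrArg (fun m => m *ᵥ y) h1
  have h4 := congrArg (fun m => m *ᵥ x) h2
  simp only [sub_mulVec, neg_mulVec, one_mulVec] at h3 h4
  refine Eq.trans ?_ (congrArg₂ (· + ·) h3 h4)
  simp only [mulVec_add, mulVec_neg, mulVec_mulVec, Matrix.mul_assoc]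
  abel

lemma matMBar_mul_eta (hE : E' * (h.c * E + h.e) = h.a * E + h.b) (x y : Fin D → R) :
    h.matMBar E *ᵥ ((h.a *ᵥ y + h.b *ᵥ x) + E'ᵀ *ᵥ (h.c *ᵥ y + h.e *ᵥ x)) = y + Eᵀ *ᵥ x := by
  have h1 : h.matMBar E * E'ᵀ * h.c + h.matMBar E * h.a = 1 := by
    rw [h.matMBar_mul hE, matMBar]
    linear_combination (norm := noncomm_ring) Eᵀ * h.ac + h.ea
  have h2 : h.matMBar E * E'ᵀ * h.e + h.matMBar E * h.b = Eᵀ := by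
    rw [h.matMBar_mul hE, matMBar]
    linear_combination (norm := noncomm_ring) Eᵀ * h.ae + h.be
  have h3 := congrArg (fun m => m *ᵥ y) h1
  have h4 := congrArg (fun m => m *ᵥ x) h2
  simp only [add_mulVec, one_mulVec] at h3 h4
  refine Eq.trans ?_ (congrArg₂ (· + ·) h3 h4)
  simp only [mulVec_add, mulVec_mulVec, Matrix.mul_assoc]
  abel

end ODDBlocks

end DFT

end

/-! ### The O(D,D) transform of a background on the same algebra. -/

noncomputable section

namespace DFT

open Kind Finset Matrix

namespace ODDBlocks

variable {D : ℕ} {R : Type*} [CommRing R]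

/-- Change of rings. -/
def map {S : Type*} [CommRing S] (f : R →+* S) (h : ODDBlocks D R) : ODDBlocks D S where
  a := h.a.map f
  b := h.b.map f
  c := h.c.map f
  e := h.e.map f
  ac := by
    have h1 := congrArg (fun m => m.map f) h.ac
    simpa only [Matrix.map_add f (map_add f), Matrix.map_mul, transpose_map,
      Matrix.map_zero f (map_zero f)] using h1
  be := by
    have h1 := congrArg (fun m => m.map f) h.be
    simpa only [Matrix.map_add f (map_add f), Matrix.map_mul, transpose_map,
      Matrix.map_zero f (map_zero f)] using h1
  ae := by
    have h1 := congrArg (fun m => m.map f) h.ae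
    simpa only [Matrix.map_add f (map_add f), Matrix.map_mul, transpose_map,
      Matrix.map_one f (map_zero f) (map_one f)] using h1
  ea := by
    have h1 := congrArg (fun m => m.map f) h.ea
    simpa only [Matrix.map_add f (map_add f), Matrix.map_mul, transpose_map,
      Matrix.map_one f (map_zero f) (map_one f)] using h1
  ce := by
    have h1 := congrArg (fun m => m.map f) h.ce
    simpa only [Matrix.map_add f (map_add f), Matrix.map_mul, transpose_map,
      Matrix.map_zero f (map_zero f)] using h1

variable (h : ODDBlocks D R)

/-- Invariance of the O(D,D) pairing; applied to two gradients it gives the strong constraint for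
the transformed derivations. -/
lemma dotProduct_oddTransform (t x t' x' : Fin D → R) :
    (h.b *ᵥ t + h.a *ᵥ x) ⬝ᵥ (h.e *ᵥ t' + h.c *ᵥ x')
      + (h.e *ᵥ t + h.c *ᵥ x) ⬝ᵥ (h.b *ᵥ t' + h.a *ᵥ x') = t ⬝ᵥ x' + x ⬝ᵥ t' := by
  have key : ∀ (m n : Matrix (Fin D) (Fin D) R) (u v : Fin D → R),
      (m *ᵥ u) ⬝ᵥ (n *ᵥ v) = u ⬝ᵥ ((mᵀ * n) *ᵥ v) := fun m n u v => by
    rw [← mulVec_mulVec, dotProduct_mulVec u, vecMul_transpose]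
  have e1 := congrArg (fun m => t ⬝ᵥ (m *ᵥ t')) h.be
  have e2 := congrArg (fun m => t ⬝ᵥ (m *ᵥ x')) h.ea
  have e3 := congrArg (fun m => x ⬝ᵥ (m *ᵥ t')) h.ae
  have e4 := congrArg (fun m => x ⬝ᵥ (m *ᵥ x')) h.ac
  simp only [add_mulVec, dotProduct_add, zero_mulVec, dotProduct_zero, one_mulVec] at e1 e2 e3 e4
  simp only [dotProduct_add, add_dotProduct, key]
  linear_combination e1 + e2 + e3 + e4

/-- Applied to matrices of second derivatives, whose symmetry is the hypothesis. The factor 2 is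
needed because `be` and `ac` only say that bᵗe and aᵗc are antisymmetric up to transposition of the
product. -/
lemma trace_oddTransform (tt tx xt xx : Matrix (Fin D) (Fin D) R) (htt : ttᵀ = tt) (hxx : xxᵀ = xx)
    (htx : xtᵀ = tx) :
    2 * (h.b * tt * h.eᵀ + h.b * tx * h.cᵀ + h.a * xt * h.eᵀ + h.a * xx * h.cᵀ).trace =
      2 * tx.trace := by
  have key : ∀ m n q : Matrix (Fin D) (Fin D) R, (m * q * nᵀ).trace = (mᵀ * n * qᵀ).trace :=
    fun m n q => by
      rw [← trace_transpose, transpose_mul, transpose_mul, transpose_transpose, ← Matrix.mul_assoc,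
        trace_mul_comm, ← Matrix.mul_assoc]
  have key' : ∀ m n q : Matrix (Fin D) (Fin D) R, (m * q * nᵀ).trace = (nᵀ * m * q).trace :=
    fun m n q => by rw [trace_mul_comm, ← Matrix.mul_assoc]
  have e1 := congrArg (fun m => (m * tt).trace) h.be
  have e2 := congrArg (fun m => (m * tx).trace) h.ae
  have e4 := congrArg (fun m => (m * xx).trace) h.ac
  simp only [add_mul, trace_add, zero_mul, trace_zero, one_mul] at e1 e2 e4
  have f1 : (h.b * tt * h.eᵀ).trace = (h.bᵀ * h.e * tt).trace := by rw [key, htt]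
  have f1' := key' h.b h.e tt
  have f2 := key' h.b h.c tx
  have f3 : (h.a * xt * h.eᵀ).trace = (h.aᵀ * h.e * tx).trace := by rw [key, htx]
  have f4 : (h.a * xx * h.cᵀ).trace = (h.aᵀ * h.c * xx).trace := by rw [key, hxx]
  have f4' := key' h.a h.c xx
  simp only [trace_add]
  linear_combination f1 + f1' + 2 * f2 + 2 * f3 + f4 + f4' + e1 + 2 * e2 + e4

end ODDBlocks

namespace Background

variable {D : ℕ} {A : Type*} [CommRing A] [Algebra ℝ A] (B : Background D A)
  (h : ODDBlocks D ℝ)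

/-- A linear combination of the coordinate derivations with constant coefficients. -/
def lin (r s : Fin D → ℝ) : Derivation ℝ A A := ∑ i, (r i • B.dt i + s i • B.dx i)

lemma lin_apply (r s : Fin D → ℝ) (f : A) :
    B.lin r s f = ∑ i, (r i • B.dt i f + s i • B.dx i f) := by
  simp [lin, derivation_sum_apply]

lemma lin_comm (r s r' s' : Fin D → ℝ) (f : A) :
    B.lin r s (B.lin r' s' f) = B.lin r' s' (B.lin r s f) := by
  simp only [lin_apply, map_sum, map_add, Derivation.map_smul, smul_sum, ← sum_add_distrib]
  rw [sum_comm]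
  refine sum_congr rfl fun j _ => sum_congr rfl fun i _ => ?_
  rw [B.dt_dt j i, B.dx_dx j i, B.dx_dt j i, ← B.dx_dt i j]
  module

/-- The derivations `∂̃^k` in transformed coordinates. -/
def oddDt (k : Fin D) : Derivation ℝ A A := B.lin (h.e k) (h.c k)

/-- The derivations `∂_k` in transformed coordinates. -/
def oddDx (k : Fin D) : Derivation ℝ A A := B.lin (h.b k) (h.a k)

/-- The blocks with entries in the algebra. -/
abbrev _root_.DFT.ODDBlocks.alg (h : ODDBlocks D ℝ) (A : Type*) [CommRing A] [Algebra ℝ A] :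
    ODDBlocks D A := h.map (algebraMap ℝ A)

lemma oddDt_apply (k : Fin D) (f : A) :
    B.oddDt h k f = ∑ i, (h.e k i • B.dt i f + h.c k i • B.dx i f) := B.lin_apply _ _ f

lemma oddDx_apply (k : Fin D) (f : A) :
    B.oddDx h k f = ∑ i, (h.b k i • B.dt i f + h.a k i • B.dx i f) := B.lin_apply _ _ f

lemma oddDt_vec (f : A) : (fun k => B.oddDt h k f) =
    (h.alg A).e *ᵥ (fun i => B.dt i f) + (h.alg A).c *ᵥ (fun i => B.dx i f) := by
  funext k
  simp [oddDt_apply, mulVec, dotProduct, ODDBlocks.map, sum_add_distrib, Algebra.smul_def]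

lemma oddDx_vec (f : A) : (fun k => B.oddDx h k f) =
    (h.alg A).b *ᵥ (fun i => B.dt i f) + (h.alg A).a *ᵥ (fun i => B.dx i f) := by
  funext k
  simp [oddDx_apply, mulVec, dotProduct, ODDBlocks.map, sum_add_distrib, Algebra.smul_def]

lemma dx_vec (f : A) : (fun i => B.dx i f) =
    (h.alg A).bᵀ *ᵥ (fun k => B.oddDt h k f) + (h.alg A).eᵀ *ᵥ (fun k => B.oddDx h k f) := by
  rw [oddDt_vec, oddDx_vec]
  simp only [mulVec_add, mulVec_mulVec]
  have h1 := congrArg (fun m => m *ᵥ fun i => B.dt i f) (h.alg A).be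
  have h2 := congrArg (fun m => m *ᵥ fun i => B.dx i f) (h.alg A).ea
  simp only [add_mulVec, zero_mulVec, one_mulVec] at h1 h2
  refine Eq.trans ?_ ((congrArg₂ (· + ·) h1 h2).symm.trans ?_)
  · simp
  · abel

lemma dt_vec (f : A) : (fun i => B.dt i f) =
    (h.alg A).aᵀ *ᵥ (fun k => B.oddDt h k f) + (h.alg A).cᵀ *ᵥ (fun k => B.oddDx h k f) := by
  rw [oddDt_vec, oddDx_vec]
  simp only [mulVec_add, mulVec_mulVec]
  have h1 := congrArg (fun m => m *ᵥ fun i => B.dt i f) (h.alg A).ae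
  have h2 := congrArg (fun m => m *ᵥ fun i => B.dx i f) (h.alg A).ac
  simp only [add_mulVec, zero_mulVec, one_mulVec] at h1 h2
  refine Eq.trans ?_ ((congrArg₂ (· + ·) h1 h2).symm.trans ?_)
  · simp
  · abel

/-- A matrix `ℰ' = (aℰ + b)(cℰ + e)⁻¹`. -/
structure ODDMatrix where
  E' : Matrix (Fin D) (Fin D) A
  N : Matrix (Fin D) (Fin D) A
  hN : ((h.alg A).c * Matrix.of B.E + (h.alg A).e) * N = 1
  hE : E' * ((h.alg A).c * Matrix.of B.E + (h.alg A).e) = (h.alg A).a * Matrix.of B.E + (h.alg A).b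

variable {B h} (W : B.ODDMatrix h)

/-- The transformed inverse metric. -/
def ODDMatrix.gI (_ : B.ODDMatrix h) : Matrix (Fin D) (Fin D) A :=
  ((h.alg A).matM (Matrix.of B.E))ᵀ * Matrix.of B.gI * (h.alg A).matM (Matrix.of B.E)

lemma gI_mul_metric : Matrix.of B.gI * (Matrix.of B.E + (Matrix.of B.E)ᵀ) = 2 := by
  ext i j
  rw [Matrix.mul_apply]
  refine (B.gI_g i j).trans ?_
  rw [show (2 : Matrix (Fin D) (Fin D) A) = Matrix.diagonal 2 from rfl, Matrix.diagonal_apply]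
  rfl

lemma _root_.DFT.half_smul_mul_comm (X Y : Matrix (Fin D) (Fin D) A) (hXY : X * Y = 2) :
    Y * X = 2 := by
  have h2 : half A • (2 : Matrix (Fin D) (Fin D) A) = 1 := by
    rw [show (2 : Matrix (Fin D) (Fin D) A) = (2 : A) • 1 from by
      rw [two_smul]; exact one_add_one_eq_two.symm, smul_smul, mul_comm, two_mul_half, one_smul]
  have h1 : (half A • X) * Y = 1 := by rw [Matrix.smul_mul, hXY, h2]
  have h3 := mul_eq_one_comm.mp h1
  rw [Matrix.mul_smul] at h3
  calc Y * X = (2 * half A) • (Y * X) := by rw [two_mul_half, one_smul]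
    _ = 2 := by
      rw [mul_smul, h3, two_smul]
      exact one_add_one_eq_two

lemma ODDMatrix.gI_mul : W.gI * (W.E' + W.E'ᵀ) = 2 := by
  have h1 := gI_mul_metric (B := B)
  rw [← (h.alg A).matM_metric W.hN W.hE, ← Matrix.mul_assoc, ← Matrix.mul_assoc] at h1
  have h2 := half_smul_mul_comm _ _ h1
  rw [← h2, ODDMatrix.gI]
  simp only [Matrix.mul_assoc]

lemma _root_.DFT.eq_of_half_smul_mul {X Y S : Matrix (Fin D) (Fin D) A} (hX : X * S = 2) (hY : Y * S = 2) : X = Y := by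
  have h1 := half_smul_mul_comm _ _ hY
  have h2 : X * 2 = 2 * Y := by
    calc X * 2 = X * (S * Y) := by rw [h1]
      _ = 2 * Y := by rw [← Matrix.mul_assoc, hX]
  have h3 : (2 : A) • X = (2 : A) • Y := by
    rw [two_smul, two_smul, ← mul_two, ← two_mul, h2]
  have h4 := congrArg (fun m => half A • m) h3
  simpa only [smul_smul, mul_comm (half A) 2, two_mul_half, one_smul] using h4

/-- M and M̄ both carry ℰ′ + ℰ′ᵗ to ℰ + ℰᵗ by congruence, so both candidates invert the same matrix
and coincide. -/
lemma ODDMatrix.gI_eq_bar : ((h.alg A).matMBar (Matrix.of B.E))ᵀ * Matrix.of B.gI *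
    (h.alg A).matMBar (Matrix.of B.E) = W.gI := by
  have h1 := gI_mul_metric (B := B)
  rw [← (h.alg A).matMBar_metric W.hE, ← Matrix.mul_assoc, ← Matrix.mul_assoc] at h1
  have h2 := half_smul_mul_comm _ _ h1
  set X := ((h.alg A).matMBar (Matrix.of B.E))ᵀ * Matrix.of B.gI *
    (h.alg A).matMBar (Matrix.of B.E) with hX
  have h3 : X * (W.E' + W.E'ᵀ) = 2 := by
    rw [← h2, hX]
    simp only [Matrix.mul_assoc]
  exact eq_of_half_smul_mul h3 W.gI_mul

/-- The transformed background. -/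
def ODDMatrix.background : Background D A where
  dx := B.oddDx h
  dt := B.oddDt h
  dx_dx _ _ f := B.lin_comm _ _ _ _ f
  dx_dt _ _ f := B.lin_comm _ _ _ _ f
  dt_dt _ _ f := B.lin_comm _ _ _ _ f
  sc f g := by
    have h1 := (h.alg A).dotProduct_oddTransform (fun i => B.dt i f) (fun i => B.dx i f)
      (fun i => B.dt i g) (fun i => B.dx i g)
    rw [← oddDt_vec, ← oddDx_vec, ← oddDt_vec, ← oddDx_vec] at h1
    simp only [dotProduct, ← sum_add_distrib] at h1
    rw [h1, ← B.sc f g]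
    exact sum_congr rfl fun i _ => add_comm _ _
  box f := by
    have h1 := (h.alg A).trace_oddTransform (Matrix.of fun i j => B.dt i (B.dt j f))
      (Matrix.of fun i j => B.dt i (B.dx j f)) (Matrix.of fun i j => B.dx i (B.dt j f))
      (Matrix.of fun i j => B.dx i (B.dx j f)) (by ext i j; exact B.dt_dt _ _ _)
      (by ext i j; exact B.dx_dx _ _ _) (by ext i j; exact B.dx_dt _ _ _)
    have h2 : (Matrix.of fun i j => B.dt i (B.dx j f)).trace = 0 := by
      rw [← B.box f]
      exact sum_congr rfl fun i _ => (B.dx_dt _ _ _).symm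
    rw [h2, mul_zero] at h1
    have h3 : ∀ x : A, 2 * x = 0 → x = 0 := fun x hx => by
      rw [← one_mul x, ← two_mul_half, mul_comm (2 : A), mul_assoc, hx, mul_zero]
    refine Eq.trans ?_ (h3 _ h1)
    refine sum_congr rfl fun k _ => ?_
    simp only [oddDx_apply, oddDt_apply, map_sum, map_add, Derivation.map_smul, Matrix.add_apply,
      Matrix.mul_apply, Matrix.diag, Matrix.of_apply, Matrix.transpose_apply, Matrix.map_apply,
      ODDBlocks.map, smul_sum, ← sum_add_distrib, sum_mul]
    simp only [Algebra.smul_def]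
    exact sum_congr rfl fun i _ => sum_congr rfl fun j _ => by ring
  E i j := W.E' i j
  d := B.d
  gI i j := W.gI i j
  gI_symm i j := by
    have h1 : W.gIᵀ = W.gI := by
      have h2 : (Matrix.of B.gI)ᵀ = Matrix.of B.gI := by
        ext i j
        exact B.gI_symm j i
      rw [ODDMatrix.gI, transpose_mul, transpose_mul, transpose_transpose, h2, Matrix.mul_assoc]
    exact congrFun (congrFun h1 j) i
  gI_g i j := by
    have h1 := congrFun (congrFun W.gI_mul i) j
    rw [Matrix.mul_apply] at h1
    refine h1.trans ?_
    rw [show (2 : Matrix (Fin D) (Fin D) A) = Matrix.diagonal 2 from rfl, Matrix.diagonal_apply]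
    rfl

/-- Expressing ∂ and ∂̃ by the transformed derivations, the coefficient of ∂′ is M by definition and
that of ∂̃′ is −Mℰ′ by `matM_mul`. -/
lemma ODDMatrix.cD_unb_vec (f : A) : (fun i => B.cD unb i f) =
    (h.alg A).matM (Matrix.of B.E) *ᵥ fun r => W.background.cD unb r f := by
  have h1 : (fun i => B.cD unb i f) =
      (fun i => B.dx i f) - Matrix.of B.E *ᵥ fun k => B.dt k f := by
    funext i
    exact B.cD_unb i f
  have h2 : (fun i => W.background.cD unb i f) =
      (fun i => B.oddDx h i f) - W.E' *ᵥ fun k => B.oddDt h k f := by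
    funext i
    exact W.background.cD_unb i f
  rw [h1, h2, B.dx_vec h, B.dt_vec h, mulVec_sub, mulVec_mulVec,
    (h.alg A).matM_mul W.hN W.hE, ODDBlocks.matM]
  simp only [mulVec_add, sub_mulVec, mulVec_mulVec]
  abel

lemma ODDMatrix.cD_bar_vec (f : A) : (fun i => B.cD bar i f) =
    (h.alg A).matMBar (Matrix.of B.E) *ᵥ fun r => W.background.cD bar r f := by
  have h1 : (fun i => B.cD bar i f) =
      (fun i => B.dx i f) + (Matrix.of B.E)ᵀ *ᵥ fun k => B.dt k f := by
    funext i
    exact B.cD_bar i f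
  have h2 : (fun i => W.background.cD bar i f) =
      (fun i => B.oddDx h i f) + W.E'ᵀ *ᵥ fun k => B.oddDt h k f := by
    funext i
    exact W.background.cD_bar i f
  rw [h1, h2, B.dx_vec h, B.dt_vec h]
  simp only [mulVec_add, mulVec_mulVec]
  rw [(h.alg A).matMBar_mul W.hE, ODDBlocks.matMBar]
  simp only [add_mulVec]
  abel

/-- Substituting 𝒟̄′ = ∂′ + ℰ′ᵗ∂̃′ in ∂̃ = aᵗ∂̃′ + cᵗ∂′ leaves (aᵗ − cᵗℰ′ᵗ)∂̃′, and aᵗ − cᵗℰ′ᵗ is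
the inverse of Mᵗ. -/
lemma ODDMatrix.dt_unb_vec (f : A) : ((h.alg A).matM (Matrix.of B.E))ᵀ *ᵥ (fun l => B.dt l f) =
    (fun s => B.oddDt h s f) + ((h.alg A).matM (Matrix.of B.E))ᵀ *ᵥ
      ((h.alg A).cᵀ *ᵥ fun r => W.background.cD bar r f) := by
  have h2 : (fun i => W.background.cD bar i f) =
      (fun i => B.oddDx h i f) + W.E'ᵀ *ᵥ fun k => B.oddDt h k f := by
    funext i
    exact W.background.cD_bar i f
  have h3 : ((h.alg A).matM (Matrix.of B.E))ᵀ * ((h.alg A).aᵀ - (h.alg A).cᵀ * W.E'ᵀ) = 1 := by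
    have h4 := congrArg transpose (mul_eq_one_comm.mp ((h.alg A).matM_mul_inv W.hN W.hE))
    rwa [transpose_mul, transpose_sub, transpose_mul, transpose_one] at h4
  have h5 : (fun s => B.oddDt h s f) = ((h.alg A).matM (Matrix.of B.E))ᵀ *ᵥ
      (((h.alg A).aᵀ - (h.alg A).cᵀ * W.E'ᵀ) *ᵥ (fun s => B.oddDt h s f)) := by
    rw [mulVec_mulVec, h3, one_mulVec]
  rw [h5, ← mulVec_add, h2, B.dt_vec h]
  congr 1
  simp only [mulVec_add, sub_mulVec, mulVec_mulVec]
  abel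

lemma ODDMatrix.dt_bar_vec (f : A) :
    ((h.alg A).matMBar (Matrix.of B.E))ᵀ *ᵥ (fun l => B.dt l f) =
    (fun s => B.oddDt h s f) + ((h.alg A).matMBar (Matrix.of B.E))ᵀ *ᵥ
      ((h.alg A).cᵀ *ᵥ fun r => W.background.cD unb r f) := by
  have h2 : (fun i => W.background.cD unb i f) =
      (fun i => B.oddDx h i f) - W.E' *ᵥ fun k => B.oddDt h k f := by
    funext i
    exact W.background.cD_unb i f
  have h3 : ((h.alg A).matMBar (Matrix.of B.E))ᵀ * ((h.alg A).aᵀ + (h.alg A).cᵀ * W.E') = 1 := by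
    have h4 := congrArg transpose (mul_eq_one_comm.mp ((h.alg A).matMBar_mul_inv W.hE))
    rwa [transpose_mul, transpose_add, transpose_mul, transpose_one, transpose_transpose] at h4
  have h5 : (fun s => B.oddDt h s f) = ((h.alg A).matMBar (Matrix.of B.E))ᵀ *ᵥ
      (((h.alg A).aᵀ + (h.alg A).cᵀ * W.E') *ᵥ (fun s => B.oddDt h s f)) := by
    rw [mulVec_mulVec, h3, one_mulVec]
  rw [h5, ← mulVec_add, h2, B.dt_vec h]
  congr 1
  simp only [mulVec_sub, add_mulVec, mulVec_mulVec]
  abel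

lemma map_derivation_mul (δ : Derivation ℝ A A) (X Y : Matrix (Fin D) (Fin D) A) :
    (X * Y).map δ = X * Y.map δ + X.map δ * Y := by
  ext i j
  simp [Matrix.mul_apply, sum_add_distrib, mul_comm]

lemma map_derivation_alg (δ : Derivation ℝ A A) (x : Matrix (Fin D) (Fin D) ℝ) :
    (x.map (algebraMap ℝ A)).map δ = 0 := by
  ext i j
  simp

lemma ODDMatrix.derivation_matM (_ : B.ODDMatrix h) (δ : Derivation ℝ A A) :
    ((h.alg A).matM (Matrix.of B.E)).map δ = -((Matrix.of B.E).map δ * (h.alg A).cᵀ) := by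
  have h1 : ((h.alg A).eᵀ).map δ = 0 := map_derivation_alg δ h.eᵀ
  have h2 : ((h.alg A).cᵀ).map δ = 0 := map_derivation_alg δ h.cᵀ
  rw [ODDBlocks.matM, Matrix.map_sub _ (map_sub δ), map_derivation_mul, h1, h2]
  simp

lemma ODDMatrix.derivation_matMBar (_ : B.ODDMatrix h) (δ : Derivation ℝ A A) :
    ((h.alg A).matMBar (Matrix.of B.E)).map δ = (Matrix.of B.E)ᵀ.map δ * (h.alg A).cᵀ := by
  have h1 : ((h.alg A).eᵀ).map δ = 0 := map_derivation_alg δ h.eᵀ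
  have h2 : ((h.alg A).cᵀ).map δ = 0 := map_derivation_alg δ h.cᵀ
  rw [ODDBlocks.matMBar, Matrix.map_add _ (map_add δ), map_derivation_mul, h1, h2]
  simp

/-- Differentiate Mℰ′ = ℰaᵗ − bᵗ; the terms with δℰ collect to δℰ(aᵗ + cᵗℰ′), whose right factor is
the inverse of M̄ᵗ. -/
lemma ODDMatrix.map_derivation_E (δ : Derivation ℝ A A) : (Matrix.of B.E).map δ =
    (h.alg A).matM (Matrix.of B.E) * W.E'.map δ * ((h.alg A).matMBar (Matrix.of B.E))ᵀ := by
  have h1 := congrArg (fun m => m.map δ) ((h.alg A).matM_mul W.hN W.hE)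
  have h2 : ((h.alg A).aᵀ).map δ = 0 := map_derivation_alg δ h.aᵀ
  have h3 : ((h.alg A).bᵀ).map δ = 0 := map_derivation_alg δ h.bᵀ
  simp only [Matrix.map_sub _ (map_sub δ), map_derivation_mul, h2, h3, W.derivation_matM,
    Matrix.mul_zero, zero_add, sub_zero] at h1
  have h4 : ((h.alg A).aᵀ + (h.alg A).cᵀ * W.E') * ((h.alg A).matMBar (Matrix.of B.E))ᵀ = 1 := by
    have h5 := congrArg transpose ((h.alg A).matMBar_mul_inv W.hE)
    rwa [transpose_mul, transpose_add, transpose_mul, transpose_one, transpose_transpose] at h5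
  have h6 : (h.alg A).matM (Matrix.of B.E) * W.E'.map δ =
      (Matrix.of B.E).map δ * ((h.alg A).aᵀ + (h.alg A).cᵀ * W.E') := by
    linear_combination (norm := noncomm_ring) h1
  rw [h6, Matrix.mul_assoc, h4, Matrix.mul_one]

/-- The background and its transform form a pair. -/
def ODDMatrix.pair : ODDPair B W.background where
  M κ i j := match κ with
    | unb => (h.alg A).matM (Matrix.of B.E) i j
    | bar => (h.alg A).matMBar (Matrix.of B.E) i j
  c i j := (h.alg A).c i j
  cD_eq κ i f := by
    cases κ
    · exact congrFun (W.cD_unb_vec f) i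
    · exact congrFun (W.cD_bar_vec f) i
  gI_eq κ n m := by
    have key : ∀ X : Matrix (Fin D) (Fin D) A, ∑ k, ∑ l, B.gI k l * (X k n * X l m) =
        (Xᵀ * Matrix.of B.gI * X) n m := fun X => by
      simp only [Matrix.mul_apply, Matrix.transpose_apply, Matrix.of_apply, sum_mul]
      rw [sum_comm]
      exact sum_congr rfl fun l _ => sum_congr rfl fun k _ => by ring
    cases κ
    · exact key ((h.alg A).matM (Matrix.of B.E))
    · exact (key ((h.alg A).matMBar (Matrix.of B.E))).trans (congrFun (congrFun W.gI_eq_bar n) m)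
  derivation_E δ j l := by
    have h1 := congrFun (congrFun (W.map_derivation_E δ) j) l
    simp only [Matrix.mul_apply, Matrix.transpose_apply, Matrix.map_apply, Matrix.of_apply,
      sum_mul] at h1
    rw [h1, sum_comm]
    exact sum_congr rfl fun r _ => sum_congr rfl fun s _ => mul_right_comm _ _ _
  M_bar i k := by
    simp only [ODDBlocks.matM, ODDBlocks.matMBar, Matrix.sub_apply, Matrix.add_apply,
      Matrix.mul_apply, Matrix.transpose_apply, Matrix.of_apply, add_mul, sum_add_distrib]
    ring
  c_M k l := by
    have h1 := congrFun (congrFun ((h.alg A).c_mul_matM (E := Matrix.of B.E)) k) l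
    simpa only [Matrix.mul_apply, Matrix.neg_apply, Matrix.transpose_apply] using h1
  derivation_unb δ i k := by
    have h1 := congrFun (congrFun (W.derivation_matM δ) i) k
    simp only [Matrix.mul_apply, Matrix.neg_apply, Matrix.transpose_apply, Matrix.map_apply] at h1
    refine h1.trans (congrArg Neg.neg (sum_congr rfl fun j _ => mul_comm _ _))
  derivation_bar δ i k := by
    have h1 := congrFun (congrFun (W.derivation_matMBar δ) i) k
    simp only [Matrix.mul_apply, Matrix.transpose_apply, Matrix.map_apply] at h1
    refine h1.trans (sum_congr rfl fun j _ => mul_comm _ _)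
  dt_eq κ s f := by
    cases κ
    · exact congrFun (W.dt_unb_vec f) s
    · exact congrFun (W.dt_bar_vec f) s
  d_eq := rfl

lemma ODDMatrix.eta_eq (xi xit : Fin D → A) (κ : Kind) (i : Fin D) : B.eta xi xit κ i =
    ∑ r, W.pair.M κ i r * W.background.eta
      ((h.alg A).c *ᵥ xit + (h.alg A).e *ᵥ xi) ((h.alg A).a *ᵥ xit + (h.alg A).b *ᵥ xi) κ r := by
  cases κ
  · exact (congrFun ((h.alg A).matM_mul_eta W.hN W.hE xi xit) i).symm
  · exact (congrFun ((h.alg A).matMBar_mul_eta W.hE xi xit) i).symm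

/-- The terms of the first line form an `O(D,D)` tensor. -/
lemma ODDMatrix.firstLine_eq (xi xit : Fin D → A) (p q : Fin D) :
    B.firstLine xi xit B.ricci p q = ∑ r, ∑ s,
      (h.alg A).matM (Matrix.of B.E) p r * (h.alg A).matMBar (Matrix.of B.E) q s *
        W.background.firstLine ((h.alg A).c *ᵥ xit + (h.alg A).e *ᵥ xi)
          ((h.alg A).a *ᵥ xit + (h.alg A).b *ᵥ xi) W.background.ricci r s :=
  W.pair.firstLine_eq (W.eta_eq xi xit) W.pair.ricci_eq p q

end Background

end DFT

end

/-! ### Differential algebras of generated functions. -/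

noncomputable section

namespace DFT

open Finset Topology

/-- The functions on `V` generated by the restrictions of the functions in `gens` under the ring
operations and inversion. -/
inductive Gen {F : Type*} (V : Set F) (gens : Set (F → ℝ)) : (V → ℝ) → Prop
  | gen (g : F → ℝ) : g ∈ gens → Gen V gens (fun x => g x)
  | const (r : ℝ) : Gen V gens (fun _ => r)
  | add (f g : V → ℝ) : Gen V gens f → Gen V gens g → Gen V gens (f + g)
  | mul (f g : V → ℝ) : Gen V gens f → Gen V gens g → Gen V gens (f * g)
  | inv (f g : V → ℝ) : Gen V gens f → f * g = 1 → Gen V gens g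

/-- The extension by zero of a function on `V`. -/
def extendZero {F : Type*} {V : Set F} (f : V → ℝ) : F → ℝ := Function.extend Subtype.val f 0

lemma extendZero_apply {F : Type*} {V : Set F} (f : V → ℝ) (x : V) : extendZero f x = f x :=
  Subtype.val_injective.extend_apply f 0 x

/-- Since V is open, the value zero chosen off V never enters a derivative at a point of V. -/
lemma extendZero_eventuallyEq {F : Type*} [TopologicalSpace F] {V : Set F} (hV : IsOpen V)
    {f : V → ℝ} {g : F → ℝ} (h : ∀ x : V, f x = g x) (x : V) : extendZero f =ᶠ[𝓝 (x : F)] g := by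
  filter_upwards [hV.mem_nhds x.2] with y hy
  exact (extendZero_apply f ⟨y, hy⟩).trans (h ⟨y, hy⟩)

/-- A set of smooth functions on an open set whose derivatives are generated by the set. -/
structure GenSystem (F : Type*) [NormedAddCommGroup F] [NormedSpace ℝ F] where
  V : Set F
  isOpen : IsOpen V
  gens : Set (F → ℝ)
  smooth : ∀ g ∈ gens, ContDiffOn ℝ ∞ g V
  deriv : ∀ g ∈ gens, ∀ v, Gen V gens (fun x => fderiv ℝ g x v)

namespace GenSystem

variable {F : Type*} [NormedAddCommGroup F] [NormedSpace ℝ F] (G : GenSystem F)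

lemma contDiffAt {f : G.V → ℝ} (hf : Gen G.V G.gens f) (x : G.V) :
    ContDiffAt ℝ ∞ (extendZero f) (x : F) := by
  induction hf with
  | gen g hg =>
    exact ((G.smooth g hg).contDiffAt (G.isOpen.mem_nhds x.2)).congr_of_eventuallyEq
      (extendZero_eventuallyEq G.isOpen (fun _ => rfl) x)
  | const r =>
    exact contDiffAt_const.congr_of_eventuallyEq
      (extendZero_eventuallyEq G.isOpen (g := fun _ => r) (fun _ => rfl) x)
  | add f g _ _ hf hg =>
    exact (hf.add hg).congr_of_eventuallyEq (extendZero_eventuallyEq G.isOpen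
      (fun y => by simp [extendZero_apply]) x)
  | mul f g _ _ hf hg =>
    exact (hf.mul hg).congr_of_eventuallyEq (extendZero_eventuallyEq G.isOpen
      (fun y => by simp [extendZero_apply]) x)
  | inv f g _ hfg hf =>
    have h : ∀ y, f y * g y = 1 := fun y => congrFun hfg y
    refine (hf.inv ?_).congr_of_eventuallyEq (extendZero_eventuallyEq G.isOpen
      (fun y => ?_) x)
    · rw [extendZero_apply]
      exact left_ne_zero_of_mul_eq_one (h x)
    · rw [Pi.inv_apply, extendZero_apply]
      exact eq_inv_of_mul_eq_one_right (h y)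

lemma differentiableAt {f : G.V → ℝ} (hf : Gen G.V G.gens f) (x : G.V) :
    DifferentiableAt ℝ (extendZero f) (x : F) := (G.contDiffAt hf x).differentiableAt (by simp)

/-- The derivative of a function on `V` in the direction `v`. -/
def dirFun (v : F) (f : G.V → ℝ) : G.V → ℝ := fun x => fderiv ℝ (extendZero f) x v

lemma dirFun_eq {f : G.V → ℝ} {g : F → ℝ} (h : ∀ x : G.V, f x = g x) (v : F) (x : G.V) :
    G.dirFun v f x = fderiv ℝ g x v := by
  rw [dirFun, (extendZero_eventuallyEq G.isOpen h x).fderiv_eq]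

lemma dirFun_const (v : F) (r : ℝ) : G.dirFun v (fun _ => r) = 0 := by
  funext x
  rw [G.dirFun_eq (g := fun _ => r) fun _ => rfl]
  simp

lemma dirFun_add (v : F) {f g : G.V → ℝ} (hf : Gen G.V G.gens f) (hg : Gen G.V G.gens g) :
    G.dirFun v (f + g) = G.dirFun v f + G.dirFun v g := by
  funext x
  rw [G.dirFun_eq (g := extendZero f + extendZero g) fun y => by simp [extendZero_apply],
    fderiv_add (G.differentiableAt hf x) (G.differentiableAt hg x)]
  rfl

lemma dirFun_mul (v : F) {f g : G.V → ℝ} (hf : Gen G.V G.gens f) (hg : Gen G.V G.gens g) :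
    G.dirFun v (f * g) = f * G.dirFun v g + g * G.dirFun v f := by
  funext x
  rw [G.dirFun_eq (g := extendZero f * extendZero g) fun y => by simp [extendZero_apply],
    fderiv_mul (G.differentiableAt hf x) (G.differentiableAt hg x)]
  simp [dirFun, extendZero_apply]

lemma gen_dirFun (v : F) {f : G.V → ℝ} (hf : Gen G.V G.gens f) :
    Gen G.V G.gens (G.dirFun v f) := by
  induction hf with
  | gen g hg =>
    have h : G.dirFun v (fun x => g x) = fun x : G.V => fderiv ℝ g x v :=
      funext fun x => G.dirFun_eq (fun _ => rfl) v x
    rw [h]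
    exact G.deriv g hg v
  | const r =>
    rw [dirFun_const]
    exact Gen.const 0
  | add f g hf hg hf' hg' =>
    rw [G.dirFun_add v hf hg]
    exact hf'.add _ _ hg'
  | mul f g hf hg hf' hg' =>
    rw [G.dirFun_mul v hf hg]
    exact (hf.mul _ _ hg').add _ _ (hg.mul _ _ hf')
  | inv f g hf hfg hf' =>
    have hg := hf.inv _ _ hfg
    have h1 := G.dirFun_mul v hf hg
    rw [hfg] at h1
    have h2 : G.dirFun v 1 = 0 := G.dirFun_const v 1
    have h3 : G.dirFun v g = (fun _ => -1) * (g * (g * G.dirFun v f)) := by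
      have h4 : (fun _ => -1 : G.V → ℝ) = -1 := rfl
      rw [h4]
      linear_combination (-g) * h1 + g * h2 - G.dirFun v g * hfg
    rw [h3]
    exact (Gen.const _).mul _ _ (hg.mul _ _ (hg.mul _ _ hf'))

/-- The algebra of generated functions. -/
def alg : Subalgebra ℝ (G.V → ℝ) where
  carrier := {f | Gen G.V G.gens f}
  mul_mem' hf hg := hf.mul _ _ hg
  add_mem' hf hg := hf.add _ _ hg
  algebraMap_mem' r := Gen.const r

/-- The derivation in the direction `v`. -/
def dir (v : F) : Derivation ℝ G.alg G.alg :=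
  Derivation.mk'
    { toFun := fun f => ⟨G.dirFun v f, G.gen_dirFun v f.2⟩
      map_add' := fun f g => Subtype.ext (G.dirFun_add v f.2 g.2)
      map_smul' := fun r f => Subtype.ext (by
        have h := G.dirFun_mul v (Gen.const r) f.2
        rw [dirFun_const, mul_zero, add_zero] at h
        exact h) }
    fun f g => Subtype.ext (G.dirFun_mul v f.2 g.2)

lemma dir_apply (v : F) (f : G.alg) (x : G.V) :
    (G.dir v f : G.V → ℝ) x = fderiv ℝ (extendZero (f : G.V → ℝ)) x v := rfl

lemma dir_eq {f : G.alg} {g : F → ℝ} (h : ∀ x : G.V, (f : G.V → ℝ) x = g x) (v : F) (x : G.V) :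
    (G.dir v f : G.V → ℝ) x = fderiv ℝ g x v := G.dirFun_eq h v x

lemma dir_comm (v w : F) (f : G.alg) : G.dir v (G.dir w f) = G.dir w (G.dir v f) := by
  refine Subtype.ext (funext fun x => ?_)
  have hd : DifferentiableAt ℝ (fderiv ℝ (extendZero (f : G.V → ℝ))) (x : F) :=
    ((G.contDiffAt f.2 x).fderiv_right (m := 1) (by norm_cast)).differentiableAt (by simp)
  rw [G.dir_eq (f := G.dir w f) (g := fun z => fderiv ℝ (extendZero (f : G.V → ℝ)) z w)
      fun _ => rfl, G.dir_eq (f := G.dir v f)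
      (g := fun z => fderiv ℝ (extendZero (f : G.V → ℝ)) z v) fun _ => rfl, fderiv_clm_apply hd (differentiableAt_const _),
    fderiv_clm_apply hd (differentiableAt_const _)]
  have hs : IsSymmSndFDerivAt ℝ (extendZero (f : G.V → ℝ)) (x : F) :=
    (G.contDiffAt f.2 x).isSymmSndFDerivAt (by
      rw [minSmoothness_of_isRCLikeNormedField]
      exact ENat.LEInfty.out)
  simpa using hs.eq v w

lemma dir_add (v w : F) (f : G.alg) : G.dir (v + w) f = G.dir v f + G.dir w f :=
  Subtype.ext (funext fun _ => map_add _ _ _)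

lemma dir_smul (r : ℝ) (v : F) (f : G.alg) : G.dir (r • v) f = r • G.dir v f :=
  Subtype.ext (funext fun _ => map_smul _ _ _)

lemma dir_sum {ι : Type*} (s : Finset ι) (v : ι → F) (f : G.alg) :
    G.dir (∑ i ∈ s, v i) f = ∑ i ∈ s, G.dir (v i) f := by
  refine Subtype.ext (funext fun x => ?_)
  simp [dir_apply, map_sum]

/-- A generator as an element of the algebra. -/
def ofGen (g : F → ℝ) (hg : g ∈ G.gens) : G.alg := ⟨fun x => g x, Gen.gen g hg⟩

/-- Induction over the elements of the algebra. -/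
lemma alg_induction {p : G.alg → Prop} (gen : ∀ g hg, p (G.ofGen g hg))
    (const : ∀ r, p (algebraMap ℝ G.alg r)) (add : ∀ f g, p f → p g → p (f + g))
    (mul : ∀ f g, p f → p g → p (f * g)) (inv : ∀ f g, f * g = 1 → p f → p g) (f : G.alg) :
    p f := by
  obtain ⟨f, hf⟩ := f
  induction hf with
  | gen g hg => exact gen g hg
  | const r => exact const r
  | add f g hf hg hf' hg' => exact add ⟨f, hf⟩ ⟨g, hg⟩ hf' hg'
  | mul f g hf hg hf' hg' => exact mul ⟨f, hf⟩ ⟨g, hg⟩ hf' hg'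
  | inv f g hf hfg hf' => exact inv ⟨f, hf⟩ ⟨g, hf.inv _ _ hfg⟩ (Subtype.ext hfg) hf'

/-- A strong constraint on products of generators holds for all functions of the algebra. -/
lemma sc_of_gens {D : ℕ} (u w : Fin D → F)
    (h : ∀ g₁ h₁ g₂ h₂, ∑ i, (G.dir (u i) (G.ofGen g₁ h₁) * G.dir (w i) (G.ofGen g₂ h₂)
      + G.dir (w i) (G.ofGen g₁ h₁) * G.dir (u i) (G.ofGen g₂ h₂)) = 0) (f g : G.alg) :
    ∑ i, (G.dir (u i) f * G.dir (w i) g + G.dir (w i) f * G.dir (u i) g) = 0 := by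
  -- For fixed g the sum is a derivation in f, so it vanishes on everything generated, inverses
  -- included, once it vanishes on generators. By symmetry the argument is applied once in each
  -- variable.
  have key : ∀ g : G.alg, (∀ g₁ h₁, ∑ i, (G.dir (u i) (G.ofGen g₁ h₁) * G.dir (w i) g
      + G.dir (w i) (G.ofGen g₁ h₁) * G.dir (u i) g) = 0) → ∀ f : G.alg,
      ∑ i, (G.dir (u i) f * G.dir (w i) g + G.dir (w i) f * G.dir (u i) g) = 0 := by
    intro g hg f
    have hmul : ∀ f₁ f₂ : G.alg, ∑ i, (G.dir (u i) (f₁ * f₂) * G.dir (w i) g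
        + G.dir (w i) (f₁ * f₂) * G.dir (u i) g) =
        f₁ * ∑ i, (G.dir (u i) f₂ * G.dir (w i) g + G.dir (w i) f₂ * G.dir (u i) g)
        + f₂ * ∑ i, (G.dir (u i) f₁ * G.dir (w i) g + G.dir (w i) f₁ * G.dir (u i) g) := by
      intro f₁ f₂
      rw [mul_sum, mul_sum, ← sum_add_distrib]
      refine sum_congr rfl fun i _ => ?_
      rw [derivation_mul, derivation_mul]
      ring
    induction f using G.alg_induction with
    | gen g₁ h₁ => exact hg g₁ h₁
    | const r => simp
    | add f₁ f₂ e₁ e₂ =>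
      refine Eq.trans ?_ ((congrArg₂ (· + ·) e₁ e₂).trans (add_zero 0))
      rw [← sum_add_distrib]
      refine sum_congr rfl fun i _ => ?_
      rw [map_add, map_add]
      ring
    | mul f₁ f₂ e₁ e₂ => rw [hmul, e₁, e₂, mul_zero, mul_zero, add_zero]
    | inv f₁ f₂ e e₁ =>
      have h1 := hmul f₁ f₂
      rw [e, e₁] at h1
      simp only [Derivation.map_one_eq_zero, zero_mul, add_zero, sum_const_zero, mul_zero] at h1
      linear_combination (-f₂) * h1 - (∑ i, (G.dir (u i) f₂ * G.dir (w i) g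
        + G.dir (w i) f₂ * G.dir (u i) g)) * e
  refine key g (fun g₁ h₁ => ?_) f
  have h2 := key (G.ofGen g₁ h₁) (fun g₂ h₂ => h g₂ h₂ g₁ h₁) g
  rw [← h2]
  exact sum_congr rfl fun i _ => by ring

/-- The cross terms of this second-order operator on a product vanish by the strong constraint, so
it behaves like a derivation and is determined by the generators. -/
lemma box_of_gens {D : ℕ} (u w : Fin D → F)
    (sc : ∀ f g, ∑ i, (G.dir (u i) f * G.dir (w i) g + G.dir (w i) f * G.dir (u i) g) = 0)
    (h : ∀ g hg, ∑ i, G.dir (u i) (G.dir (w i) (G.ofGen g hg)) = 0) (f : G.alg) :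
    ∑ i, G.dir (u i) (G.dir (w i) f) = 0 := by
  have hmul : ∀ f₁ f₂ : G.alg, ∑ i, G.dir (u i) (G.dir (w i) (f₁ * f₂)) =
      f₁ * ∑ i, G.dir (u i) (G.dir (w i) f₂) + f₂ * ∑ i, G.dir (u i) (G.dir (w i) f₁) := by
    intro f₁ f₂
    rw [← add_zero (f₁ * _ + _), ← sc f₁ f₂, mul_sum, mul_sum, ← sum_add_distrib, ← sum_add_distrib]
    refine sum_congr rfl fun i _ => ?_
    rw [derivation_mul, map_add, derivation_mul, derivation_mul]
    ring
  induction f using G.alg_induction with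
  | gen g hg => exact h g hg
  | const r => simp
  | add f₁ f₂ e₁ e₂ => simp only [map_add, sum_add_distrib, e₁, e₂, add_zero]
  | mul f₁ f₂ e₁ e₂ => rw [hmul, e₁, e₂, mul_zero, mul_zero, add_zero]
  | inv f₁ f₂ e e₁ =>
    have h1 := hmul f₁ f₂
    rw [e, e₁] at h1
    simp only [Derivation.map_one_eq_zero, map_zero, sum_const_zero, mul_zero, add_zero] at h1
    linear_combination (-f₂) * h1 - (∑ i, G.dir (u i) (G.dir (w i) f₂)) * e

end GenSystem

end DFT

end

/-! ### Pulling identities back along affine maps. -/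

noncomputable section

namespace DFT

open Kind Finset Topology

namespace GenSystem

variable {F : Type*} [NormedAddCommGroup F] [NormedSpace ℝ F] (G : GenSystem F)

/-- Evaluation at a point. -/
def ev (x : G.V) : G.alg →ₐ[ℝ] ℝ := (Pi.evalAlgHom ℝ (fun _ : G.V => ℝ) x).comp G.alg.val

lemma ev_apply (x : G.V) (f : G.alg) : G.ev x f = (f : G.V → ℝ) x := rfl

lemma ev_half (x : G.V) : G.ev x (half G.alg) = 1 / 2 := (G.ev x).commutes _

end GenSystem

variable {D : ℕ} {F : Type*} [NormedAddCommGroup F] [NormedSpace ℝ F]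

/-- An affine map from the doubled space to `F` under which the fields `Φ` correspond to a
background. -/
structure Slice (G : GenSystem F) (B : Background D G.alg) (Φ : Fields D) where
  x₀ : F
  L : Doubled D →L[ℝ] F
  dx : ∀ i f, B.dx i f = G.dir (L (Pi.single (.inr i) 1)) f
  dt : ∀ i f, B.dt i f = G.dir (L (Pi.single (.inl i) 1)) f
  E : ∀ i j X (hX : x₀ + L X ∈ G.V), Φ.E i j X = G.ev ⟨_, hX⟩ (B.E i j)
  d : ∀ X (hX : x₀ + L X ∈ G.V), Φ.d X = G.ev ⟨_, hX⟩ B.d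

namespace Slice

variable {G : GenSystem F} {B : Background D G.alg} {Φ : Fields D} (S : Slice G B Φ)

/-- The function `φ` is the pullback of `f`. -/
def Rel (φ : Sc D) (f : G.alg) : Prop := ∀ X (hX : S.x₀ + S.L X ∈ G.V), φ X = G.ev ⟨_, hX⟩ f

variable {S}

/-- Chain rule: near a point of the preimage, φ is the extension of f composed with the affine map.
-/
lemma Rel.pd {φ : Sc D} {f : G.alg} (h : S.Rel φ f) (M : DIdx D) :
    S.Rel (pd M φ) (G.dir (S.L (Pi.single M 1)) f) := by
  intro X hX
  have hc : Continuous fun Y : Doubled D => S.x₀ + S.L Y := by fun_prop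
  have h1 : φ =ᶠ[𝓝 X] extendZero (f : G.V → ℝ) ∘ fun Y => S.x₀ + S.L Y := by
    filter_upwards [(G.isOpen.preimage hc).mem_nhds hX] with Y hY
    exact (h Y hY).trans (extendZero_apply (f : G.V → ℝ) ⟨_, hY⟩).symm
  have h2 : HasFDerivAt (fun Y => S.x₀ + S.L Y) S.L X := S.L.hasFDerivAt.const_add _
  have h3 := ((G.differentiableAt f.2 ⟨_, hX⟩).hasFDerivAt.comp X h2).fderiv
  rw [DFT.pd, h1.fderiv_eq, h3]
  rfl

lemma Rel.pdx {φ : Sc D} {f : G.alg} (h : S.Rel φ f) (i : Fin D) :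
    S.Rel (pdx i φ) (B.dx i f) := by
  rw [S.dx]
  exact h.pd _

lemma Rel.pdt {φ : Sc D} {f : G.alg} (h : S.Rel φ f) (i : Fin D) :
    S.Rel (pdt i φ) (B.dt i f) := by
  rw [S.dt]
  exact h.pd _

variable (S)

lemma rel_E (i j : Fin D) : S.Rel (Φ.E i j) (B.E i j) := S.E i j

lemma rel_d : S.Rel Φ.d B.d := S.d

/-- Evaluating `gI_g` at a point exhibits a left inverse of the metric there, and inverses are
unique. -/
lemma rel_gInv (i j : Fin D) : S.Rel (Φ.gInv i j) (B.gI i j) := by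
  intro X hX
  let m : Matrix (Fin D) (Fin D) ℝ := Matrix.of fun i j => G.ev ⟨_, hX⟩ (B.gI i j)
  have h : m * Φ.gMat X = 1 := by
    ext i j
    have h1 := congrArg (G.ev ⟨_, hX⟩) (B.gI_g i j)
    rw [map_sum] at h1
    rw [Matrix.mul_apply, Matrix.one_apply]
    have h2 : ∀ k, m i k * Φ.gMat X k j =
        (1 / 2) * G.ev ⟨_, hX⟩ (B.gI i k * (B.E k j + B.E j k)) := fun k => by
      simp only [m, Fields.gMat, Matrix.of_apply, S.E _ _ X hX, map_mul, map_add]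
      ring
    simp_rw [h2]
    rw [← mul_sum, h1]
    split_ifs
    · rw [map_ofNat]
      norm_num
    · rw [map_zero, mul_zero]
  rw [Fields.gInv, Matrix.inv_eq_left_inv h]
  rfl

variable {S}

lemma Rel.calD {φ : Sc D} {f : G.alg} (h : S.Rel φ f) (κ : Kind) (i : Fin D) :
    S.Rel (calD Φ κ i φ) (B.cD κ i f) := by
  intro X hX
  cases κ
  · simp only [DFT.calD, B.cD_unb, map_sub, map_sum, map_mul, h.pdx i X hX, S.E _ _ X hX,
      h.pdt _ X hX]
  · simp only [DFT.calD, B.cD_bar, map_add, map_sum, map_mul, h.pdx i X hX, S.E _ _ X hX,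
      h.pdt _ X hX]

lemma Rel.calDUp {φ : Sc D} {f : G.alg} (h : S.Rel φ f) (κ : Kind) (i : Fin D) :
    S.Rel (calDUp Φ κ i φ) (∑ m, B.gI i m * B.cD κ m f) := by
  intro X hX
  simp only [DFT.calDUp, map_sum, map_mul, S.rel_gInv _ _ X hX, h.calD _ _ X hX]

variable (S)

lemma rel_Gam (κ τ : Kind) (i j k : Fin D) : S.Rel (Gam Φ κ τ i j k) (B.Gam κ τ i j k) := by
  intro X hX
  cases κ <;> cases τ <;>
  simp only [DFT.Gam, Background.Gam, map_sum, map_mul, map_add, map_sub, G.ev_half,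
    S.rel_gInv _ _ X hX, (S.rel_E _ _).calD _ _ X hX]

variable {S}

lemma rel_cov1 {V : Fin D → Sc D} {V' : Fin D → G.alg} (h : ∀ j, S.Rel (V j) (V' j))
    (κ τ : Kind) (i j : Fin D) : S.Rel (cov1 Φ κ τ i V j) (B.cov1 κ τ i V' j) := by
  intro X hX
  simp only [DFT.cov1, Background.cov1, map_sub, map_sum, map_mul, (h _).calD _ _ X hX,
    S.rel_Gam _ _ _ _ _ X hX, h _ X hX]

lemma rel_cov2 {T : Fin D → Fin D → Sc D} {T' : Fin D → Fin D → G.alg}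
    (h : ∀ p q, S.Rel (T p q) (T' p q)) (κ τ₁ τ₂ : Kind) (i p q : Fin D) :
    S.Rel (cov2 Φ κ τ₁ τ₂ i T p q) (B.cov2 κ τ₁ τ₂ i T' p q) := by
  intro X hX
  simp only [DFT.cov2, Background.cov2, map_sub, map_sum, map_mul, (h _ _).calD _ _ X hX,
    S.rel_Gam _ _ _ _ _ X hX, h _ _ X hX]

lemma rel_cov3 {T : Fin D → Fin D → Fin D → Sc D} {T' : Fin D → Fin D → Fin D → G.alg}
    (h : ∀ s p q, S.Rel (T s p q) (T' s p q)) (κ τ₀ τ₁ τ₂ : Kind) (i s p q : Fin D) :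
    S.Rel (cov3 Φ κ τ₀ τ₁ τ₂ i T s p q) (B.cov3 κ τ₀ τ₁ τ₂ i T' s p q) := by
  intro X hX
  simp only [DFT.cov3, Background.cov3, map_sub, map_sum, map_mul, (h _ _ _).calD _ _ X hX,
    S.rel_Gam _ _ _ _ _ X hX, h _ _ _ X hX]

variable (S)

lemma rel_DE (κ : Kind) (s p q : Fin D) : S.Rel (DE Φ κ s p q) (B.DE κ s p q) :=
  (S.rel_E p q).calD κ s

lemma rel_DEUp (κ : Kind) (s p q : Fin D) : S.Rel (DEUp Φ κ s p q) (B.DEUp κ s p q) :=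
  (S.rel_E p q).calDUp κ s

/-- The Ricci-like tensor of `Φ` is the pullback of the Ricci-like tensor of the background. -/
lemma rel_Ricci (p q : Fin D) : S.Rel (Ricci Φ p q) (B.ricci p q) := by
  intro X hX
  have h4 : (1 / 4 : ℝ) = 1 / 2 * (1 / 2) := by norm_num
  simp only [DFT.Ricci, Background.ricci, h4, map_sub, map_add, map_sum, map_mul, G.ev_half,
    map_ofNat, S.rel_gInv _ _ X hX, S.rel_DE _ _ _ _ X hX, S.rel_DEUp _ _ _ _ X hX,
    rel_cov3 (S.rel_DE unb) _ _ _ _ _ _ _ _ X hX, rel_cov3 (S.rel_DE bar) _ _ _ _ _ _ _ _ X hX,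
    rel_cov1 (fun i => S.rel_d.calD unb i) _ _ _ _ X hX,
    rel_cov1 (fun i => S.rel_d.calD bar i) _ _ _ _ X hX]

variable {S} {Λ : GaugeParam D} {xi xit : Fin D → G.alg}

lemma rel_eta (hxi : ∀ i, S.Rel (Λ.xi i) (xi i)) (hxit : ∀ i, S.Rel (Λ.xit i) (xit i))
    (i : Fin D) : S.Rel (eta Φ Λ i) (B.eta xi xit unb i) := by
  intro X hX
  simp only [DFT.eta, Background.eta, map_neg, map_add, map_sum, map_mul, S.E _ _ X hX,
    hxi _ X hX, hxit _ X hX]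

lemma rel_etaBar (hxi : ∀ i, S.Rel (Λ.xi i) (xi i)) (hxit : ∀ i, S.Rel (Λ.xit i) (xit i))
    (i : Fin D) : S.Rel (etaBar Φ Λ i) (B.eta xi xit bar i) := by
  intro X hX
  simp only [DFT.etaBar, Background.eta, map_add, map_sum, map_mul, S.E _ _ X hX,
    hxi _ X hX, hxit _ X hX]

lemma rel_firstLine (hxi : ∀ i, S.Rel (Λ.xi i) (xi i)) (hxit : ∀ i, S.Rel (Λ.xit i) (xit i))
    (p q : Fin D) : S.Rel (firstLine Φ Λ p q) (B.firstLine xi xit B.ricci p q) := by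
  intro X hX
  have h1 := rel_eta hxi hxit
  have h2 := rel_etaBar hxi hxit
  simp only [DFT.firstLine, Background.firstLine, map_sub, map_add, map_sum, map_mul, G.ev_half,
    S.rel_gInv _ _ X hX, S.rel_Ricci _ _ X hX, rel_cov1 h1 _ _ _ _ X hX, rel_cov1 h2 _ _ _ _ X hX,
    rel_cov2 S.rel_Ricci _ _ _ _ _ _ X hX, h1 _ X hX, h2 _ X hX]

lemma rel_extraOne (hxi : ∀ i, S.Rel (Λ.xi i) (xi i)) (hxit : ∀ i, S.Rel (Λ.xit i) (xit i))
    (p q : Fin D) : S.Rel (extraOne Φ Λ p q) (B.extraOne xi xit B.ricci p q) := by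
  intro X hX
  have h1 := rel_eta hxi hxit
  have h2 := rel_etaBar hxi hxit
  simp only [DFT.extraOne, Background.extraOne, map_add, map_sum, map_mul, G.ev_half,
    S.rel_gInv _ _ X hX, S.rel_Ricci _ _ X hX, rel_cov1 h1 _ _ _ _ X hX, rel_cov1 h2 _ _ _ _ X hX]

lemma rel_extraTwo (hxi : ∀ i, S.Rel (Λ.xi i) (xi i)) (hxit : ∀ i, S.Rel (Λ.xit i) (xit i))
    (p q : Fin D) : S.Rel (extraTwo Φ Λ p q) (B.extraTwo xi xit B.ricci p q) := by
  intro X hX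
  have h1 := rel_eta hxi hxit
  have h2 := rel_etaBar hxi hxit
  simp only [DFT.extraTwo, Background.extraTwo, map_add, map_sum, map_mul, G.ev_half,
    S.rel_gInv _ _ X hX, S.rel_Ricci _ _ X hX, rel_cov1 h1 _ _ _ _ X hX, rel_cov1 h2 _ _ _ _ X hX]

lemma rel_transport (hxi : ∀ i, S.Rel (Λ.xi i) (xi i)) (hxit : ∀ i, S.Rel (Λ.xit i) (xit i))
    {φ : Sc D} {f : G.alg} (h : S.Rel φ f) : S.Rel (transport Λ φ) (B.transport xi xit f) := by
  intro X hX
  simp only [DFT.transport, Background.transport, map_add, map_sum, map_mul, h.pdx _ X hX,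
    h.pdt _ X hX, hxi _ X hX, hxit _ X hX]

lemma rel_deltaE (hxi : ∀ i, S.Rel (Λ.xi i) (xi i)) (hxit : ∀ i, S.Rel (Λ.xit i) (xit i))
    (i j : Fin D) : S.Rel (deltaE Φ Λ i j)
      (B.gaugeE xi xit i j + B.transport xi xit (B.E i j)) := by
  intro X hX
  simp only [DFT.deltaE, B.gaugeE_eq, map_add, map_sub, map_sum, map_mul, S.E _ _ X hX,
    (hxi _).calD _ _ X hX, (hxit _).calD _ _ X hX, rel_transport hxi hxit (S.rel_E i j) X hX]
  ring

lemma rel_deltaDil (hxi : ∀ i, S.Rel (Λ.xi i) (xi i)) (hxit : ∀ i, S.Rel (Λ.xit i) (xit i)) :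
    S.Rel (deltaDil Φ Λ) (-(half G.alg * ∑ i, (B.dx i (xi i) + B.dt i (xit i)))
      + B.transport xi xit B.d) := by
  intro X hX
  simp only [DFT.deltaDil, map_add, map_neg, map_sum, map_mul, G.ev_half,
    (hxi _).pdx _ X hX, (hxit _).pdt _ X hX, rel_transport hxi hxit S.rel_d X hX]
  ring

/-- The Lie derivative form of the gauge transformation. -/
lemma rel_lie (hxi : ∀ i, S.Rel (Λ.xi i) (xi i)) (hxit : ∀ i, S.Rel (Λ.xit i) (xit i))
    {T : Fin D → Fin D → Sc D} {T' : Fin D → Fin D → G.alg} (h : ∀ p q, S.Rel (T p q) (T' p q))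
    (p q : Fin D) : S.Rel (fun X => lieXi Λ T p q X + lieXit Λ T p q X
        + ∑ k, ∑ l, Φ.E p k X * Tkl Λ k l X * T l q X
        + ∑ k, ∑ l, Φ.E l q X * Tkl Λ k l X * T p k X)
      (B.transport xi xit (T' p q) + ∑ r, B.rot xi xit unb p r * T' r q
        + ∑ r, B.rot xi xit bar q r * T' p r) := by
  intro X hX
  have e1 : ∑ k, ∑ l, Φ.E p k X * Tkl Λ k l X * T l q X =
      ∑ l, (∑ k, Φ.E p k X * Tkl Λ k l X) * T l q X := by
    simp_rw [sum_mul]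
    exact sum_comm
  have e2 : ∑ k, ∑ l, Φ.E l q X * Tkl Λ k l X * T p k X =
      ∑ k, (∑ l, Φ.E l q X * Tkl Λ k l X) * T p k X := by
    simp_rw [sum_mul]
  beta_reduce
  rw [e1, e2]
  simp only [DFT.lieXi, DFT.lieXit, DFT.Tkl, B.rot_unb_eq_dx, B.rot_bar_eq_dx,
    Background.transport, map_add, map_sub, map_sum, map_mul, S.E _ _ X hX,
    (hxi _).pdx _ X hX, (hxi _).pdt _ X hX, (hxit _).pdt _ X hX, (h _ _).pdx _ X hX,
    (h _ _).pdt _ X hX, h _ _ X hX, hxi _ X hX, hxit _ X hX, add_mul, sub_mul, sum_add_distrib,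
    sum_sub_distrib]
  ring

end Slice

end DFT

end

/-! ### The background defined by given fields. -/

noncomputable section

namespace DFT

open Kind Finset Topology

lemma Gen.sum {F ι : Type*} {V : Set F} {gens : Set (F → ℝ)} (s : Finset ι) (f : ι → V → ℝ)
    (h : ∀ i ∈ s, Gen V gens (f i)) : Gen V gens (∑ i ∈ s, f i) := by
  classical
  induction s using Finset.induction_on with
  | empty => exact Gen.const 0
  | insert a s ha ih =>
    rw [sum_insert ha]
    exact (h a (mem_insert_self _ _)).add _ _ (ih fun i hi => h i (mem_insert_of_mem hi))

namespace GenSystem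

variable {D : ℕ} {F : Type*} [NormedAddCommGroup F] [NormedSpace ℝ F] (G : GenSystem F)

/-- This is why inversion is among the generating operations: determinants that vanish nowhere
become units, and g^{ij} and (cℰ + e)⁻¹ exist in the algebra. -/
lemma isUnit_of_ne_zero {f : G.alg} (h : ∀ x, (f : G.V → ℝ) x ≠ 0) : IsUnit f := by
  have h1 : (f : G.V → ℝ) * (fun x => ((f : G.V → ℝ) x)⁻¹) = 1 :=
    funext fun x => mul_inv_cancel₀ (h x)
  exact IsUnit.of_mul_eq_one ⟨_, Gen.inv _ _ f.2 h1⟩ (Subtype.ext h1)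

lemma map_metric {A A' : Type*} [CommRing A] [Algebra ℝ A] [CommRing A'] [Algebra ℝ A']
    (q : A →ₐ[ℝ] A') (E : Fin D → Fin D → A) :
    (Matrix.of fun i j => half A * (E i j + E j i)).map q =
      Matrix.of fun i j => half A' * (q (E i j) + q (E j i)) := by
  ext i j
  simp [map_half]

/-- The background with given fields and derivatives along the vectors `u i` and `w i`. -/
def background (u w : Fin D → F)
    (sc : ∀ f g, ∑ i, (G.dir (u i) f * G.dir (w i) g + G.dir (w i) f * G.dir (u i) g) = 0)
    (box : ∀ f, ∑ i, G.dir (u i) (G.dir (w i) f) = 0)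
    (E : Fin D → Fin D → G.alg) (d : G.alg)
    (hE : ∀ x, (Matrix.of fun i j => (1 / 2 : ℝ) * (G.ev x (E i j) + G.ev x (E j i))).det ≠ 0) :
    Background D G.alg where
  dx i := G.dir (u i)
  dt i := G.dir (w i)
  dx_dx _ _ f := G.dir_comm _ _ f
  dx_dt _ _ f := G.dir_comm _ _ f
  dt_dt _ _ f := G.dir_comm _ _ f
  sc := sc
  box := box
  E := E
  d := d
  gI i j := (Matrix.of fun i j => half G.alg * (E i j + E j i))⁻¹ i j
  gI_symm i j := by
    have h : (Matrix.of fun i j => half G.alg * (E i j + E j i)).transpose =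
        Matrix.of fun i j => half G.alg * (E i j + E j i) := by
      ext i j
      simp [add_comm]
    have h1 := congrArg Inv.inv h
    rw [← Matrix.transpose_nonsing_inv] at h1
    exact congrFun (congrFun h1 j) i
  gI_g i j := by
    have h : IsUnit (Matrix.of fun i j => half G.alg * (E i j + E j i)).det := by
      refine G.isUnit_of_ne_zero fun x => ?_
      rw [← G.ev_apply, AlgHom.map_det, AlgHom.mapMatrix_apply, map_metric]
      exact hE x
    have h1 := congrFun (congrFun (Matrix.nonsing_inv_mul _ h) i) j
    rw [Matrix.mul_apply, Matrix.one_apply] at h1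
    have h2 : ∀ k, (Matrix.of fun i j => half G.alg * (E i j + E j i))⁻¹ i k * (E k j + E j k) =
        2 * ((Matrix.of fun i j => half G.alg * (E i j + E j i))⁻¹ i k
          * (Matrix.of fun i j => half G.alg * (E i j + E j i)) k j) := fun k => by
      rw [Matrix.of_apply]
      linear_combination (-(Matrix.of fun i j => half G.alg * (E i j + E j i))⁻¹ i k
        * (E k j + E j k)) * two_mul_half G.alg
    simp_rw [h2]
    rw [← mul_sum, h1]
    split_ifs <;> simp

variable {F₁ F₂ : Type*} [NormedAddCommGroup F₁] [NormedSpace ℝ F₁] [NormedAddCommGroup F₂]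
  [NormedSpace ℝ F₂]

/-- A linear map which pulls back generated functions to generated functions. -/
structure Hom (G₁ : GenSystem F₁) (G₂ : GenSystem F₂) where
  L : F₁ →L[ℝ] F₂
  mapsTo : ∀ x ∈ G₁.V, L x ∈ G₂.V
  gens : ∀ g ∈ G₂.gens, Gen G₁.V G₁.gens (fun x => g (L x))

namespace Hom

variable {G₁ : GenSystem F₁} {G₂ : GenSystem F₂} (s : Hom G₁ G₂)

lemma gen_comp {f : G₂.V → ℝ} (hf : Gen G₂.V G₂.gens f) :
    Gen G₁.V G₁.gens (fun x => f ⟨s.L x, s.mapsTo x x.2⟩) := by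
  induction hf with
  | gen g hg => exact s.gens g hg
  | const r => exact Gen.const r
  | add f g _ _ hf hg => exact hf.add _ _ hg
  | mul f g _ _ hf hg => exact hf.mul _ _ hg
  | inv f g _ hfg hf => exact hf.inv _ _ (funext fun x => congrFun hfg ⟨s.L x, s.mapsTo x x.2⟩)

/-- The pullback of functions. -/
def pullback : G₂.alg →ₐ[ℝ] G₁.alg where
  toFun f := ⟨fun x => (f : G₂.V → ℝ) ⟨s.L x, s.mapsTo x x.2⟩, s.gen_comp f.2⟩
  map_one' := rfl
  map_mul' _ _ := rfl
  map_zero' := rfl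
  map_add' _ _ := rfl
  commutes' _ := rfl

lemma dir_pullback (v : F₁) (f : G₂.alg) :
    G₁.dir v (s.pullback f) = s.pullback (G₂.dir (s.L v) f) := by
  refine Subtype.ext (funext fun x => ?_)
  have h1 : ∀ y : G₁.V, (s.pullback f : G₁.V → ℝ) y =
      (extendZero (f : G₂.V → ℝ) ∘ s.L) y := fun y =>
    (extendZero_apply (f : G₂.V → ℝ) ⟨s.L y, s.mapsTo y y.2⟩).symm
  have h2 : HasFDerivAt (extendZero (f : G₂.V → ℝ) ∘ s.L)
      ((fderiv ℝ (extendZero (f : G₂.V → ℝ)) (s.L x)).comp s.L) (x : F₁) :=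
    (G₂.differentiableAt f.2 ⟨_, s.mapsTo x x.2⟩).hasFDerivAt.comp (x : F₁) s.L.hasFDerivAt
  rw [G₁.dir_eq h1, h2.fderiv]
  rfl

end Hom

end GenSystem

variable {D : ℕ} {U : Set (Doubled D)} {Φ : Fields D} {Λ : GaugeParam D}

lemma contDiffOn_pd (hU : IsOpen U) {A : Sc D} (hA : ContDiffOn ℝ ∞ A U) (M : DIdx D) :
    ContDiffOn ℝ ∞ (pd M A) U :=
  (hA.fderiv_of_isOpen hU (m := ∞) (by norm_cast)).clm_apply contDiffOn_const

lemma FieldProduct.contDiffOn (hU : IsOpen U) (hreg : Regular U Φ Λ) {A : Sc D}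
    (hA : FieldProduct Φ Λ A) : ContDiffOn ℝ ∞ A U := by
  induction hA with
  | E i j => exact hreg.smooth_E i j
  | d => exact hreg.smooth_d
  | xi i => exact hreg.smooth_xi i
  | xit i => exact hreg.smooth_xit i
  | deriv M A _ h => exact contDiffOn_pd hU h M
  | mul A B _ _ hA hB => exact hA.mul hB

lemma fderiv_eq_sum_pd (A : Sc D) (X v : Doubled D) : fderiv ℝ A X v = ∑ M, v M * pd M A X := by
  conv_lhs => rw [← univ_sum_single v]
  rw [map_sum]
  refine sum_congr rfl fun M _ => ?_
  have h : Pi.single M (v M) = v M • Pi.single M (1 : ℝ) := by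
    rw [← Pi.single_smul, smul_eq_mul, mul_one]
  rw [h, map_smul, smul_eq_mul]
  rfl

/-- The system of functions generated by the fields and gauge parameters. -/
def fieldSystem (hU : IsOpen U) (hreg : Regular U Φ Λ) : GenSystem (Doubled D) where
  V := U
  isOpen := hU
  gens := {A | FieldProduct Φ Λ A}
  smooth _ hA := hA.contDiffOn hU hreg
  deriv A hA v := by
    have h : (fun X : U => fderiv ℝ A X v) = ∑ M, (fun _ => v M) * fun X : U => pd M A X := by
      funext X
      rw [fderiv_eq_sum_pd]
      simp
    rw [h]
    exact Gen.sum _ _ fun M _ => (Gen.const _).mul _ _ (Gen.gen _ (hA.deriv M A))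

section FieldSystem

variable (hU : IsOpen U) (hreg : Regular U Φ Λ)

/-- An element of `FieldProduct` as an element of the algebra. -/
def fieldEl (A : Sc D) (hA : FieldProduct Φ Λ A) : (fieldSystem hU hreg).alg :=
  (fieldSystem hU hreg).ofGen A hA

lemma ev_fieldEl (A : Sc D) (hA : FieldProduct Φ Λ A) (X : Doubled D) (hX : X ∈ U) :
    (fieldSystem hU hreg).ev ⟨X, hX⟩ (fieldEl hU hreg A hA) = A X := rfl

lemma dir_fieldEl (A : Sc D) (hA : FieldProduct Φ Λ A) (M : DIdx D) :
    (fieldSystem hU hreg).dir (Pi.single M 1) (fieldEl hU hreg A hA) =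
      fieldEl hU hreg (pd M A) (hA.deriv M A) :=
  Subtype.ext (funext fun X => (fieldSystem hU hreg).dir_eq (g := A) (fun _ => rfl) _ X)

/-- The hypothesis contains both orders of differentiation, which agree on smooth functions, so it
is twice the sum wanted. -/
lemma fieldSystem_box_fieldEl (hsc : StrongConstraint U Φ Λ) (A : Sc D)
    (hA : FieldProduct Φ Λ A) :
    ∑ i, (fieldSystem hU hreg).dir (Pi.single (.inr i) 1)
      ((fieldSystem hU hreg).dir (Pi.single (.inl i) 1) (fieldEl hU hreg A hA)) = 0 := by
  have h1 : ∀ i, fieldEl hU hreg _ ((hA.deriv (.inr i) _).deriv (.inl i) _) =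
      fieldEl hU hreg _ ((hA.deriv (.inl i) _).deriv (.inr i) _) := fun i => by
    have h := (fieldSystem hU hreg).dir_comm (Pi.single (.inl i) 1) (Pi.single (.inr i) 1)
      (fieldEl hU hreg A hA)
    rwa [dir_fieldEl, dir_fieldEl, dir_fieldEl, dir_fieldEl] at h
  simp only [dir_fieldEl]
  refine Subtype.ext (funext fun X => ?_)
  have h2 := hsc A hA X X.2
  have h3 : ∀ i, pdt i (pdx i A) X = pdx i (pdt i A) X := fun i =>
    congrArg ((fieldSystem hU hreg).ev X) (h1 i)
  simp only [h3, ← two_mul, ← mul_sum] at h2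
  have h4 := (mul_eq_zero.mp h2).resolve_left two_ne_zero
  have h5 : (fieldSystem hU hreg).ev X
      (∑ i, fieldEl hU hreg _ ((hA.deriv (.inl i) _).deriv (.inr i) _)) = 0 := by
    rw [map_sum]
    exact h4
  exact h5

/-- Polarization: ∂_i∂̃^i annihilates A, C and AC, since products of generators are again
generators; hence the cross terms vanish. -/
lemma fieldSystem_sc (hsc : StrongConstraint U Φ Λ) (f g : (fieldSystem hU hreg).alg) :
    ∑ i, ((fieldSystem hU hreg).dir (Pi.single (.inr i) 1) f
        * (fieldSystem hU hreg).dir (Pi.single (.inl i) 1) g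
      + (fieldSystem hU hreg).dir (Pi.single (.inl i) 1) f
        * (fieldSystem hU hreg).dir (Pi.single (.inr i) 1) g) = 0 := by
  refine (fieldSystem hU hreg).sc_of_gens (fun i => Pi.single (.inr i) 1)
    (fun i => Pi.single (.inl i) 1) (fun A hA C hC => ?_) f g
  have h1 := fieldSystem_box_fieldEl hU hreg hsc A hA
  have h2 := fieldSystem_box_fieldEl hU hreg hsc C hC
  have h3 := fieldSystem_box_fieldEl hU hreg hsc _ (FieldProduct.mul A C hA hC)
  have h4 : fieldEl hU hreg _ (FieldProduct.mul A C hA hC) =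
    fieldEl hU hreg A hA * fieldEl hU hreg C hC := rfl
  rw [h4] at h3
  simp only [derivation_mul, map_add, sum_add_distrib] at h3
  simp only [← mul_sum, ← sum_mul, h1, h2, mul_zero, zero_mul, zero_add, add_zero] at h3
  rw [sum_add_distrib]
  exact h3

lemma fieldSystem_box (hsc : StrongConstraint U Φ Λ) (f : (fieldSystem hU hreg).alg) :
    ∑ i, (fieldSystem hU hreg).dir (Pi.single (.inr i) 1)
      ((fieldSystem hU hreg).dir (Pi.single (.inl i) 1) f) = 0 :=
  (fieldSystem hU hreg).box_of_gens (fun i => Pi.single (.inr i) 1)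
    (fun i => Pi.single (.inl i) 1) (fieldSystem_sc hU hreg hsc)
    (fieldSystem_box_fieldEl hU hreg hsc) f

/-- The background of the fields `Φ`. -/
def fieldBackground (hsc : StrongConstraint U Φ Λ) : Background D (fieldSystem hU hreg).alg :=
  (fieldSystem hU hreg).background (fun i => Pi.single (.inr i) 1) (fun i => Pi.single (.inl i) 1)
    (fieldSystem_sc hU hreg hsc) (fieldSystem_box hU hreg hsc)
    (fun i j => fieldEl hU hreg _ (.E i j)) (fieldEl hU hreg _ .d) fun X => hreg.nondeg X X.2

/-- The identity slice. -/
def fieldSlice (hsc : StrongConstraint U Φ Λ) :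
    Slice (fieldSystem hU hreg) (fieldBackground hU hreg hsc) Φ where
  x₀ := 0
  L := ContinuousLinearMap.id ℝ _
  dx _ _ := rfl
  dt _ _ := rfl
  E i j X hX := (congrArg (Φ.E i j) (zero_add X).symm).trans
    (ev_fieldEl hU hreg _ (.E i j) _ hX).symm
  d X hX := (congrArg Φ.d (zero_add X).symm).trans (ev_fieldEl hU hreg _ .d _ hX).symm

lemma fieldSlice_rel (hsc : StrongConstraint U Φ Λ) (A : Sc D) (hA : FieldProduct Φ Λ A) :
    (fieldSlice hU hreg hsc).Rel A (fieldEl hU hreg A hA) := fun X hX =>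
  (congrArg A (zero_add X).symm).trans (ev_fieldEl hU hreg A hA _ hX).symm

end FieldSystem

end DFT

end

/-! ### The one-parameter family of varied fields. -/

noncomputable section

namespace DFT

open Kind Finset Topology

variable {D : ℕ} {U : Set (Doubled D)} {Φ : Fields D} {Λ : GaugeParam D}
  (hU : IsOpen U) (hreg : Regular U Φ Λ) (hsc : StrongConstraint U Φ Λ)

/-- The gauge parameters as elements of the algebra. -/
def xiEl (i : Fin D) : (fieldSystem hU hreg).alg := fieldEl hU hreg _ (.xi i)

/-- The dual gauge parameters as elements of the algebra. -/
def xitEl (i : Fin D) : (fieldSystem hU hreg).alg := fieldEl hU hreg _ (.xit i)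

/-- The variation of `ℰ` as an element of the algebra. -/
def deltaEEl (i j : Fin D) : (fieldSystem hU hreg).alg :=
  (fieldBackground hU hreg hsc).gaugeE (xiEl hU hreg) (xitEl hU hreg) i j
    + (fieldBackground hU hreg hsc).transport (xiEl hU hreg) (xitEl hU hreg)
      ((fieldBackground hU hreg hsc).E i j)

/-- The variation of `d` as an element of the algebra. -/
def deltaDilEl : (fieldSystem hU hreg).alg :=
  -(half _ * ∑ i, ((fieldBackground hU hreg hsc).dx i (xiEl hU hreg i)
      + (fieldBackground hU hreg hsc).dt i (xitEl hU hreg i)))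
    + (fieldBackground hU hreg hsc).transport (xiEl hU hreg) (xitEl hU hreg)
      (fieldBackground hU hreg hsc).d

lemma fieldSlice_rel_eq {φ : Sc D} {f : (fieldSystem hU hreg).alg}
    (h : (fieldSlice hU hreg hsc).Rel φ f) (X : Doubled D) (hX : X ∈ U) :
    φ X = (fieldSystem hU hreg).ev ⟨X, hX⟩ f := by
  have h1 : (fieldSlice hU hreg hsc).x₀ + (fieldSlice hU hreg hsc).L X = X := zero_add X
  have h2 : (fieldSlice hU hreg hsc).x₀ + (fieldSlice hU hreg hsc).L X ∈
      (fieldSystem hU hreg).V := by rwa [h1]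
  rw [h X h2]
  congr 2
  exact Subtype.ext h1

lemma deltaE_eq (i j : Fin D) (X : Doubled D) (hX : X ∈ U) :
    deltaE Φ Λ i j X = (fieldSystem hU hreg).ev ⟨X, hX⟩ (deltaEEl hU hreg hsc i j) :=
  fieldSlice_rel_eq hU hreg hsc (Slice.rel_deltaE (fun i => fieldSlice_rel hU hreg hsc _ (.xi i))
    (fun i => fieldSlice_rel hU hreg hsc _ (.xit i)) i j) X hX

lemma deltaDil_eq (X : Doubled D) (hX : X ∈ U) :
    deltaDil Φ Λ X = (fieldSystem hU hreg).ev ⟨X, hX⟩ (deltaDilEl hU hreg hsc) :=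
  fieldSlice_rel_eq hU hreg hsc (Slice.rel_deltaDil (fun i => fieldSlice_rel hU hreg hsc _ (.xi i))
    (fun i => fieldSlice_rel hU hreg hsc _ (.xit i))) X hX

/-- Used for `isOpen_family`: the pairs (t, X) with nondegenerate varied metric form an open set. -/
lemma continuousOn_deltaE (hU : IsOpen U) (hreg : Regular U Φ Λ) (hsc : StrongConstraint U Φ Λ)
    (i j : Fin D) : ContinuousOn (deltaE Φ Λ i j) U := by
  intro X hX
  have h := ((fieldSystem hU hreg).contDiffAt (deltaEEl hU hreg hsc i j).2 ⟨X, hX⟩).continuousAt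
  refine (h.congr ?_).continuousWithinAt
  exact extendZero_eventuallyEq hU (fun Y => (deltaE_eq hU hreg hsc i j Y Y.2).symm) ⟨X, hX⟩

lemma isOpen_family (hU : IsOpen U) (hreg : Regular U Φ Λ) (hsc : StrongConstraint U Φ Λ) :
    IsOpen {z : ℝ × Doubled D |
    z.2 ∈ U ∧ ((gaugeVaried Φ Λ z.1).gMat z.2).det ≠ 0} := by
  have hs : ∀ {φ : Sc D}, ContinuousOn φ U →
      ContinuousOn (fun z : ℝ × Doubled D => φ z.2) (Prod.snd ⁻¹' U) := fun h =>
    h.comp continuousOn_snd fun _ hz => hz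
  have hE : ∀ i j, ContinuousOn (fun z : ℝ × Doubled D => (gaugeVaried Φ Λ z.1).E i j z.2)
      (Prod.snd ⁻¹' U) := fun i j =>
    (hs (hreg.smooth_E i j).continuousOn).add
      (continuousOn_fst.mul (hs (continuousOn_deltaE hU hreg hsc i j)))
  have hc : ContinuousOn (fun z : ℝ × Doubled D => ((gaugeVaried Φ Λ z.1).gMat z.2).det)
      (Prod.snd ⁻¹' U) := by
    simp_rw [Matrix.det_apply]
    refine continuousOn_finsetSum _ fun σ _ => ?_
    refine ContinuousOn.const_smul (continuousOn_finsetProd _ fun i _ => ?_) _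
    exact continuousOn_const.mul ((hE _ _).add (hE _ _))
  exact hc.isOpen_inter_preimage (hU.preimage continuous_snd) isOpen_ne

/-- The system of functions of a parameter and of a point generated by the parameter, the fields
and the gauge parameters. -/
def familySystem : GenSystem (ℝ × Doubled D) where
  V := {z | z.2 ∈ U ∧ ((gaugeVaried Φ Λ z.1).gMat z.2).det ≠ 0}
  isOpen := isOpen_family hU hreg hsc
  gens := {g | (∃ A, FieldProduct Φ Λ A ∧ g = fun z => A z.2) ∨ g = Prod.fst}
  smooth := by
    rintro g (⟨A, hA, rfl⟩ | rfl)
    · exact (hA.contDiffOn hU hreg).comp contDiffOn_snd fun z hz => hz.1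
    · exact contDiffOn_fst
  deriv := by
    rintro g (⟨A, hA, rfl⟩ | rfl) v
    · have h : (fun z : {z : ℝ × Doubled D |
          z.2 ∈ U ∧ ((gaugeVaried Φ Λ z.1).gMat z.2).det ≠ 0} =>
          fderiv ℝ (fun z : ℝ × Doubled D => A z.2) z v) =
          ∑ M, (fun _ => v.2 M) * fun z : {z : ℝ × Doubled D |
            z.2 ∈ U ∧ ((gaugeVaried Φ Λ z.1).gMat z.2).det ≠ 0} => pd M A z.1.2 := by
        funext z
        have h1 : HasFDerivAt A (fderiv ℝ A z.1.2) z.1.2 :=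
          (((hA.contDiffOn hU hreg).contDiffAt (hU.mem_nhds z.2.1)).differentiableAt
            (by simp)).hasFDerivAt
        have h2 : HasFDerivAt (fun z : ℝ × Doubled D => A z.2)
            ((fderiv ℝ A z.1.2).comp (ContinuousLinearMap.snd ℝ ℝ (Doubled D))) z.1 :=
          h1.comp z.1 hasFDerivAt_snd
        rw [h2.fderiv]
        refine (fderiv_eq_sum_pd A z.1.2 v.2).trans ?_
        simp
      rw [h]
      exact Gen.sum _ _ fun M _ => (Gen.const _).mul _ _
        (Gen.gen (fun z : ℝ × Doubled D => pd M A z.2) (Or.inl ⟨_, hA.deriv M A, rfl⟩))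
    · have h : (fun z : {z : ℝ × Doubled D |
          z.2 ∈ U ∧ ((gaugeVaried Φ Λ z.1).gMat z.2).det ≠ 0} =>
          fderiv ℝ (Prod.fst : ℝ × Doubled D → ℝ) z v) = fun _ => v.1 := by
        funext z
        rw [fderiv_fst]
        rfl
      rw [h]
      exact Gen.const _

/-- The projection to the doubled space. -/
def familyProj : GenSystem.Hom (familySystem hU hreg hsc) (fieldSystem hU hreg) where
  L := ContinuousLinearMap.snd ℝ ℝ (Doubled D)
  mapsTo _ hz := hz.1
  gens A hA := Gen.gen (fun z : ℝ × Doubled D => A z.2) (Or.inl ⟨A, hA, rfl⟩)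

/-- The inclusion at parameter zero. -/
def familyIncl : GenSystem.Hom (fieldSystem hU hreg) (familySystem hU hreg hsc) where
  L := ContinuousLinearMap.inr ℝ ℝ (Doubled D)
  mapsTo X hX := by
    refine ⟨hX, ?_⟩
    have h : (gaugeVaried Φ Λ 0).gMat X = Φ.gMat X := by
      ext i j
      simp [gaugeVaried, Fields.gMat]
    exact h ▸ hreg.nondeg X hX
  gens := by
    rintro g (⟨A, hA, rfl⟩ | rfl)
    · exact Gen.gen A hA
    · exact Gen.const 0

/-- The parameter as an element of the algebra. -/
def paramEl : (familySystem hU hreg hsc).alg :=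
  (familySystem hU hreg hsc).ofGen Prod.fst (Or.inr rfl)

lemma dir_paramEl (v : ℝ × Doubled D) : (familySystem hU hreg hsc).dir v
    (paramEl hU hreg hsc) = algebraMap ℝ _ v.1 := by
  refine Subtype.ext (funext fun z => ?_)
  rw [(familySystem hU hreg hsc).dir_eq (f := paramEl hU hreg hsc) (g := Prod.fst) fun _ => rfl,
    fderiv_fst]
  rfl

lemma dir_familyProj (v : ℝ × Doubled D) (f : (fieldSystem hU hreg).alg) :
    (familySystem hU hreg hsc).dir v ((familyProj hU hreg hsc).pullback f) =
      (familyProj hU hreg hsc).pullback ((fieldSystem hU hreg).dir v.2 f) :=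
  (familyProj hU hreg hsc).dir_pullback v f

lemma familySystem_gens (g : ℝ × Doubled D → ℝ) (hg : g ∈ (familySystem hU hreg hsc).gens) :
    (∃ f, (familySystem hU hreg hsc).ofGen g hg = (familyProj hU hreg hsc).pullback f) ∨
      (familySystem hU hreg hsc).ofGen g hg = paramEl hU hreg hsc := by
  rcases hg with ⟨A, hA, rfl⟩ | rfl
  · exact Or.inl ⟨fieldEl hU hreg A hA, rfl⟩
  · exact Or.inr rfl

/-- The coordinate directions annihilate t, and all other generators are pulled back from U. -/
lemma familySystem_sc (f g : (familySystem hU hreg hsc).alg) :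
    ∑ i, ((familySystem hU hreg hsc).dir (0, Pi.single (.inr i) 1) f
        * (familySystem hU hreg hsc).dir (0, Pi.single (.inl i) 1) g
      + (familySystem hU hreg hsc).dir (0, Pi.single (.inl i) 1) f
        * (familySystem hU hreg hsc).dir (0, Pi.single (.inr i) 1) g) = 0 := by
  refine (familySystem hU hreg hsc).sc_of_gens (fun i => (0, Pi.single (.inr i) 1))
    (fun i => (0, Pi.single (.inl i) 1)) (fun g₁ h₁ g₂ h₂ => ?_) f g
  obtain ⟨f₁, e₁⟩ | e₁ := familySystem_gens hU hreg hsc g₁ h₁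
  · obtain ⟨f₂, e₂⟩ | e₂ := familySystem_gens hU hreg hsc g₂ h₂
    · rw [e₁, e₂]
      simp only [dir_familyProj]
      have h := congrArg (familyProj hU hreg hsc).pullback (fieldSystem_sc hU hreg hsc f₁ f₂)
      simpa only [map_sum, map_add, map_mul, map_zero] using h
    · simp [e₂, dir_paramEl]
  · simp [e₁, dir_paramEl]

lemma familySystem_box (f : (familySystem hU hreg hsc).alg) :
    ∑ i, (familySystem hU hreg hsc).dir (0, Pi.single (.inr i) 1)
      ((familySystem hU hreg hsc).dir (0, Pi.single (.inl i) 1) f) = 0 := by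
  refine (familySystem hU hreg hsc).box_of_gens (fun i => (0, Pi.single (.inr i) 1))
    (fun i => (0, Pi.single (.inl i) 1)) (familySystem_sc hU hreg hsc) (fun g hg => ?_) f
  obtain ⟨f₁, e₁⟩ | e₁ := familySystem_gens hU hreg hsc g hg
  · rw [e₁]
    simp only [dir_familyProj]
    have h := congrArg (familyProj hU hreg hsc).pullback (fieldSystem_box hU hreg hsc f₁)
    simpa only [map_sum, map_zero] using h
  · simp [e₁, dir_paramEl]

/-- The background of the gauge varied fields. -/
def familyBackground : Background D (familySystem hU hreg hsc).alg :=
  (familySystem hU hreg hsc).background (fun i => (0, Pi.single (.inr i) 1))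
    (fun i => (0, Pi.single (.inl i) 1)) (familySystem_sc hU hreg hsc)
    (familySystem_box hU hreg hsc)
    (fun i j => (familyProj hU hreg hsc).pullback ((fieldBackground hU hreg hsc).E i j)
      + paramEl hU hreg hsc * (familyProj hU hreg hsc).pullback (deltaEEl hU hreg hsc i j))
    ((familyProj hU hreg hsc).pullback (fieldBackground hU hreg hsc).d
      + paramEl hU hreg hsc * (familyProj hU hreg hsc).pullback (deltaDilEl hU hreg hsc))
    fun z => by
      have h := z.2.2
      have h1 : ∀ i j, (gaugeVaried Φ Λ z.1.1).E i j z.1.2 = (familySystem hU hreg hsc).ev z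
          ((familyProj hU hreg hsc).pullback ((fieldBackground hU hreg hsc).E i j)
      + paramEl hU hreg hsc * (familyProj hU hreg hsc).pullback (deltaEEl hU hreg hsc i j)) :=
        fun i j => by
          rw [map_add, map_mul]
          exact congrArg (fun r => Φ.E i j z.1.2 + z.1.1 * r)
            (deltaE_eq hU hreg hsc i j z.1.2 z.2.1)
      simpa only [Fields.gMat, h1] using h

end DFT

end

/-! ### The derivative of the Ricci-like tensor along the family. -/

noncomputable section

namespace DFT

open Kind Finset Topology

/-- The inverse metric of a background is determined by ℰ, so an algebra map compatible with ℰ is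
compatible with it too. -/
lemma map_gI {D : ℕ} {A A₀ : Type*} [CommRing A] [Algebra ℝ A] [CommRing A₀] [Algebra ℝ A₀]
    {B : Background D A} {B₀ : Background D A₀} (q : A →ₐ[ℝ] A₀)
    (h : ∀ i j, q (B.E i j) = B₀.E i j) (i j : Fin D) : q (B.gI i j) = B₀.gI i j := by
  have h1 : (Matrix.of fun i j => q (B.gI i j)) * (Matrix.of B₀.E + (Matrix.of B₀.E).transpose) =
      2 := by
    rw [← B₀.gI_mul_metric]
    ext i j
    rw [Matrix.mul_apply, Matrix.mul_apply]
    refine Eq.trans ?_ (B₀.gI_g i j).symm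
    have h2 := congrArg q (B.gI_g i j)
    rw [map_sum] at h2
    simp only [map_mul, map_add, h] at h2
    refine h2.trans ?_
    split_ifs
    · exact map_ofNat q 2
    · exact map_zero q
  exact congrFun (congrFun (eq_of_half_smul_mul h1 B₀.gI_mul_metric) i) j

variable {D : ℕ} {U : Set (Doubled D)} {Φ : Fields D} {Λ : GaugeParam D}
  (hU : IsOpen U) (hreg : Regular U Φ Λ) (hsc : StrongConstraint U Φ Λ)

lemma familyIncl_paramEl : (familyIncl hU hreg hsc).pullback (paramEl hU hreg hsc) = 0 := rfl

lemma familyIncl_familyProj (f : (fieldSystem hU hreg).alg) :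
    (familyIncl hU hreg hsc).pullback ((familyProj hU hreg hsc).pullback f) = f := rfl

lemma familyIncl_dir (f g : (fieldSystem hU hreg).alg) :
    (familyIncl hU hreg hsc).pullback ((familySystem hU hreg hsc).dir (1, 0)
      ((familyProj hU hreg hsc).pullback f
        + paramEl hU hreg hsc * (familyProj hU hreg hsc).pullback g)) = g := by
  have h : ∀ f : (fieldSystem hU hreg).alg, (fieldSystem hU hreg).dir 0 f = 0 := fun f =>
    Subtype.ext (funext fun X => map_zero _)
  rw [map_add, derivation_mul, dir_familyProj, dir_familyProj, dir_paramEl, h, h]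
  simp only [map_zero, mul_zero, zero_add, map_one, one_mul]
  exact familyIncl_familyProj hU hreg hsc g

/-- The gauge variation of the fields. -/
def fieldVariation : GaugeVariation (familyBackground hU hreg hsc) (fieldBackground hU hreg hsc)
    (xiEl hU hreg) (xitEl hU hreg) where
  q := (familyIncl hU hreg hsc).pullback
  δ := (familyIncl hU hreg hsc).pullback.toLinearMap ∘ₗ
    ((familySystem hU hreg hsc).dir (1, 0)).toLinearMap
  δ_mul f g := by
    change (familyIncl hU hreg hsc).pullback ((familySystem hU hreg hsc).dir (1, 0) (f * g)) = _
    rw [derivation_mul, map_add, map_mul, map_mul]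
    rfl
  q_dx i f := ((familyIncl hU hreg hsc).dir_pullback (Pi.single (.inr i) 1) f).symm
  q_dt i f := ((familyIncl hU hreg hsc).dir_pullback (Pi.single (.inl i) 1) f).symm
  δ_dx i f := (congrArg (familyIncl hU hreg hsc).pullback
    ((familySystem hU hreg hsc).dir_comm (1, 0) (0, Pi.single (.inr i) 1) f)).trans
      ((familyIncl hU hreg hsc).dir_pullback (Pi.single (.inr i) 1) _).symm
  δ_dt i f := (congrArg (familyIncl hU hreg hsc).pullback
    ((familySystem hU hreg hsc).dir_comm (1, 0) (0, Pi.single (.inl i) 1) f)).trans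
      ((familyIncl hU hreg hsc).dir_pullback (Pi.single (.inl i) 1) _).symm
  q_E i j := by
    refine (map_add _ _ _).trans ?_
    rw [map_mul, familyIncl_paramEl, zero_mul, add_zero]
    rfl
  q_d := by
    refine (map_add _ _ _).trans ?_
    rw [map_mul, familyIncl_paramEl, zero_mul, add_zero]
    rfl
  q_gI := map_gI _ fun i j => by
    refine (map_add _ _ _).trans ?_
    rw [map_mul, familyIncl_paramEl, zero_mul, add_zero]
    rfl
  δ_E i j := familyIncl_dir hU hreg hsc _ _
  δ_d := familyIncl_dir hU hreg hsc _ _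

lemma gaugeVaried_E_eq (i j : Fin D) (z : (familySystem hU hreg hsc).V) :
    (gaugeVaried Φ Λ z.1.1).E i j z.1.2 =
      (familySystem hU hreg hsc).ev z ((familyBackground hU hreg hsc).E i j) := by
  refine Eq.trans ?_ (map_add ((familySystem hU hreg hsc).ev z) _ _).symm
  rw [map_mul]
  exact congrArg (fun r => Φ.E i j z.1.2 + z.1.1 * r) (deltaE_eq hU hreg hsc i j z.1.2 z.2.1)

lemma gaugeVaried_d_eq (z : (familySystem hU hreg hsc).V) :
    (gaugeVaried Φ Λ z.1.1).d z.1.2 =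
      (familySystem hU hreg hsc).ev z (familyBackground hU hreg hsc).d := by
  refine Eq.trans ?_ (map_add ((familySystem hU hreg hsc).ev z) _ _).symm
  rw [map_mul]
  exact congrArg (fun r => Φ.d z.1.2 + z.1.1 * r) (deltaDil_eq hU hreg hsc z.1.2 z.2.1)

/-- The slice at a fixed parameter. -/
def familySlice (t : ℝ) : Slice (familySystem hU hreg hsc) (familyBackground hU hreg hsc)
    (gaugeVaried Φ Λ t) where
  x₀ := (t, 0)
  L := ContinuousLinearMap.inr ℝ ℝ (Doubled D)
  dx _ _ := rfl
  dt _ _ := rfl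
  E i j X hX := by
    have e : (t, (0 : Doubled D)) + ContinuousLinearMap.inr ℝ ℝ (Doubled D) X = (t, X) := by
      simp
    exact (congrArg (fun z : ℝ × Doubled D => (gaugeVaried Φ Λ z.1).E i j z.2) e.symm).trans
      (gaugeVaried_E_eq hU hreg hsc i j ⟨_, hX⟩)
  d X hX := by
    have e : (t, (0 : Doubled D)) + ContinuousLinearMap.inr ℝ ℝ (Doubled D) X = (t, X) := by
      simp
    exact (congrArg (fun z : ℝ × Doubled D => (gaugeVaried Φ Λ z.1).d z.2) e.symm).trans
      (gaugeVaried_d_eq hU hreg hsc ⟨_, hX⟩)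

/-- For t near 0 the point (t, X) stays in the open domain, where 𝒦 of the varied fields is the
value of a single element of the family algebra. Its smoothness gives existence of the derivative,
and ∂_t at t = 0 is δ by construction. -/
lemma hasDerivAt_Ricci (X : Doubled D) (hX : X ∈ U) (p q : Fin D) :
    HasDerivAt (fun t => Ricci (gaugeVaried Φ Λ t) p q X)
      ((fieldSystem hU hreg).ev ⟨X, hX⟩
        ((fieldVariation hU hreg hsc).δ ((familyBackground hU hreg hsc).ricci p q))) 0 := by
  have h0 : ((0 : ℝ), X) ∈ (familySystem hU hreg hsc).V :=
    (familyIncl hU hreg hsc).mapsTo X hX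
  set f := (familyBackground hU hreg hsc).ricci p q with hf
  have hc : Continuous fun t : ℝ => (t, X) := by fun_prop
  have h1 : (fun t => Ricci (gaugeVaried Φ Λ t) p q X) =ᶠ[𝓝 0]
      fun t => extendZero (f : (familySystem hU hreg hsc).V → ℝ) (t, X) := by
    filter_upwards [((familySystem hU hreg hsc).isOpen.preimage hc).mem_nhds h0] with t ht
    have e : (t, (0 : Doubled D)) + ContinuousLinearMap.inr ℝ ℝ (Doubled D) X = (t, X) := by
      simp
    have ht' : (t, (0 : Doubled D)) + ContinuousLinearMap.inr ℝ ℝ (Doubled D) X ∈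
        (familySystem hU hreg hsc).V := e.symm ▸ ht
    refine ((familySlice hU hreg hsc t).rel_Ricci p q X ht').trans ?_
    rw [← hf, ← e]
    exact (extendZero_apply (f : (familySystem hU hreg hsc).V → ℝ) ⟨_, ht'⟩).symm
  have h2 := ((familySystem hU hreg hsc).differentiableAt f.2 ⟨_, h0⟩).hasFDerivAt
  have h3 : HasDerivAt (fun t : ℝ => (t, X)) (1, 0) 0 :=
    (hasDerivAt_id 0).prodMk (hasDerivAt_const 0 X)
  exact (h2.comp_hasDerivAt (0 : ℝ) h3).congr_of_eventuallyEq h1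

theorem hasDerivAt_Ricci_lie (hU : IsOpen U) (hreg : Regular U Φ Λ)
    (hsc : StrongConstraint U Φ Λ) (X : Doubled D) (hX : X ∈ U) (p q : Fin D) :
    HasDerivAt (fun t : ℝ => Ricci (gaugeVaried Φ Λ t) p q X)
      (lieXi Λ (Ricci Φ) p q X + lieXit Λ (Ricci Φ) p q X
        + ∑ k, ∑ l, Φ.E p k X * Tkl Λ k l X * Ricci Φ l q X
        + ∑ k, ∑ l, Φ.E l q X * Tkl Λ k l X * Ricci Φ p k X) 0 := by
  have h := hasDerivAt_Ricci hU hreg hsc X hX p q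
  rw [GaugeVariation.δ_ricci] at h
  exact h.congr_deriv (fieldSlice_rel_eq hU hreg hsc (Slice.rel_lie
    (fun i => fieldSlice_rel hU hreg hsc _ (.xi i)) (fun i => fieldSlice_rel hU hreg hsc _ (.xit i))
    (fieldSlice hU hreg hsc).rel_Ricci p q) X hX).symm

theorem hasDerivAt_Ricci_split (hU : IsOpen U) (hreg : Regular U Φ Λ)
    (hsc : StrongConstraint U Φ Λ) (X : Doubled D) (hX : X ∈ U) (p q : Fin D) :
    HasDerivAt (fun t : ℝ => Ricci (gaugeVaried Φ Λ t) p q X)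
      (firstLine Φ Λ p q X + extraOne Φ Λ p q X + extraTwo Φ Λ p q X) 0 := by
  have h := hasDerivAt_Ricci hU hreg hsc X hX p q
  have hxi := fun i => fieldSlice_rel hU hreg hsc _ (.xi i)
  have hxit := fun i => fieldSlice_rel hU hreg hsc _ (.xit i)
  rw [GaugeVariation.δ_ricci, ← Background.firstLine_add_extra, map_add, map_add] at h
  rw [fieldSlice_rel_eq hU hreg hsc (Slice.rel_firstLine hxi hxit p q) X hX,
    fieldSlice_rel_eq hU hreg hsc (Slice.rel_extraOne hxi hxit p q) X hX,
    fieldSlice_rel_eq hU hreg hsc (Slice.rel_extraTwo hxi hxit p q) X hX]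
  exact h

end DFT

end

/-! ### O(D,D) covariance of F for fields on the doubled space. -/

noncomputable section

namespace DFT

open Kind Finset Topology Matrix

variable {D : ℕ}

/-- The blocks of an element of `O(D,D)`. -/
def IsODD.blocks {h : DMat D} (hh : IsODD h) : ODDBlocks D ℝ := by
  have h1 : (fromBlocks h.toBlocks₁₁ h.toBlocks₁₂ h.toBlocks₂₁ h.toBlocks₂₂)ᵀ *
      fromBlocks 0 1 1 0 * fromBlocks h.toBlocks₁₁ h.toBlocks₁₂ h.toBlocks₂₁ h.toBlocks₂₂ =
      fromBlocks 0 1 1 0 := by rwa [fromBlocks_toBlocks]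
  have h3 : (fromBlocks 0 1 1 0 : DMat D) * fromBlocks 0 1 1 0 = 1 := by
    simp [fromBlocks_multiply]
  -- The left inverse ηhᵗη is also a right inverse; this supplies the relation `ce`.
  have h2 : fromBlocks h.toBlocks₁₁ h.toBlocks₁₂ h.toBlocks₂₁ h.toBlocks₂₂ * (fromBlocks 0 1 1 0 *
      (fromBlocks h.toBlocks₁₁ h.toBlocks₁₂ h.toBlocks₂₁ h.toBlocks₂₂)ᵀ * fromBlocks 0 1 1 0)
      = 1 := by
    rw [mul_eq_one_comm, Matrix.mul_assoc, Matrix.mul_assoc, ← Matrix.mul_assoc _ (fromBlocks 0 1 1 0),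
      h1, h3]
  simp only [fromBlocks_transpose, fromBlocks_multiply, Matrix.mul_zero, Matrix.mul_one, zero_add,
    add_zero, fromBlocks_inj] at h1
  simp only [fromBlocks_transpose, fromBlocks_multiply, Matrix.mul_zero, Matrix.zero_mul,
    Matrix.one_mul, Matrix.mul_one, zero_add, add_zero] at h2
  rw [← fromBlocks_one, fromBlocks_inj] at h2
  exact
    { a := h.toBlocks₁₁
      b := h.toBlocks₁₂
      c := h.toBlocks₂₁
      e := h.toBlocks₂₂
      ac := by rw [add_comm]; exact h1.1
      be := by rw [add_comm]; exact h1.2.2.2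
      ae := by rw [add_comm]; exact h1.2.1
      ea := h1.2.2.1
      ce := h2.2.2.1 }

lemma IsODD.mul_eq_one {h : DMat D} (hh : IsODD h) :
    fromBlocks 0 1 1 0 * hᵀ * fromBlocks 0 1 1 0 * h = 1 := by
  have h3 : (fromBlocks 0 1 1 0 : DMat D) * fromBlocks 0 1 1 0 = 1 := by
    simp [fromBlocks_multiply]
  rw [Matrix.mul_assoc, Matrix.mul_assoc, ← Matrix.mul_assoc hᵀ]
  exact (congrArg (fromBlocks 0 1 1 0 * ·) hh).trans h3

lemma IsODD.inv_eq {h : DMat D} (hh : IsODD h) : h⁻¹ = fromBlocks h.toBlocks₂₂ᵀ h.toBlocks₁₂ᵀ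
    h.toBlocks₂₁ᵀ h.toBlocks₁₁ᵀ := by
  rw [inv_eq_left_inv hh.mul_eq_one]
  conv_lhs => rw [← fromBlocks_toBlocks h]
  simp [fromBlocks_transpose, fromBlocks_multiply]

lemma IsODD.inv_mulVec_mulVec {h : DMat D} (hh : IsODD h) (X : Doubled D) :
    h⁻¹ *ᵥ (h *ᵥ X) = X := by
  rw [mulVec_mulVec, inv_eq_left_inv hh.mul_eq_one, hh.mul_eq_one, one_mulVec]

/-- From h⁻¹ = ηhᵗη: by the chain rule, ∂_i of a function of h⁻¹X is the transform `oddDx` of its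
argument. -/
lemma IsODD.inv_mulVec_inr {h : DMat D} (hh : IsODD h) (i : Fin D) :
    h⁻¹ *ᵥ (Pi.single (.inr i) 1) = ∑ k, (h.toBlocks₁₂ i k • Pi.single (.inl k) (1 : ℝ)
      + h.toBlocks₁₁ i k • Pi.single (.inr k) (1 : ℝ)) := by
  rw [hh.inv_eq, mulVec_single_one]
  ext (M | M) <;> simp [Pi.single_apply]

lemma IsODD.inv_mulVec_inl {h : DMat D} (hh : IsODD h) (i : Fin D) :
    h⁻¹ *ᵥ (Pi.single (.inl i) 1) = ∑ k, (h.toBlocks₂₂ i k • Pi.single (.inl k) (1 : ℝ)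
      + h.toBlocks₂₁ i k • Pi.single (.inr k) (1 : ℝ)) := by
  rw [hh.inv_eq, mulVec_single_one]
  ext (M | M) <;> simp [Pi.single_apply]

variable {U : Set (Doubled D)} {Φ : Fields D} {Λ : GaugeParam D}
  (hU : IsOpen U) (hreg : Regular U Φ Λ) (hsc : StrongConstraint U Φ Λ) {h : DMat D}
  (hh : IsODD h) (hdet : ∀ X ∈ U, IsUnit (denomMat h Φ X).det)

/-- The matrix `cℰ + e` with entries in the algebra. -/
def denomEl : Matrix (Fin D) (Fin D) (fieldSystem hU hreg).alg :=
  (hh.blocks.alg (fieldSystem hU hreg).alg).c * Matrix.of (fieldBackground hU hreg hsc).E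
    + (hh.blocks.alg (fieldSystem hU hreg).alg).e

lemma map_algebraMap_ev {G : GenSystem (Doubled D)} (X : G.V) (m : Matrix (Fin D) (Fin D) ℝ) :
    (m.map (algebraMap ℝ G.alg)).map (G.ev X) = m := by
  ext i j
  exact (G.ev X).commutes _

lemma map_denomEl (X : (fieldSystem hU hreg).V) : (denomEl hU hreg hsc hh).map ((fieldSystem hU hreg).ev X) =
    denomMat h Φ X := by
  rw [denomEl, ← AlgHom.mapMatrix_apply, map_add, map_mul]
  simp only [AlgHom.mapMatrix_apply]
  exact congrArg₂ (· + ·) (congrArg₂ (· * ·) (map_algebraMap_ev X _) rfl) (map_algebraMap_ev X _)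

lemma isUnit_det_denomEl (hdet : ∀ X ∈ U, IsUnit (denomMat h Φ X).det) :
    IsUnit (denomEl hU hreg hsc hh).det := by
  refine (fieldSystem hU hreg).isUnit_of_ne_zero fun X => ?_
  rw [← GenSystem.ev_apply, AlgHom.map_det, AlgHom.mapMatrix_apply, map_denomEl]
  exact (hdet X X.2).ne_zero

/-- The transformed matrix `ℰ'`. -/
def fieldODDMatrix (hdet : ∀ X ∈ U, IsUnit (denomMat h Φ X).det) :
    (fieldBackground hU hreg hsc).ODDMatrix hh.blocks where
  E' := ((hh.blocks.alg (fieldSystem hU hreg).alg).a * Matrix.of (fieldBackground hU hreg hsc).E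
    + (hh.blocks.alg (fieldSystem hU hreg).alg).b) * (denomEl hU hreg hsc hh)⁻¹
  N := (denomEl hU hreg hsc hh)⁻¹
  hN := mul_nonsing_inv _ (isUnit_det_denomEl hU hreg hsc hh hdet)
  hE := nonsing_inv_mul_cancel_right _ _ (isUnit_det_denomEl hU hreg hsc hh hdet)

lemma map_fieldODDMatrix (X : (fieldSystem hU hreg).V) :
    (fieldODDMatrix hU hreg hsc hh hdet).E'.map ((fieldSystem hU hreg).ev X) =
      (h.toBlocks₁₁ * Φ.EMat X + h.toBlocks₁₂) * (denomMat h Φ X)⁻¹ := by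
  have h1 : (denomMat h Φ X)⁻¹ =
      (denomEl hU hreg hsc hh)⁻¹.map ((fieldSystem hU hreg).ev X) := by
    refine inv_eq_right_inv ?_
    rw [← map_denomEl hU hreg hsc hh, ← AlgHom.mapMatrix_apply, ← AlgHom.mapMatrix_apply,
      ← map_mul, mul_nonsing_inv _ (isUnit_det_denomEl hU hreg hsc hh hdet), map_one]
  rw [h1, fieldODDMatrix, ← AlgHom.mapMatrix_apply, map_mul, map_add, map_mul]
  simp only [AlgHom.mapMatrix_apply]
  exact congrArg (· * _) (congrArg₂ (· + ·) (congrArg₂ (· * ·) (map_algebraMap_ev X _) rfl)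
    (map_algebraMap_ev X _))

/-- The slice of the transformed fields. -/
def fieldODDSlice : Slice (fieldSystem hU hreg) (fieldODDMatrix hU hreg hsc hh hdet).background
    (actFields h Φ) where
  x₀ := 0
  L := (Matrix.mulVecLin h⁻¹).toContinuousLinearMap
  dx i f := by
    change _ = (fieldSystem hU hreg).dir (h⁻¹ *ᵥ Pi.single (.inr i) 1) f
    rw [hh.inv_mulVec_inr, GenSystem.dir_sum]
    simp only [GenSystem.dir_add, GenSystem.dir_smul]
    exact Background.oddDx_apply ..
  dt i f := by
    change _ = (fieldSystem hU hreg).dir (h⁻¹ *ᵥ Pi.single (.inl i) 1) f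
    rw [hh.inv_mulVec_inl, GenSystem.dir_sum]
    simp only [GenSystem.dir_add, GenSystem.dir_smul]
    exact Background.oddDt_apply ..
  E i j X hX := by
    refine Eq.trans ?_ (congrFun (congrFun
      (map_fieldODDMatrix hU hreg hsc hh hdet ⟨_, hX⟩) i) j).symm
    exact congrArg (fun Y => ((h.toBlocks₁₁ * Φ.EMat Y + h.toBlocks₁₂) * (denomMat h Φ Y)⁻¹) i j)
      (zero_add (h⁻¹ *ᵥ X)).symm
  d X hX := congrArg Φ.d (zero_add (h⁻¹ *ᵥ X)).symm

lemma fieldODDSlice_rel (i : Fin D) :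
    (fieldODDSlice hU hreg hsc hh hdet).Rel ((actGauge h Λ).xi i)
      (((hh.blocks.alg (fieldSystem hU hreg).alg).c *ᵥ xitEl hU hreg
        + (hh.blocks.alg (fieldSystem hU hreg).alg).e *ᵥ xiEl hU hreg) i) ∧
    (fieldODDSlice hU hreg hsc hh hdet).Rel ((actGauge h Λ).xit i)
      (((hh.blocks.alg (fieldSystem hU hreg).alg).a *ᵥ xitEl hU hreg
        + (hh.blocks.alg (fieldSystem hU hreg).alg).b *ᵥ xiEl hU hreg) i) := by
  have key : ∀ (m n : Matrix (Fin D) (Fin D) ℝ) (X : Doubled D)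
      (hX : 0 + h⁻¹ *ᵥ X ∈ U), ∑ j, m i j * Λ.xit j (h⁻¹ *ᵥ X) + ∑ j, n i j * Λ.xi j (h⁻¹ *ᵥ X) =
      (fieldSystem hU hreg).ev ⟨_, hX⟩ ((m.map (algebraMap ℝ _) *ᵥ xitEl hU hreg
        + n.map (algebraMap ℝ _) *ᵥ xiEl hU hreg) i) := fun m n X hX => by
    simp only [Pi.add_apply, mulVec, dotProduct, map_add, map_sum, map_mul, map_apply,
      AlgHom.commutes]
    exact congrArg (fun Y => ∑ j, m i j * Λ.xit j Y + ∑ j, n i j * Λ.xi j Y)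
      (zero_add (h⁻¹ *ᵥ X)).symm
  refine ⟨fun X hX => Eq.trans ?_ (key hh.blocks.c hh.blocks.e X hX),
    fun X hX => Eq.trans ?_ (key hh.blocks.a hh.blocks.b X hX)⟩
  · exact Fintype.sum_sum_type fun M => h (.inr i) M * Λ.vec (h⁻¹ *ᵥ X) M
  · exact Fintype.sum_sum_type fun M => h (.inl i) M * Λ.vec (h⁻¹ *ᵥ X) M

lemma map_matM_ev (X : (fieldSystem hU hreg).V) :
    ((hh.blocks.alg _).matM (Matrix.of (fieldBackground hU hreg hsc).E)).map
      ((fieldSystem hU hreg).ev X) = MMat h Φ X := by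
  rw [ODDBlocks.matM, ← AlgHom.mapMatrix_apply, map_sub, map_mul]
  simp only [AlgHom.mapMatrix_apply]
  exact congrArg₂ (· - ·) (map_algebraMap_ev X hh.blocks.eᵀ)
    (congrArg₂ (· * ·) rfl (map_algebraMap_ev X hh.blocks.cᵀ))

lemma map_matMBar_ev (X : (fieldSystem hU hreg).V) :
    ((hh.blocks.alg _).matMBar (Matrix.of (fieldBackground hU hreg hsc).E)).map
      ((fieldSystem hU hreg).ev X) = MBarMat h Φ X := by
  rw [ODDBlocks.matMBar, ← AlgHom.mapMatrix_apply, map_add, map_mul]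
  simp only [AlgHom.mapMatrix_apply]
  exact congrArg₂ (· + ·) (map_algebraMap_ev X hh.blocks.eᵀ)
    (congrArg₂ (· * ·) rfl (map_algebraMap_ev X hh.blocks.cᵀ))

/-- The transformed fields are pullbacks along h⁻¹ of a background on the same function algebra.
Covariance at X is thus the algebraic identity `ODDMatrix.firstLine_eq` evaluated at X = h⁻¹(hX). -/
theorem isODDTensor_firstLine : IsODDTensor (D := D) firstLine := by
  intro U Φ Λ hU hreg hsc h hh hdet X hX p q
  have hxi := fun i => fieldSlice_rel hU hreg hsc _ (.xi i)
  have hxit := fun i => fieldSlice_rel hU hreg hsc _ (.xit i)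
  have e : (0 : Doubled D) + h⁻¹ *ᵥ (h *ᵥ X) = X := by rw [zero_add, hh.inv_mulVec_mulVec]
  have hX' : (0 : Doubled D) + h⁻¹ *ᵥ (h *ᵥ X) ∈ U := e.symm ▸ hX
  have e' : (⟨X, hX⟩ : (fieldSystem hU hreg).V) = ⟨_, hX'⟩ := Subtype.ext e.symm
  have h1 := fun k l => Slice.rel_firstLine
    (fun i => (fieldODDSlice_rel hU hreg hsc hh hdet i).1)
    (fun i => (fieldODDSlice_rel hU hreg hsc hh hdet i).2) k l (h *ᵥ X) hX'
  rw [fieldSlice_rel_eq hU hreg hsc (Slice.rel_firstLine hxi hxit p q) X hX,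
    (fieldODDMatrix hU hreg hsc hh hdet).firstLine_eq, map_sum]
  refine sum_congr rfl fun k _ => ?_
  rw [map_sum]
  refine sum_congr rfl fun l _ => ?_
  rw [map_mul, map_mul, h1 k l]
  have e1 : ∀ f, (fieldSystem hU hreg).ev ⟨X, hX⟩ f = (fieldSystem hU hreg).ev ⟨_, hX'⟩ f :=
    fun f => congrArg (fun Y => (fieldSystem hU hreg).ev Y f) e'
  exact congrArg₂ (· * ·) (congrArg₂ (· * ·)
    (congrFun (congrFun (map_matM_ev hU hreg hsc hh ⟨X, hX⟩) p) k)
    (congrFun (congrFun (map_matMBar_ev hU hreg hsc hh ⟨X, hX⟩) q) l)) (e1 _)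

end DFT
end

/-! ### Independence of a coordinate, and the limit without winding dependence. -/

noncomputable section

namespace DFT

open Kind Finset Topology Matrix

variable {D : ℕ} {U : Set (Doubled D)} {Φ : Fields D} {Λ : GaugeParam D}

/-- The fields and gauge parameters are independent of the coordinate `N`. -/
structure IndependentOf (U : Set (Doubled D)) (Φ : Fields D) (Λ : GaugeParam D) (N : DIdx D) :
    Prop where
  E : ∀ i j, ∀ X ∈ U, pd N (Φ.E i j) X = 0
  d : ∀ X ∈ U, pd N Φ.d X = 0
  xi : ∀ i, ∀ X ∈ U, pd N (Λ.xi i) X = 0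
  xit : ∀ i, ∀ X ∈ U, pd N (Λ.xit i) X = 0

namespace IndependentOf

variable {N : DIdx D}

/-- Independence of the fields themselves suffices: derivatives inherit it because directional
derivatives commute, products by the Leibniz rule. -/
lemma dir_fieldEl (hN : IndependentOf U Φ Λ N) (hU : IsOpen U)
    (hreg : Regular U Φ Λ) (A : Sc D) (hA : FieldProduct Φ Λ A) :
    (fieldSystem hU hreg).dir (Pi.single N 1) (fieldEl hU hreg A hA) = 0 := by
  have h0 : ∀ A (hA : FieldProduct Φ Λ A), (∀ X ∈ U, pd N A X = 0) →
      (fieldSystem hU hreg).dir (Pi.single N 1) (fieldEl hU hreg A hA) = 0 := fun A hA h => by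
    rw [DFT.dir_fieldEl]
    exact Subtype.ext (funext fun X => h X X.2)
  induction hA with
  | E i j => exact h0 _ _ (hN.E i j)
  | d => exact h0 _ _ hN.d
  | xi i => exact h0 _ _ (hN.xi i)
  | xit i => exact h0 _ _ (hN.xit i)
  | deriv M A hA h => rw [← DFT.dir_fieldEl hU hreg A hA, GenSystem.dir_comm, h, map_zero]
  | mul A B hA hB h h' =>
    have e : fieldEl hU hreg _ (hA.mul A B hB) = fieldEl hU hreg A hA * fieldEl hU hreg B hB := rfl
    rw [e, derivation_mul, h, h', mul_zero, zero_mul, add_zero]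

lemma pd_eq_zero (hN : IndependentOf U Φ Λ N) (hU : IsOpen U)
    (hreg : Regular U Φ Λ) (A : Sc D) (hA : FieldProduct Φ Λ A) (X : Doubled D) (hX : X ∈ U) :
    pd N A X = 0 := by
  have h := hN.dir_fieldEl hU hreg A hA
  rw [DFT.dir_fieldEl] at h
  exact congrArg ((fieldSystem hU hreg).ev ⟨X, hX⟩) h

lemma dir_eq_zero (hN : IndependentOf U Φ Λ N) (hU : IsOpen U)
    (hreg : Regular U Φ Λ) (f : (fieldSystem hU hreg).alg) :
    (fieldSystem hU hreg).dir (Pi.single N 1) f = 0 := by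
  induction f using GenSystem.alg_induction with
  | gen g hg => exact hN.dir_fieldEl hU hreg g hg
  | const r => simp
  | add f g h h' => rw [map_add, h, h', add_zero]
  | mul f g h h' => rw [derivation_mul, h, h', mul_zero, zero_mul, add_zero]
  | inv f g e h =>
    have h1 := derivation_mul ((fieldSystem hU hreg).dir (Pi.single N 1)) f g
    rw [e, h, Derivation.map_one_eq_zero] at h1
    linear_combination (-g) * h1 - ((fieldSystem hU hreg).dir (Pi.single N 1)) g * e

end IndependentOf

lemma pd_eqOn_zero (hU : IsOpen U) {A : Sc D} (hA : ∀ X ∈ U, A X = 0) (M : DIdx D)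
    (X : Doubled D) (hX : X ∈ U) : pd M A X = 0 := by
  have h : A =ᶠ[𝓝 X] fun _ => 0 := by
    filter_upwards [hU.mem_nhds hX] with Y hY using hA Y hY
  rw [pd, h.fderiv_eq]
  simp

lemma strongConstraint_of_inl (hU : IsOpen U) (hreg : Regular U Φ Λ)
    (h : ∀ k, IndependentOf U Φ Λ (.inl k)) : StrongConstraint U Φ Λ := fun A hA X hX =>
  sum_eq_zero fun i _ => (congrArg₂ (· + ·)
    (pd_eqOn_zero hU (fun Y hY => (h i).pd_eq_zero hU hreg A hA Y hY) (.inr i) X hX)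
    ((h i).pd_eq_zero hU hreg _ (hA.deriv (.inr i)) X hX)).trans (add_zero 0)

/-- The dual solution of the strong constraint, needed for the image of the counterexample under x ↔
x̃. -/
lemma strongConstraint_of_inr (hU : IsOpen U) (hreg : Regular U Φ Λ)
    (h : ∀ k, IndependentOf U Φ Λ (.inr k)) : StrongConstraint U Φ Λ := fun A hA X hX =>
  sum_eq_zero fun i _ => (congrArg₂ (· + ·)
    ((h i).pd_eq_zero hU hreg _ (hA.deriv (.inl i)) X hX)
    (pd_eqOn_zero hU (fun Y hY => (h i).pd_eq_zero hU hreg A hA Y hY) (.inl i) X hX)).trans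
      (add_zero 0)

lemma NoWinding.independentOf (h : NoWinding U Φ Λ) (k : Fin D) : IndependentOf U Φ Λ (.inl k) where
  E i j X hX := (h X hX k).1 i j
  d X hX := (h X hX k).2.1
  xi i X hX := (h X hX k).2.2.1 i
  xit i X hX := (h X hX k).2.2.2 i

/-- Without dependence on the winding coordinates the Ricci-like tensor transforms with the
ordinary Lie derivative. -/
theorem hasDerivAt_Ricci_lieXi (hU : IsOpen U) (hreg : Regular U Φ Λ) (hw : NoWinding U Φ Λ)
    (X : Doubled D) (hX : X ∈ U) (p q : Fin D) :
    HasDerivAt (fun t : ℝ => Ricci (gaugeVaried Φ Λ t) p q X) (lieXi Λ (Ricci Φ) p q X) 0 := by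
  have hsc := strongConstraint_of_inl hU hreg hw.independentOf
  refine (hasDerivAt_Ricci_lie hU hreg hsc X hX p q).congr_deriv ?_
  have h1 : ∀ k, pdt k (Ricci Φ p q) X = 0 := fun k => by
    rw [fieldSlice_rel_eq hU hreg hsc (((fieldSlice hU hreg hsc).rel_Ricci p q).pdt k) X hX]
    exact (congrArg _ ((hw.independentOf k).dir_eq_zero hU hreg _)).trans (map_zero _)
  have h2 : ∀ k i, pdt k (Λ.xi i) X = 0 := fun k i => (hw X hX k).2.2.1 i
  have h3 : ∀ k i, pdt k (Λ.xit i) X = 0 := fun k i => (hw X hX k).2.2.2 i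
  simp [lieXit, Tkl, h1, h2, h3]

end DFT

end

/-! ### The counterexample to covariance: flat ℰ, quadratic dilaton, exchange of x and x̃. -/

noncomputable section

namespace DFT

open Kind Finset Topology Matrix

variable {D : ℕ}

/-- Constant `ℰ_{ij} = δ_{ij}` with a dilaton quadratic in the coordinate `N`. -/
def flatFields (N : DIdx D) : Fields D where
  E i j := fun _ => (1 : Matrix (Fin D) (Fin D) ℝ) i j
  d := fun X => X N ^ 2 / 2

/-- The gauge parameter whose only component is the coordinate `N`, in the direction `N`. -/
def dilation (N : DIdx D) : GaugeParam D where
  xi i := fun X => (Pi.single N 1 : Doubled D) (.inr i) * X N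
  xit i := fun X => (Pi.single N 1 : Doubled D) (.inl i) * X N

/-- The components of the frames `𝒟_i` and `𝒟̄_i` of `flatFields` in the direction `N`. -/
def flatFrame (N : DIdx D) : Kind → Fin D → ℝ
  | unb, i => (Pi.single N 1 : Doubled D) (.inr i) - (Pi.single N 1 : Doubled D) (.inl i)
  | bar, i => (Pi.single N 1 : Doubled D) (.inr i) + (Pi.single N 1 : Doubled D) (.inl i)

lemma pd_const (M : DIdx D) (r : ℝ) : pd M (fun _ => r) = fun _ => 0 := by
  funext X
  simp [pd]

lemma pd_mul_coord (M N : DIdx D) (r : ℝ) (X : Doubled D) :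
    pd M (fun X => r * X N) X = r * (Pi.single N 1 : Doubled D) M := by
  have h : HasFDerivAt (fun X : Doubled D => r * X N)
      (r • ContinuousLinearMap.proj (R := ℝ) (φ := fun _ : DIdx D => ℝ) N) X :=
    (ContinuousLinearMap.proj (R := ℝ) (φ := fun _ : DIdx D => ℝ) N).hasFDerivAt.const_mul r
  rw [pd, h.fderiv]
  simp [Pi.single_apply, eq_comm]

lemma pd_flatFields_d (M N : DIdx D) (X : Doubled D) :
    pd M (flatFields N).d X = (Pi.single N 1 : Doubled D) M * X N := by
  have h0 := (ContinuousLinearMap.proj (R := ℝ) (φ := fun _ : DIdx D => ℝ) N).hasFDerivAt (x := X)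
  have h : HasFDerivAt (fun X : Doubled D => X N ^ 2 * 2⁻¹) _ X := (h0.pow 2).mul_const (2⁻¹ : ℝ)
  simp only [pd, flatFields, div_eq_mul_inv]
  rw [h.fderiv]
  simp [Pi.single_apply, eq_comm]

variable (N : DIdx D)

lemma calD_flatFields_const (κ : Kind) (i : Fin D) (r : ℝ) (X : Doubled D) :
    calD (flatFields N) κ i (fun _ => r) X = 0 := by
  cases κ <;> simp [calD, pdx, pdt, pd_const]

lemma calD_flatFields (κ : Kind) (i : Fin D) (f : Sc D) (X : Doubled D) :
    calD (flatFields N) κ i f X = pdx i f X + (match κ with | unb => -1 | bar => 1) * pdt i f X := by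
  cases κ <;> simp [calD, flatFields, Matrix.one_apply, sub_eq_add_neg]

lemma calD_flatFields_mul_coord (κ : Kind) (i : Fin D) (r : ℝ) (X : Doubled D) :
    calD (flatFields N) κ i (fun X => r * X N) X = r * flatFrame N κ i := by
  rw [calD_flatFields, pdx, pdt, pd_mul_coord, pd_mul_coord]
  cases κ <;> simp only [flatFrame] <;> ring

lemma calD_flatFields_d (κ : Kind) (i : Fin D) :
    calD (flatFields N) κ i (flatFields N).d = fun X => flatFrame N κ i * X N := by
  funext X
  rw [calD_flatFields, pdx, pdt, pd_flatFields_d, pd_flatFields_d]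
  cases κ <;> simp only [flatFrame] <;> ring

lemma gMat_flatFields (X : Doubled D) : (flatFields N).gMat X = 1 := by
  ext i j
  simp only [Fields.gMat, flatFields, Matrix.of_apply, Matrix.one_apply, eq_comm]
  split_ifs <;> norm_num

lemma gInv_flatFields (i j : Fin D) (X : Doubled D) :
    (flatFields N).gInv i j X = if i = j then 1 else 0 := by
  rw [Fields.gInv, gMat_flatFields, inv_one, Matrix.one_apply]

lemma calD_flatFields_E (κ : Kind) (i j k : Fin D) (X : Doubled D) :
    calD (flatFields N) κ i ((flatFields N).E j k) X = 0 := calD_flatFields_const N κ i _ X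

lemma Gam_flatFields (κ τ : Kind) (i j k : Fin D) (X : Doubled D) :
    Gam (flatFields N) κ τ i j k X = 0 := by
  cases κ <;> cases τ <;> simp [Gam, calD_flatFields_E]

lemma cov1_flatFields (κ τ : Kind) (i j : Fin D) (V : Fin D → Sc D) (X : Doubled D) :
    cov1 (flatFields N) κ τ i V j X = calD (flatFields N) κ i (V j) X := by
  simp [cov1, Gam_flatFields]

lemma DE_flatFields (κ : Kind) (s p q : Fin D) : DE (flatFields N) κ s p q = fun _ => 0 :=
  funext fun X => calD_flatFields_E N κ s p q X

lemma DEUp_flatFields (κ : Kind) (s p q : Fin D) (X : Doubled D) :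
    DEUp (flatFields N) κ s p q X = 0 := by
  simp [DEUp, calDUp, calD_flatFields_E]

lemma cov3_flatFields (κ τ₀ τ₁ τ₂ κ' : Kind) (i s p q : Fin D) (X : Doubled D) :
    cov3 (flatFields N) κ τ₀ τ₁ τ₂ i (DE (flatFields N) κ') s p q X = 0 := by
  simp [cov3, Gam_flatFields, DE_flatFields, calD_flatFields_const]

/-- Constant ℰ removes all symbols and leaves −2 times the second frame derivative of d, which the
quadratic dilaton makes constant and not identically zero. -/
lemma Ricci_flatFields (p q : Fin D) (X : Doubled D) :
    Ricci (flatFields N) p q X = -2 * (flatFrame N unb p * flatFrame N bar q) := by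
  simp only [Ricci, cov3_flatFields, cov1_flatFields, DE_flatFields, DEUp_flatFields,
    calD_flatFields_d, calD_flatFields_mul_coord, mul_zero, add_zero, sub_zero,
    sum_const_zero]
  ring

lemma eta_flatFields (i : Fin D) :
    eta (flatFields N) (dilation N) i = fun X => flatFrame N unb i * X N := by
  funext X
  simp only [eta, flatFields, dilation, flatFrame, Matrix.one_apply, ite_mul, one_mul, zero_mul,
    sum_ite_eq, mem_univ, if_true]
  ring

lemma etaBar_flatFields (i : Fin D) :
    etaBar (flatFields N) (dilation N) i = fun X => flatFrame N bar i * X N := by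
  funext X
  simp only [etaBar, flatFields, dilation, flatFrame, Matrix.one_apply, ite_mul, one_mul, zero_mul,
    sum_ite_eq', mem_univ, if_true]
  ring

/-- Besides 𝒦 there appears the contraction of an unbarred with a barred frame component, whose sign
depends on whether N is a momentum or a winding coordinate. -/
lemma extraOne_flatFields (p q : Fin D) (X : Doubled D) :
    extraOne (flatFields N) (dilation N) p q X = -2 * (flatFrame N unb p * flatFrame N bar q)
      * ∑ k, flatFrame N unb k * flatFrame N bar k := by
  simp only [extraOne, cov1_flatFields, eta_flatFields, etaBar_flatFields,
    calD_flatFields_mul_coord, Ricci_flatFields, gInv_flatFields, ite_mul, one_mul, zero_mul,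
    sum_ite_eq, mem_univ, if_true, mul_sum]
  exact sum_congr rfl fun k _ => by ring

lemma extraTwo_flatFields (p q : Fin D) (X : Doubled D) :
    extraTwo (flatFields N) (dilation N) p q X = -2 * (flatFrame N unb p * flatFrame N bar q)
      * ∑ k, flatFrame N unb k * flatFrame N bar k := by
  simp only [extraTwo, cov1_flatFields, eta_flatFields, etaBar_flatFields,
    calD_flatFields_mul_coord, Ricci_flatFields, gInv_flatFields, ite_mul, one_mul, zero_mul,
    sum_ite_eq, mem_univ, if_true, mul_sum]
  exact sum_congr rfl fun k _ => by ring

lemma regular_flatFields : Regular Set.univ (flatFields N) (dilation N) where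
  smooth_E _ _ := contDiffOn_const
  smooth_d := by
    simp only [flatFields]
    fun_prop
  smooth_xi i := by
    simp only [dilation]
    fun_prop
  smooth_xit i := by
    simp only [dilation]
    fun_prop
  nondeg X _ := by simp [gMat_flatFields]

lemma independentOf_flatFields (M : DIdx D) (h : M ≠ N) :
    IndependentOf Set.univ (flatFields N) (dilation N) M where
  E i j X _ := congrFun (pd_const M _) X
  d X _ := by simp [pd_flatFields_d, h]
  xi i X _ := by
    simp only [dilation, pd_mul_coord]
    simp [Pi.single_apply, h]
  xit i X _ := by
    simp only [dilation, pd_mul_coord]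
    simp [Pi.single_apply, h]

/-- The transformation exchanging all `x^i` and `x̃_i`. -/
def swapMat (D : ℕ) : DMat D := fromBlocks 0 1 1 0

lemma swapMat_mul_swapMat : swapMat D * swapMat D = 1 := by
  simp [swapMat, fromBlocks_multiply]

lemma isODD_swapMat : IsODD (swapMat D) := by
  have h : (swapMat D)ᵀ = swapMat D := by simp [swapMat, fromBlocks_transpose]
  change (swapMat D)ᵀ * swapMat D * swapMat D = swapMat D
  rw [h, swapMat_mul_swapMat, Matrix.one_mul]

lemma swapMat_mulVec (X : Doubled D) (M : DIdx D) : (swapMat D *ᵥ X) M = X M.swap := by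
  rw [swapMat, fromBlocks_mulVec]
  cases M <;> simp

lemma swapMat_inv : (swapMat D)⁻¹ = swapMat D := inv_eq_left_inv swapMat_mul_swapMat

lemma EMat_flatFields (X : Doubled D) : (flatFields N).EMat X = 1 := rfl

lemma denomMat_swapMat (X : Doubled D) : denomMat (swapMat D) (flatFields N) X = 1 := by
  simp [denomMat, EMat_flatFields, swapMat]

/-- Here c = 1 and e = 0, so M = −ℰ while M̄ = ℰᵗ: only unbarred indices change sign. -/
lemma MMat_swapMat (X : Doubled D) : MMat (swapMat D) (flatFields N) X = -1 := by
  simp [MMat, EMat_flatFields, swapMat]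

lemma MBarMat_swapMat (X : Doubled D) : MBarMat (swapMat D) (flatFields N) X = 1 := by
  simp [MBarMat, EMat_flatFields, swapMat]

lemma actFields_swapMat : actFields (swapMat D) (flatFields N) = flatFields N.swap := by
  simp only [actFields, denomMat_swapMat, EMat_flatFields, swapMat_inv]
  simp only [flatFields, swapMat_mulVec]
  simp [swapMat]

lemma actGauge_swapMat : actGauge (swapMat D) (dilation N) = dilation N.swap := by
  simp only [actGauge, swapMat_inv, swapMat_mulVec]
  cases N <;> simp [dilation, GaugeParam.vec, swapMat_mulVec, Pi.single_apply]

lemma flatFrame_inr (κ : Kind) (z : Fin D) : flatFrame (.inr z) κ z = 1 := by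
  cases κ <;> simp [flatFrame]

lemma flatFrame_inl_unb (z : Fin D) : flatFrame (.inl z) unb z = -1 := by
  simp [flatFrame]

lemma flatFrame_inl_bar (z : Fin D) : flatFrame (.inl z) bar z = 1 := by
  simp [flatFrame]

lemma sum_flatFrame_inr (z : Fin D) :
    ∑ k, flatFrame (.inr z) unb k * flatFrame (.inr z) bar k = 1 := by
  simp [flatFrame, Pi.single_apply]

lemma sum_flatFrame_inl (z : Fin D) :
    ∑ k, flatFrame (.inl z) unb k * flatFrame (.inl z) bar k = -1 := by
  simp [flatFrame, Pi.single_apply]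

/-- An object which is covariant under `swapMat` changes its sign. -/
lemma IsODDTensor.flatFields {T : Fields D → GaugeParam D → Fin D → Fin D → Sc D}
    (hT : IsODDTensor T) (z : Fin D) : T (flatFields (.inr z)) (dilation (.inr z)) z z 0 =
      -T (DFT.flatFields (.inl z)) (dilation (.inl z)) z z 0 := by
  have h := hT Set.univ (DFT.flatFields (.inr z)) (dilation (.inr z)) isOpen_univ
    (regular_flatFields _) (strongConstraint_of_inl isOpen_univ (regular_flatFields _)
      fun k => independentOf_flatFields _ _ (by simp)) (swapMat D) isODD_swapMat
    (fun X _ => by simp [denomMat_swapMat]) 0 (Set.mem_univ _) z z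
  rw [h, actFields_swapMat, actGauge_swapMat, mulVec_zero, MMat_swapMat, MBarMat_swapMat]
  simp [Matrix.one_apply]

lemma not_isODDTensor_extraOne (z : Fin D) : ¬ IsODDTensor (D := D) extraOne := fun h => by
  have h1 := h.flatFields z
  rw [extraOne_flatFields, extraOne_flatFields, sum_flatFrame_inr, sum_flatFrame_inl] at h1
  -- The value is −2 for the momentum and for the winding coordinate alike, whereas covariance
  -- demands opposite values.
  norm_num [flatFrame_inr, flatFrame_inl_unb, flatFrame_inl_bar] at h1

lemma not_isODDTensor_extraTwo (z : Fin D) : ¬ IsODDTensor (D := D) extraTwo := fun h => by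
  have h1 := h.flatFields z
  rw [extraTwo_flatFields, extraTwo_flatFields, sum_flatFrame_inr, sum_flatFrame_inl] at h1
  norm_num [flatFrame_inr, flatFrame_inl_unb, flatFrame_inl_bar] at h1

lemma not_isODDTensor_extra (z : Fin D) : ¬ IsODDTensor (D := D)
    (fun Φ Λ p q X => extraOne Φ Λ p q X + extraTwo Φ Λ p q X) := fun h => by
  have h1 := h.flatFields z
  beta_reduce at h1
  rw [extraOne_flatFields, extraOne_flatFields, extraTwo_flatFields, extraTwo_flatFields,
    sum_flatFrame_inr, sum_flatFrame_inl] at h1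
  norm_num [flatFrame_inr, flatFrame_inl_unb, flatFrame_inl_bar] at h1

/-- Since F is covariant, covariance of δ𝒦 would force the sum of the extra terms to change sign,
but it is −4 for both configurations. -/
lemma not_isODDTensor_deltaRicci (z : Fin D) : ¬ IsODDTensor (D := D) deltaRicci := fun h => by
  have h1 := h.flatFields z
  have h2 := isODDTensor_firstLine.flatFields z
  have h3 := (hasDerivAt_Ricci_split isOpen_univ (regular_flatFields (.inr z))
    (strongConstraint_of_inl isOpen_univ (regular_flatFields _)
      fun k => independentOf_flatFields _ _ (by simp)) 0 (Set.mem_univ _) z z).deriv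
  have h4 := (hasDerivAt_Ricci_split isOpen_univ (regular_flatFields (.inl z))
    (strongConstraint_of_inr isOpen_univ (regular_flatFields _)
      fun k => independentOf_flatFields _ _ (by simp)) 0 (Set.mem_univ _) z z).deriv
  rw [deltaRicci, deltaRicci, h3, h4, h2, extraOne_flatFields, extraOne_flatFields,
    extraTwo_flatFields, extraTwo_flatFields, sum_flatFrame_inr, sum_flatFrame_inl] at h1
  norm_num [flatFrame_inr, flatFrame_inl_unb, flatFrame_inl_bar] at h1
  linarith

end DFT

end

theorem mainTheorem5 (D : ℕ) (hD : 1 ≤ D) :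
    -- the gauge transformation of the Ricci-like tensor and its rewriting
    (∀ (U : Set (DFT.Doubled D)) (Φ : DFT.Fields D) (Λ : DFT.GaugeParam D), IsOpen U →
      DFT.Regular U Φ Λ → DFT.StrongConstraint U Φ Λ → ∀ X ∈ U, ∀ p q : Fin D,
        HasDerivAt (fun t : ℝ => DFT.Ricci (DFT.gaugeVaried Φ Λ t) p q X)
          (DFT.lieXi Λ (DFT.Ricci Φ) p q X + DFT.lieXit Λ (DFT.Ricci Φ) p q X
            + ∑ k, ∑ l, Φ.E p k X * DFT.Tkl Λ k l X * DFT.Ricci Φ l q X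
            + ∑ k, ∑ l, Φ.E l q X * DFT.Tkl Λ k l X * DFT.Ricci Φ p k X) 0 ∧
        HasDerivAt (fun t : ℝ => DFT.Ricci (DFT.gaugeVaried Φ Λ t) p q X)
          (DFT.firstLine Φ Λ p q X + DFT.extraOne Φ Λ p q X + DFT.extraTwo Φ Λ p q X) 0) ∧
    -- the terms of the first line are covariant, the remaining ones and the total are not
    DFT.IsODDTensor (D := D) DFT.firstLine ∧
    ¬ DFT.IsODDTensor (D := D) DFT.extraOne ∧
    ¬ DFT.IsODDTensor (D := D) DFT.extraTwo ∧
    ¬ DFT.IsODDTensor (D := D)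
        (fun Φ Λ p q X => DFT.extraOne Φ Λ p q X + DFT.extraTwo Φ Λ p q X) ∧
    ¬ DFT.IsODDTensor (D := D) DFT.deltaRicci ∧
    -- the limit without dependence on the winding coordinates
    (∀ (U : Set (DFT.Doubled D)) (Φ : DFT.Fields D) (Λ : DFT.GaugeParam D), IsOpen U →
      DFT.Regular U Φ Λ → DFT.NoWinding U Φ Λ → ∀ X ∈ U, ∀ p q : Fin D,
        HasDerivAt (fun t : ℝ => DFT.Ricci (DFT.gaugeVaried Φ Λ t) p q X)
          (DFT.lieXi Λ (DFT.Ricci Φ) p q X) 0) := by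
  -- The counterexamples need one coordinate direction, provided by D ≥ 1.
  have z : Fin D := ⟨0, hD⟩
  exact ⟨fun U Φ Λ hU hreg hsc X hX p q =>
      ⟨DFT.hasDerivAt_Ricci_lie hU hreg hsc X hX p q,
        DFT.hasDerivAt_Ricci_split hU hreg hsc X hX p q⟩,
    DFT.isODDTensor_firstLine, DFT.not_isODDTensor_extraOne z, DFT.not_isODDTensor_extraTwo z,
    DFT.not_isODDTensor_extra z, DFT.not_isODDTensor_deltaRicci z,
    fun U Φ Λ hU hreg hw X hX p q => DFT.hasDerivAt_Ricci_lieXi hU hreg hw X hX p q⟩
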